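/- Work on the two-dimensional torus. For $\beta\in\mathbb R$ let $H^\beta$ be the space of families of Fourier coefficients $\varphi=(\varphi_k)_{k\in\mathbb Z^2\setminus\{0\}}$, $\varphi_k\in\mathbb C$, with $\|\varphi\|_{H^\beta}^2=\sum_{k\ne0}|k|^{2\beta}|\varphi_k|^2<\infty$ ($|k|$ the Euclidean norm), regarded as a real Hilbert space. Let $\mu_2=\bigotimes_{k\neq 0}\mu_2^k$ with $d\mu_2^k(z)=\frac{|k|^2}{2\pi}e^{-\frac12|k|^2|z|^2}\,dx\,dy$, $z=x+iy$; for $\beta<0$ it is a Borel probability measure on $H^\beta$. For $N\in\mathbb N$ let $\Pi_N$ be the projection onto the frequencies $1\le|k|\le N$ and let $(:B:)^N:H^\beta\to H^\beta$ be given by $$(:B:)^N_k(\varphi)=\sum_{l,m\in\mathbb Z^2}\psi_{k-m}\,\psi_{l+m}\,\overline{\psi_l}\;-\;4\Big(\sum_{1\le|m|\le N}\frac1{|m|^2}\Big)\varphi_k,\qquad \psi=\Pi_N\varphi\ \ (\psi_j:=0 \text{ unless } 1\le |j|\le N),$$ for $1\le|k|\le N$, and $(:B:)^N_k(\varphi)=0$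 for $|k|>N$. For a Hilbert space $G$, $HS(\otimes^sH^1,G)$ is the space of continuous real $s$-linear maps $T:(H^1)^s\to G$ with $\|T\|^2=\sum_{j_1,\dots,j_s}\|T(\hat e_{j_1},\dots,\hat e_{j_s})\|_G^2<\infty$, where $(\hat e_j)$ is an orthonormal basis of the real Hilbert space $H^1$ (so $HS(\otimes^0H^1,G)=G$). A map $F':H^\beta\to HS(\otimes^{s+1}H^1,G)$ is the Malliavin gradient of $F:H^\beta\to HS(\otimes^sH^1,G)$ if for every $v\in H^1$ the map $F$ has a $\mu_2$-version that is absolutely continuous on bounded intervals of every line parallel to $v$ and satisfies, for $\mu_2$-a.e. $\varphi$, $$\lim_{\varepsilon\to0}\tfrac1\varepsilon\big(F(\varphi+\varepsilon v)-F(\varphi)\big)=F'(\varphi)(v,\cdot)\quad\text{in } HS(\otimes^sH^1,G).$$ Put $\nabla^0F=F$, and let $\nabla^{s+1}F$ be the gradient of $\nabla^sF$. For $r\in\mathbb N$ and $1\le p<\infty$, $W^p_r(H^\beta;G)$ consists of the maps $F\in L^p(\mu_2;G)$ for which $\nabla^sF$ exists and belongs to $L^p(\mu_2;HS(\otimes^sH^1,G))$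 for $1\le s\le r$. Let $W_\infty(H^\beta)=\bigcap_{r\in\mathbb N,\,1\le p<\infty}W^p_r(H^\beta;H^\beta)$. **Proposition.** Let $\beta<0$. The sequence $(:B:)^N$ converges as $N\to\infty$, in $L^p(\mu_2;H^\beta)$ for every integer $p\ge1$, to a map $:B:\,:H^\beta\to H^\beta$ (unique up to $\mu_2$-a.e. equality). All iterated gradients $\nabla^s:B:$, $s\in\mathbb N$, exist, and $$\nabla^s:B:\ \in L^p\big(\mu_2;HS(\otimes^sH^1,H^\beta)\big)\qquad\text{for every } s\in\mathbb N \text{ and every integer } p\ge1.$$ Hence $:B:$ belongs to the Malliavin–Sobolev space $W_\infty(H^\beta)$. -/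

import Mathlib

open MeasureTheory Filter Topology
open scoped ENNReal

noncomputable section

/-! ## Sobolev spaces on the two-dimensional torus, in Fourier coordinates -/

/-- The nonzero frequencies `k ∈ ℤ² \ {0}`. -/
abbrev Mode : Type := {k : ℤ × ℤ // k ≠ 0}

/-- `|k|² = k₁² + k₂²`. -/
def freqSq (k : ℤ × ℤ) : ℝ := (k.1 : ℝ) ^ 2 + (k.2 : ℝ) ^ 2

/-- The Euclidean length `|k|`. -/
def freqNorm (k : ℤ × ℤ) : ℝ := Real.sqrt (freqSq k)

theorem freqSq_pos (k : Mode) : 0 < freqSq k := by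
  obtain ⟨⟨a, b⟩, h⟩ := k
  simp only [freqSq]
  by_cases ha : a = 0
  · have hb : b ≠ 0 := by
      rintro rfl
      exact h (by rw [ha]; rfl)
    have : (0 : ℝ) < (b : ℝ) ^ 2 := by positivity
    positivity
  · have : (0 : ℝ) < (a : ℝ) ^ 2 := by positivity
    positivity

theorem freqNorm_pos (k : Mode) : 0 < freqNorm k := Real.sqrt_pos.2 (freqSq_pos k)

theorem one_le_freqNorm (k : Mode) : 1 ≤ freqNorm k := by
  rw [freqNorm, Real.one_le_sqrt]
  have h := freqSq_pos k
  have h2 : freqSq k = (((k.1.1 ^ 2 + k.1.2 ^ 2 : ℤ)) : ℝ) := by simp [freqSq]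
  rw [h2] at h ⊢
  exact_mod_cast h

/-- The families `φ = (φ_k)_{k ≠ 0}` of Fourier coefficients with `∑ |k|^{2β} |φ_k|² < ∞`. -/
def sobolevSubmodule (β : ℝ) : Submodule ℝ (Mode → ℂ) where
  carrier := {φ | Memℓp (fun k : Mode => freqNorm k ^ β • φ k) 2}
  add_mem' {φ ψ} hφ hψ := by
    have h := Memℓp.add hφ hψ
    have e : (fun k : Mode => freqNorm k ^ β • (φ + ψ) k)
        = (fun k : Mode => freqNorm k ^ β • φ k) + fun k : Mode => freqNorm k ^ β • ψ k := by
      funext k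
      simp
    rw [Set.mem_ofPred_eq, e]
    exact h
  zero_mem' := by
    have e : (fun k : Mode => freqNorm k ^ β • (0 : Mode → ℂ) k) = 0 := by
      funext k
      simp
    rw [Set.mem_ofPred_eq, e]
    exact zero_memℓp
  smul_mem' c φ hφ := by
    have h := Memℓp.const_smul (𝕜 := ℝ) hφ c
    have e : (fun k : Mode => freqNorm k ^ β • (c • φ) k)
        = c • fun k : Mode => freqNorm k ^ β • φ k := by
      funext k
      simp only [Pi.smul_apply]
      rw [smul_comm]
    rw [Set.mem_ofPred_eq, e]
    exact h

/-- The Sobolev space `H^β` of mean-zero (generalized) functions on the two-dimensional torus;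
an element is identified with the family of its Fourier coefficients. -/
def Hs (β : ℝ) : Type := sobolevSubmodule β

namespace Hs

variable {β : ℝ}

instance : AddCommGroup (Hs β) := inferInstanceAs (AddCommGroup (sobolevSubmodule β))

instance : Module ℝ (Hs β) := inferInstanceAs (Module ℝ (sobolevSubmodule β))

/-- The Fourier coefficients of `φ ∈ H^β`. -/
def coeff (φ : Hs β) : Mode → ℂ := φ.1

/-- The map `φ ↦ (|k|^β φ_k)_k` from `H^β` to `ℓ²`. -/
def toLp2 (β : ℝ) : Hs β →ₗ[ℝ] lp (fun _ : Mode => ℂ) 2 where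
  toFun φ := ⟨fun k : Mode => freqNorm k ^ β • φ.coeff k, φ.2⟩
  map_add' φ ψ := by
    apply Subtype.ext
    funext k
    exact smul_add (freqNorm k ^ β) (φ.coeff k) (ψ.coeff k)
  map_smul' c φ := by
    apply Subtype.ext
    funext k
    exact smul_comm (freqNorm k ^ β) c (φ.coeff k)

theorem toLp2_injective (β : ℝ) : Function.Injective (toLp2 β) := by
  intro φ ψ h
  apply Subtype.ext
  funext k
  have hk : freqNorm k ^ β • φ.coeff k = freqNorm k ^ β • ψ.coeff k :=
    congrFun (congrArg Subtype.val h) k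
  exact smul_right_injective ℂ (Real.rpow_pos_of_pos (freqNorm_pos k) β).ne' hk

/-- The norm `‖φ‖² = ∑ |k|^{2β} |φ_k|²`. -/
instance : NormedAddCommGroup (Hs β) :=
  NormedAddCommGroup.induced (Hs β) _ (toLp2 β) (toLp2_injective β)

/-- `H^β` as a real Hilbert space, with `⟪φ, ψ⟫ = Re ∑ |k|^{2β} conj(φ_k) ψ_k`. -/
instance : InnerProductSpace ℝ (Hs β) := InnerProductSpace.induced (toLp2 β)

instance : MeasurableSpace (Hs β) := borel (Hs β)

instance : BorelSpace (Hs β) := ⟨rfl⟩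

theorem coeff_add (φ ψ : Hs β) : (φ + ψ).coeff = φ.coeff + ψ.coeff := rfl

theorem coeff_smul (c : ℝ) (φ : Hs β) : (c • φ).coeff = c • φ.coeff := rfl

theorem ext_coeff {φ ψ : Hs β} (h : φ.coeff = ψ.coeff) : φ = ψ := Subtype.ext h

/-- `φ ↦ (|k|^β φ_k)_k` is an isometric isomorphism onto `ℓ²`. -/
def equivLp2 (β : ℝ) : Hs β ≃ₗᵢ[ℝ] lp (fun _ : Mode => ℂ) 2 where
  toLinearEquiv := LinearEquiv.ofBijective (toLp2 β) ⟨toLp2_injective β, by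
    intro f
    have e : (fun k : Mode => freqNorm k ^ β • ((freqNorm k ^ β)⁻¹ • (f : Mode → ℂ) k))
        = (f : Mode → ℂ) := by
      funext k
      exact smul_inv_smul₀ (Real.rpow_pos_of_pos (freqNorm_pos k) β).ne' _
    refine ⟨⟨fun k : Mode => (freqNorm k ^ β)⁻¹ • (f : Mode → ℂ) k, ?_⟩, ?_⟩
    · change Memℓp _ 2
      rw [e]
      exact f.2
    · exact Subtype.ext e⟩
  norm_map' _ := rfl

instance : CompleteSpace (Hs β) :=
  (equivLp2 β).toIsometryEquiv.completeSpace

/-- A finitely supported family of Fourier coefficients, as an element of `H^β`. -/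
def ofFinite (β : ℝ) (c : Mode → ℂ) (hc : (Function.support c).Finite) : Hs β :=
  ⟨c, (memℓp_zero (hc.subset (fun k (hk : freqNorm k ^ β • c k ≠ 0) =>
    right_ne_zero_of_smul hk))).of_exponent_ge zero_le⟩

/-- The inclusion `H^α ⊆ H^β` for `β ≤ α`. -/
def incl {α β : ℝ} (h : β ≤ α) : Hs α →ₗ[ℝ] Hs β where
  toFun φ := ⟨φ.coeff, Memℓp.mono' φ.2 (fun k : Mode => by
    rw [norm_smul, norm_smul]
    refine mul_le_mul_of_nonneg_right ?_ (norm_nonneg _)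
    rw [Real.norm_of_nonneg (Real.rpow_nonneg (freqNorm_pos k).le _),
      Real.norm_of_nonneg (Real.rpow_nonneg (freqNorm_pos k).le _)]
    exact Real.rpow_le_rpow_of_exponent_le (one_le_freqNorm k) h)⟩
  map_add' _ _ := rfl
  map_smul' _ _ := rfl

/-- The vectors `|k|^{-β} e_k` (second index `0`) and `i |k|^{-β} e_k` (second index `1`), where
`e_k` is the family with a single nonzero coefficient, equal to `1`, at `k`. -/
def basisVec (β : ℝ) (q : Mode × Fin 2) : Hs β :=
  ofFinite β (Pi.single q.1 ((freqNorm q.1 ^ β)⁻¹ • Complex.basisOneI q.2))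
    ((Set.finite_singleton q.1).subset Pi.support_single_subset)

theorem equivLp2_basisVec (β : ℝ) (q : Mode × Fin 2) :
    equivLp2 β (basisVec β q) = lp.single 2 q.1 (Complex.basisOneI q.2) := by
  apply Subtype.ext
  funext k
  change freqNorm k ^ β • (Pi.single q.1 ((freqNorm q.1 ^ β)⁻¹ • Complex.basisOneI q.2) :
    Mode → ℂ) k = _
  by_cases h : k = q.1
  · subst h
    simp [smul_smul, mul_inv_cancel₀ (Real.rpow_pos_of_pos (freqNorm_pos q.1) β).ne',
      -Complex.real_smul]
  · simp [h]

theorem inner_basisVec (q : Mode × Fin 2) (φ : Hs β) :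
    inner ℝ (basisVec β q) φ =
      inner ℝ (Complex.basisOneI q.2) (freqNorm q.1 ^ β • φ.coeff q.1) := by
  rw [← (equivLp2 β).inner_map_map, equivLp2_basisVec, lp.inner_single_left]
  rfl

theorem orthonormal_basisVec (β : ℝ) : Orthonormal ℝ (basisVec β) := by
  classical
  rw [orthonormal_iff_ite]
  rintro ⟨k, a⟩ ⟨l, b⟩
  rw [← (equivLp2 β).inner_map_map, equivLp2_basisVec, equivLp2_basisVec, lp.inner_single_left]
  by_cases h : k = l
  · subst h
    fin_cases a <;> fin_cases b <;> simp [Complex.inner]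
  · simp [h]

/-- The Fourier basis of the real Hilbert space `H^β`. -/
def basis (β : ℝ) : HilbertBasis (Mode × Fin 2) ℝ (Hs β) :=
  HilbertBasis.mkOfOrthogonalEqBot (orthonormal_basisVec β) (by
    rw [Submodule.eq_bot_iff]
    intro φ hφ
    rw [Submodule.mem_orthogonal] at hφ
    apply ext_coeff
    funext k
    have hp : freqNorm k ^ β ≠ 0 := (Real.rpow_pos_of_pos (freqNorm_pos k) β).ne'
    have h0 := hφ _ (Submodule.subset_span ⟨(k, 0), rfl⟩)
    have h1 := hφ _ (Submodule.subset_span ⟨(k, 1), rfl⟩)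
    rw [inner_basisVec] at h0 h1
    change φ.coeff k = 0
    apply Complex.ext
    · simpa [Complex.inner, hp] using h0
    · simpa [Complex.inner, hp] using h1)

end Hs

/-! ## Hilbert–Schmidt maps on tensor powers -/

section HilbertSchmidt

variable {ι H : Type} [NormedAddCommGroup H] [InnerProductSpace ℝ H]

theorem multilinear_eq_zero_of_basis (b : HilbertBasis ι ℝ H) {s : ℕ} {G : Type}
    [NormedAddCommGroup G] [NormedSpace ℝ G]
    (T : ContinuousMultilinearMap ℝ (fun _ : Fin s => H) G)
    (hT : ∀ j : Fin s → ι, T (fun i => b (j i)) = 0) : T = 0 := by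
  classical
  have key : ∀ A : Finset (Fin s), ∀ m : Fin s → H,
      (∀ i, i ∉ A → ∃ a, m i = b a) → T m = 0 := by
    intro A
    induction A using Finset.induction_on with
    | empty =>
      intro m hm
      choose j hj using fun i => hm i (Finset.notMem_empty i)
      have : m = fun i => b (j i) := funext hj
      rw [this]
      exact hT j
    | insert i A hi ih =>
      intro m hm
      have hz : T.toContinuousLinearMap m i = 0 := by
        apply ContinuousLinearMap.ext_on (s := Set.range b)
        · rw [dense_iff_closure_eq, ← Submodule.topologicalClosure_coe, b.dense_span]
          rfl
        · rintro _ ⟨a, rfl⟩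
          change T (Function.update m i (b a)) = 0
          apply ih
          intro i' hi'
          by_cases h : i' = i
          · subst h
            exact ⟨a, by simp⟩
          · rw [Function.update_of_ne h]
            exact hm i' (by simp [h, hi'])
      have := congrArg (fun L : H →L[ℝ] G => L (m i)) hz
      simpa using this
  ext m
  exact key Finset.univ m (fun i hi => absurd (Finset.mem_univ i) hi)

/-- The continuous `s`-linear maps `T : H × ⋯ × H → G` whose squared norms on the basis,
`‖T(b_{j₁}, …, b_{j_s})‖²`, are summable. -/
def hilbertSchmidtSubmodule (b : HilbertBasis ι ℝ H) (s : ℕ) (G : Type)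
    [NormedAddCommGroup G] [NormedSpace ℝ G] :
    Submodule ℝ (ContinuousMultilinearMap ℝ (fun _ : Fin s => H) G) where
  carrier := {T | Memℓp (fun j : Fin s → ι => T (fun i => b (j i))) 2}
  add_mem' hS hT := Memℓp.add hS hT
  zero_mem' := zero_memℓp
  smul_mem' c _ hT := Memℓp.const_smul hT c

/-- The space `HS(⊗^s H, G)` of Hilbert–Schmidt operators, realized as `s`-linear maps; for
`s = 0` it is `G`. -/
def HS (b : HilbertBasis ι ℝ H) (s : ℕ) (G : Type)
    [NormedAddCommGroup G] [NormedSpace ℝ G] : Type :=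
  hilbertSchmidtSubmodule b s G

namespace HS

variable {b : HilbertBasis ι ℝ H} {s : ℕ} {G : Type} [NormedAddCommGroup G] [NormedSpace ℝ G]

instance : AddCommGroup (HS b s G) := inferInstanceAs (AddCommGroup (hilbertSchmidtSubmodule b s G))

instance : Module ℝ (HS b s G) := inferInstanceAs (Module ℝ (hilbertSchmidtSubmodule b s G))

/-- The underlying multilinear map. -/
def toMultilinear (T : HS b s G) : ContinuousMultilinearMap ℝ (fun _ : Fin s => H) G := T.1

/-- The matrix `(T(b_{j₁}, …, b_{j_s}))_j`. -/
def toLp2 : HS b s G →ₗ[ℝ] lp (fun _ : Fin s → ι => G) 2 where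
  toFun T := ⟨fun j => T.toMultilinear (fun i => b (j i)), T.2⟩
  map_add' _ _ := rfl
  map_smul' _ _ := rfl

theorem toLp2_injective : Function.Injective (toLp2 : HS b s G →ₗ[ℝ] _) := by
  rw [← LinearMap.ker_eq_bot, LinearMap.ker_eq_bot']
  intro T hT
  exact Subtype.ext (multilinear_eq_zero_of_basis b T.toMultilinear
    (fun j => congrFun (congrArg Subtype.val hT) j))

/-- The Hilbert–Schmidt norm `‖T‖² = ∑_j ‖T(b_{j₁}, …, b_{j_s})‖²`. -/
instance : NormedAddCommGroup (HS b s G) :=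
  NormedAddCommGroup.induced (HS b s G) _ toLp2 toLp2_injective

instance : NormedSpace ℝ (HS b s G) := NormedSpace.induced ℝ (HS b s G) _ toLp2

end HS

/-! ## Malliavin derivatives and Sobolev spaces over `(X, H, μ)` -/

variable {X G : Type} [AddCommGroup X] [Module ℝ X] [MeasurableSpace X]
  [NormedAddCommGroup G] [NormedSpace ℝ G]

/-- `F'` is the Malliavin gradient of `F`. Here `H` is the Cameron–Martin space, embedded by `ι₀`
in `X`, the functional `F` takes values in `HS(⊗^s H, G)`, and
`F' : X → HS(⊗^{s+1} H, G) = HS(H, HS(⊗^s H, G))`. For every direction `v ∈ H` the functional `F`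
has a version that is absolutely continuous along the lines parallel to `v` and such that, for
almost every `x`, the limit of `(F(x + ε v) - F(x)) / ε` as `ε → 0` exists in `HS(⊗^s H, G)` and
is the contraction `F'(x)(v, ·)`. -/
def IsMalliavinGradient (b : HilbertBasis ι ℝ H) (ι₀ : H →ₗ[ℝ] X) (μ : Measure X) {s : ℕ}
    (F : X → HS b s G) (F' : X → HS b (s + 1) G) : Prop :=
  ∀ v : H, ∃ Fv : X → HS b s G, Fv =ᵐ[μ] F ∧
    (∀ (x : X) (t₀ t₁ : ℝ),
      AbsolutelyContinuousOnInterval (fun t : ℝ => Fv (x + t • ι₀ v)) t₀ t₁) ∧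
    ∀ᵐ x ∂μ, ∃ L : HS b s G,
      (∀ w : Fin s → H, L.toMultilinear w = (F' x).toMultilinear (Fin.cons v w)) ∧
      Tendsto (fun ε : ℝ => ε⁻¹ • (Fv (x + ε • ι₀ v) - Fv x)) (𝓝[≠] 0) (𝓝 L)

/-- `D 0, D 1, …, D r` are the iterated gradients `F = ∇^0 F, ∇^1 F, …, ∇^r F` of `F : X → G`. -/
def IsIteratedGradient (b : HilbertBasis ι ℝ H) (ι₀ : H →ₗ[ℝ] X) (μ : Measure X)
    (F : X → G) (r : ℕ) (D : ∀ s : ℕ, X → HS b s G) : Prop :=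
  (∀ᵐ x ∂μ, ∀ w : Fin 0 → H, (D 0 x).toMultilinear w = F x) ∧
    ∀ s < r, IsMalliavinGradient b ι₀ μ (D s) (D (s + 1))

/-- The Malliavin–Sobolev space `W_r^p(X; G)`. -/
def MemW (b : HilbertBasis ι ℝ H) (ι₀ : H →ₗ[ℝ] X) (μ : Measure X) (r : ℕ) (p : ℝ≥0∞)
    (F : X → G) : Prop :=
  MemLp F p μ ∧ ∃ D : ∀ s : ℕ, X → HS b s G, IsIteratedGradient b ι₀ μ F r D ∧
    ∀ s, 1 ≤ s → s ≤ r → MemLp (D s) p μ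

/-- `W_∞(X; G)`, the intersection of all `W_r^p(X; G)` with `r ∈ ℕ` and `1 ≤ p < ∞`. -/
def MemWInfty (b : HilbertBasis ι ℝ H) (ι₀ : H →ₗ[ℝ] X) (μ : Measure X) (F : X → G) : Prop :=
  ∀ (r : ℕ) (p : ℝ≥0∞), 1 ≤ p → p ≠ ∞ → MemW b ι₀ μ r p F

end HilbertSchmidt

/-! ## The Gaussian measure `μ₂` -/

/-- The law of the `k`-th Fourier coefficient: the measure on `ℂ` with density
`|k|² / (2π) · exp(-|k|² |z|² / 2)`. -/
def modeLaw (k : Mode) : Measure ℂ :=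
  volume.withDensity fun z =>
    ENNReal.ofReal (freqSq k / (2 * Real.pi) * Real.exp (-(freqSq k * ‖z‖ ^ 2) / 2))

theorem modeLaw_integral (k : Mode) :
    ∫ z : ℂ, freqSq k / (2 * Real.pi) * Real.exp (-(freqSq k * ‖z‖ ^ 2) / 2) = 1 := by
  have hk := freqSq_pos k
  have h := Complex.integral_exp_neg_mul_rpow (p := 2) (b := freqSq k / 2) one_le_two (by positivity)
  have e : ∀ z : ℂ, Real.exp (-(freqSq k * ‖z‖ ^ 2) / 2)
      = Real.exp (-(freqSq k / 2) * ‖z‖ ^ (2 : ℝ)) := by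
    intro z
    rw [Real.rpow_two]
    congr 1
    ring
  simp_rw [e]
  rw [integral_const_mul, h]
  norm_num [Real.rpow_neg_one, Real.Gamma_two]
  field_simp

instance (k : Mode) : IsProbabilityMeasure (modeLaw k) := by
  constructor
  have hk := freqSq_pos k
  rw [modeLaw, withDensity_apply _ MeasurableSet.univ, Measure.restrict_univ,
    ← ofReal_integral_eq_lintegral_ofReal, modeLaw_integral, ENNReal.ofReal_one]
  · by_contra hn
    have := modeLaw_integral k
    rw [integral_undef hn] at this
    exact zero_ne_one this
  · exact ae_of_all _ fun z => by positivity

/-- The product measure `⨂_{k ≠ 0} μ₂^k` on all families of Fourier coefficients. -/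
def coeffLaw : Measure (Mode → ℂ) := Measure.infinitePi modeLaw

/-- The Gaussian measure `μ₂` on `H^β`, `β < 0`: the restriction of the product measure, which is
concentrated on the families that belong to `H^β`. -/
def gaussianMeasure (β : ℝ) : Measure (Hs β) := coeffLaw.comap Hs.coeff

theorem lintegral_modeLaw_sq (k : Mode) :
    ∫⁻ z, ENNReal.ofReal (‖z‖ ^ 2) ∂(modeLaw k) = ENNReal.ofReal (2 / freqSq k) := by
  have hk := freqSq_pos k
  have h := Complex.integral_rpow_mul_exp_neg_mul_rpow (p := 2) (q := 2) (b := freqSq k / 2)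
    one_le_two (by norm_num) (by positivity)
  have hI : ∫ z : ℂ, freqSq k / (2 * Real.pi) * Real.exp (-(freqSq k * ‖z‖ ^ 2) / 2) * ‖z‖ ^ 2
      = 2 / freqSq k := by
    have e : ∀ z : ℂ, freqSq k / (2 * Real.pi) * Real.exp (-(freqSq k * ‖z‖ ^ 2) / 2) * ‖z‖ ^ 2
        = freqSq k / (2 * Real.pi) *
          (‖z‖ ^ (2 : ℝ) * Real.exp (-(freqSq k / 2) * ‖z‖ ^ (2 : ℝ))) := by
      intro z
      have : -(freqSq k * ‖z‖ ^ 2) / 2 = -(freqSq k / 2) * ‖z‖ ^ 2 := by ring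
      rw [Real.rpow_two, this]
      ring
    simp_rw [e]
    rw [integral_const_mul, h]
    have e1 : (-(2 + 2) / 2 : ℝ) = -(2 : ℕ) := by norm_num
    have e2 : ((2 + 2) / 2 : ℝ) = 2 := by norm_num
    rw [e1, e2, Real.rpow_neg (by positivity), Real.rpow_natCast, Real.Gamma_two]
    field_simp
  rw [modeLaw, lintegral_withDensity_eq_lintegral_mul _ (by fun_prop) (by fun_prop), ← hI,
    ofReal_integral_eq_lintegral_ofReal]
  · refine lintegral_congr fun z => ?_
    rw [Pi.mul_apply, ← ENNReal.ofReal_mul (by positivity)]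
  · by_contra hn
    rw [integral_undef hn] at hI
    have : 0 < 2 / freqSq k := by positivity
    exact this.ne hI
  · exact ae_of_all _ fun z => by positivity

theorem Hs.measurable_coeff (β : ℝ) : Measurable (Hs.coeff : Hs β → Mode → ℂ) := by
  rw [measurable_pi_iff]
  intro k
  have hp : freqNorm k ^ β ≠ 0 := (Real.rpow_pos_of_pos (freqNorm_pos k) β).ne'
  have e : (fun φ : Hs β => φ.coeff k)
      = fun φ : Hs β => (freqNorm k ^ β)⁻¹ • (Hs.equivLp2 β φ : Mode → ℂ) k := by
    funext φ
    exact (inv_smul_smul₀ hp _).symm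
  rw [e]
  apply Continuous.measurable
  have h1 : Continuous fun f : lp (fun _ : Mode => ℂ) 2 => (f : Mode → ℂ) k := by
    refine AddMonoidHomClass.continuous_of_bound
      (⟨⟨fun f : lp (fun _ : Mode => ℂ) 2 => (f : Mode → ℂ) k, rfl⟩, fun _ _ => rfl⟩ :
        lp (fun _ : Mode => ℂ) 2 →+ ℂ) 1 fun f => ?_
    rw [one_mul]
    exact lp.norm_apply_le_norm two_ne_zero f k
  have h2 : Continuous fun φ : Hs β => ((Hs.equivLp2 β φ : Mode → ℂ) k : ℂ) :=
    h1.comp (Hs.equivLp2 β).continuous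
  exact h2.const_smul ((freqNorm k ^ β)⁻¹)

instance (β : ℝ) : SecondCountableTopology (Hs β) := by
  have : TopologicalSpace.SeparableSpace (Hs β) := by
    rw [← TopologicalSpace.isSeparable_univ_iff]
    have h := (Hs.basis β).dense_span
    have h2 : (Set.univ : Set (Hs β)) =
        closure (Submodule.span ℝ (Set.range (Hs.basis β)) : Set (Hs β)) := by
      rw [← Submodule.topologicalClosure_coe, h]
      rfl
    rw [h2]
    exact ((Set.countable_range _).isSeparable.span (R := ℝ)).closure
  exact UniformSpace.secondCountable_of_separable _

theorem Hs.measurableEmbedding_coeff (β : ℝ) :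
    MeasurableEmbedding (Hs.coeff : Hs β → Mode → ℂ) :=
  (Hs.measurable_coeff β).measurableEmbedding fun _ _ h => Hs.ext_coeff h

theorem summable_freqNorm {β : ℝ} (hβ : β < 0) :
    Summable fun k : Mode => (freqNorm k ^ β) ^ 2 * (2 / freqSq k) := by
  have h := (EisensteinSeries.summable_one_div_norm_rpow (k := 2 - 2 * β) (by linarith))
  have h3 := (h.comp_injective (i := fun k : Mode => ![k.1.1, k.1.2]) (by
    intro a b hab
    have h0 := congrFun hab 0
    have h1 := congrFun hab 1
    exact Subtype.ext (Prod.ext (by simpa using h0) (by simpa using h1)))).mul_left 2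
  refine Summable.of_nonneg_of_le (fun k => ?_) (fun k => ?_) h3
  · have := freqSq_pos k
    positivity
  · have hp := freqNorm_pos k
    have hs := freqSq_pos k
    have e : (freqNorm k ^ β) ^ 2 * (2 / freqSq k) = 2 * freqNorm k ^ (-(2 - 2 * β)) := by
      have : freqSq k = freqNorm k ^ (2 : ℝ) := by
        rw [Real.rpow_two, freqNorm, Real.sq_sqrt hs.le]
      rw [this, neg_sub, Real.rpow_sub hp, ← Real.rpow_natCast, ← Real.rpow_mul hp.le]
      rw [mul_comm β]
      push_cast
      ring
    rw [e]
    refine mul_le_mul_of_nonneg_left ?_ zero_le_two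
    have hle : ‖(![k.1.1, k.1.2] : Fin 2 → ℤ)‖ ≤ freqNorm k := by
      rw [pi_norm_le_iff_of_nonneg hp.le]
      intro i
      rw [freqNorm]
      apply Real.le_sqrt_of_sq_le
      fin_cases i
      · simp [freqSq, Int.norm_eq_abs]
        positivity
      · simp [freqSq, Int.norm_eq_abs]
        positivity
    have hpos : 0 < ‖(![k.1.1, k.1.2] : Fin 2 → ℤ)‖ := by
      rw [norm_pos_iff]
      intro h0
      refine k.2 (Prod.ext ?_ ?_)
      · simpa using congrFun h0 0
      · simpa using congrFun h0 1
    exact Real.rpow_le_rpow_of_nonpos hpos hle (by linarith)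

/-- For `β < 0` almost every family of coefficients belongs to `H^β`. -/
theorem isProbabilityMeasure_gaussianMeasure {β : ℝ} (hβ : β < 0) :
    IsProbabilityMeasure (gaussianMeasure β) := by
  have hP : IsProbabilityMeasure coeffLaw := by
    unfold coeffLaw
    infer_instance
  constructor
  rw [gaussianMeasure, (Hs.measurableEmbedding_coeff β).comap_apply, Set.image_univ]
  have hm : ∀ k : Mode, AEMeasurable
      (fun c : Mode → ℂ => ENNReal.ofReal ((freqNorm k ^ β) ^ 2 * ‖c k‖ ^ 2)) coeffLaw := by
    intro k
    have : Measurable fun c : Mode → ℂ => ‖c k‖ ^ 2 := by fun_prop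
    exact (this.const_mul _).ennreal_ofReal.aemeasurable
  have hae : ∀ᵐ c ∂coeffLaw, c ∈ Set.range (Hs.coeff : Hs β → Mode → ℂ) := by
    have hfin : ∫⁻ c, ∑' k : Mode, ENNReal.ofReal ((freqNorm k ^ β) ^ 2 * ‖c k‖ ^ 2) ∂coeffLaw
        ≠ ∞ := by
      rw [lintegral_tsum hm]
      have e : ∀ k : Mode, ∫⁻ c, ENNReal.ofReal ((freqNorm k ^ β) ^ 2 * ‖c k‖ ^ 2) ∂coeffLaw
          = ENNReal.ofReal ((freqNorm k ^ β) ^ 2 * (2 / freqSq k)) := by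
        intro k
        have h1 : ∫⁻ c, ENNReal.ofReal (‖c k‖ ^ 2) ∂coeffLaw
            = ENNReal.ofReal (2 / freqSq k) := by
          rw [← lintegral_modeLaw_sq k]
          exact (measurePreserving_eval_infinitePi modeLaw k).lintegral_comp
            (f := fun z : ℂ => ENNReal.ofReal (‖z‖ ^ 2)) (by fun_prop)
        simp_rw [ENNReal.ofReal_mul (sq_nonneg (freqNorm _ ^ β))]
        rw [lintegral_const_mul _ (by fun_prop), h1]
      simp_rw [e]
      exact (summable_freqNorm hβ).tsum_ofReal_ne_top
    have := ae_lt_top' (AEMeasurable.tsum hm) hfin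
    filter_upwards [this] with c hc
    refine ⟨⟨c, ?_⟩, rfl⟩
    change Memℓp (fun k : Mode => freqNorm k ^ β • c k) 2
    apply memℓp_gen
    have hs := ENNReal.summable_toReal hc.ne
    refine hs.congr fun k => ?_
    rw [ENNReal.toReal_ofReal (by positivity), norm_smul,
      Real.norm_of_nonneg (Real.rpow_nonneg (freqNorm_pos k).le _)]
    simp [mul_pow]
  exact (mem_ae_iff_prob_eq_one (Hs.measurableEmbedding_coeff β).measurableSet_range).1 hae

/-! ## The renormalized cubic nonlinearity -/

/-- The frequencies `k` with `1 ≤ |k| ≤ N`. -/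
def freqBall (N : ℕ) : Finset (ℤ × ℤ) :=
  (Finset.Icc (-(N : ℤ)) N ×ˢ Finset.Icc (-(N : ℤ)) N).filter
    fun k => k ≠ 0 ∧ k.1 ^ 2 + k.2 ^ 2 ≤ (N : ℤ) ^ 2

theorem mem_freqBall {N : ℕ} {k : ℤ × ℤ} : k ∈ freqBall N ↔ k ≠ 0 ∧ freqNorm k ≤ N := by
  have e : freqNorm k ≤ N ↔ k.1 ^ 2 + k.2 ^ 2 ≤ (N : ℤ) ^ 2 := by
    rw [freqNorm, Real.sqrt_le_left (Nat.cast_nonneg N), freqSq]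
    exact_mod_cast Iff.rfl
  rw [freqBall, Finset.mem_filter, e]
  refine ⟨fun h => h.2, fun h => ⟨?_, h⟩⟩
  have h1 : |k.1| ≤ (N : ℤ) := abs_le_of_sq_le_sq (by nlinarith [h.2, sq_nonneg k.2]) (by positivity)
  have h2 : |k.2| ≤ (N : ℤ) := abs_le_of_sq_le_sq (by nlinarith [h.2, sq_nonneg k.1]) (by positivity)
  simp only [Finset.mem_product, Finset.mem_Icc]
  exact ⟨abs_le.1 h1, abs_le.1 h2⟩

/-- The coefficients of the truncation `Π_N φ`, indexed by all of `ℤ²`: equal to `φ_k` if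
`1 ≤ |k| ≤ N`, and `0` otherwise. -/
def truncCoeff {β : ℝ} (N : ℕ) (φ : Hs β) (k : ℤ × ℤ) : ℂ :=
  if h : k ∈ freqBall N then φ.coeff ⟨k, (mem_freqBall.1 h).1⟩ else 0

/-- `B_k(ψ) = ∑_{l, m} ψ_{k-m} ψ_{l+m} conj(ψ_l)`, used for finitely supported `ψ`. -/
def cubicCoeff (ψ : ℤ × ℤ → ℂ) (k : ℤ × ℤ) : ℂ :=
  ∑' q : (ℤ × ℤ) × (ℤ × ℤ), ψ (k - q.2) * ψ (q.1 + q.2) * (starRingEnd ℂ) (ψ q.1)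

/-- The renormalization constant `4 ∑_{1 ≤ |m| ≤ N} |m|^{-2}`. -/
def wickConst (N : ℕ) : ℝ := 4 * ∑ m ∈ freqBall N, 1 / freqSq m

/-- The `k`-th coefficient of `(:B:)^N`: it is `B_k(Π_N φ) - 4 (∑_{1 ≤ |m| ≤ N} |m|^{-2}) φ_k` for
`1 ≤ |k| ≤ N`, and `0` for `|k| > N`. -/
def wickCubicCoeff {β : ℝ} (N : ℕ) (φ : Hs β) (k : Mode) : ℂ :=
  if (k : ℤ × ℤ) ∈ freqBall N then
    cubicCoeff (truncCoeff N φ) k - wickConst N * φ.coeff k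
  else 0

/-- The renormalized truncated nonlinearity `(:B:)^N : H^β → H^β`. -/
def wickCubicTrunc (β : ℝ) (N : ℕ) (φ : Hs β) : Hs β :=
  Hs.ofFinite β (wickCubicCoeff N φ) (by
    refine Set.Finite.subset (Set.Finite.preimage Subtype.val_injective.injOn
      (freqBall N).finite_toSet) (s := Subtype.val ⁻¹' (freqBall N : Set (ℤ × ℤ))) ?_
    intro k hk
    by_contra hn
    exact hk (if_neg hn))

/-- `B` is (a version of) `:B:`, the limit of `(:B:)^N` in `L^p(μ₂; H^β)` for every `p ≥ 1`. -/
def IsWickCubic (β : ℝ) (B : Hs β → Hs β) : Prop :=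
  AEStronglyMeasurable B (gaussianMeasure β) ∧
    ∀ p : ℕ, 1 ≤ p →
      Tendsto (fun N : ℕ => eLpNorm (fun φ => wickCubicTrunc β N φ - B φ) p (gaussianMeasure β))
        atTop (𝓝 0)

/-- The inclusion of the Cameron–Martin space `H^1` in `H^β`, for `β < 0`. -/
def cameronMartin {β : ℝ} (hβ : β < 0) : Hs 1 →ₗ[ℝ] Hs β := Hs.incl (hβ.le.trans zero_le_one)

end

/-! ### Squared norms in `[0, ∞]` and contractions of Hilbert–Schmidt maps. -/

noncomputable section

/-! In the Fourier basis of `H^1`, the coordinates of `φ` under `μ₂` are independent standard real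
Gaussians. In these coordinates `(:B:)^N` is a Wick-ordered cubic polynomial, and it is determined
by its third gradient, the constant symmetric tensor `gradTensor β N`. The counterterm `wickConst N`
is exactly the trace term of the Wick ordering: contracting the two unconjugated factors gives `0`,
and each of the two contractions with the conjugated factor gives `∑ 2/|m|²` (`chaos_gradTensor`).

For such a polynomial every gradient of order `s ≤ 3` is a chaos of degree `3 - s` built from the
same tensor `T`, and its moment of order `2n` is at most `C_n ‖T‖^(2n)`, with `C_n` independent of
the number of coordinates (`lintegral_wick_le`). The bound comes from decoupling: a Wick monomial of
degree `d + 1` is, up to a constant, the conditional expectation of a product of a degree-`d` Wick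
monomial in one Gaussian vector and a linear form in an independent one, the pair being a rotation
by `π/4` of the original variables. Khinchine's inequality then removes one degree at a time.

Hence convergence in all `L^p`, for all orders at once, reduces to `gradTensor β N` being Cauchy in
the Hilbert–Schmidt norm (`cauchySeq_gradTensor`), that is, to the finiteness of `∑ |a+b-c|^(2β)
|a|⁻² |b|⁻² |c|⁻²` (`tsum_tripleWeight_ne_top`). Without the first factor the sum diverges
logarithmically in each variable; the small decay given by `β < 0` can be redistributed over the
three smallest of the four frequencies.

The limits are Malliavin gradients of one another because Taylor's formula for the polynomials is
exact. Along a fast subsequence all orders converge almost everywhere, and convergence of orders `s,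
…, s + 3` at one point `x` forces convergence on the whole line `x + t v`, to a cubic polynomial in
`t` (`exists_version_of_tendsto_cubic`). No quasi-invariance of the measure is needed. -/

theorem enorm_pow_eq_ofReal {E : Type*} [SeminormedAddGroup E] (x : E) (n : ℕ) :
    ‖x‖ₑ ^ n = ENNReal.ofReal (‖x‖ ^ n) := by
  rw [ENNReal.ofReal_pow (norm_nonneg _), ofReal_norm]

theorem sum_enorm_sq_eq_ofReal {α E : Type*} [SeminormedAddGroup E] (s : Finset α) (f : α → E) :
    ∑ i ∈ s, ‖f i‖ₑ ^ 2 = ENNReal.ofReal (∑ i ∈ s, ‖f i‖ ^ 2) := by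
  rw [ENNReal.ofReal_sum_of_nonneg (fun i _ => by positivity)]
  simp_rw [enorm_pow_eq_ofReal]

/-- Sums of squares are kept in `[0, ∞]`, where series can be reordered and compared without
summability conditions. -/
theorem memℓp_two_iff_tsum_enorm {α : Type*} {G : Type*} [NormedAddCommGroup G] {f : α → G} :
    Memℓp f 2 ↔ ∑' i, ‖f i‖ₑ ^ 2 ≠ ∞ := by
  rw [memℓp_gen_iff (by norm_num)]
  simp_rw [enorm_pow_eq_ofReal]
  constructor
  · intro h
    refine Summable.tsum_ofReal_ne_top ?_
    simpa using h
  · intro h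
    have := ENNReal.summable_toReal h
    refine this.congr fun i => ?_
    rw [ENNReal.toReal_ofReal (by positivity)]
    simp

theorem lp_enorm_sq {α : Type*} {G : Type*} [NormedAddCommGroup G]
    (f : lp (fun _ : α => G) 2) : ‖f‖ₑ ^ 2 = ∑' i, ‖f i‖ₑ ^ 2 := by
  have h := lp.norm_rpow_eq_tsum (p := 2) (by norm_num) f
  have h2 : ‖f‖ ^ 2 = ∑' i, ‖f i‖ ^ 2 := by simpa using h
  have hs : Summable fun i => ‖f i‖ ^ 2 := by
    simpa using (lp.memℓp f).summable (p := 2) (by norm_num)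
  simp_rw [enorm_pow_eq_ofReal]
  rw [h2, ENNReal.ofReal_tsum_of_nonneg (fun i => by positivity) hs]

section

variable {ι H : Type} [NormedAddCommGroup H] [InnerProductSpace ℝ H]

/-- The squared coordinates in a Hilbert basis sum up to the squared norm. -/
theorem HilbertBasis.tsum_inner_enorm_sq (b : HilbertBasis ι ℝ H) (v : H) :
    ∑' i, ‖inner ℝ (b i) v‖ₑ ^ 2 = ‖v‖ₑ ^ 2 := by
  have h := lp_enorm_sq (b.repr v)
  simp_rw [b.repr_apply_apply] at h
  rw [← h]
  congr 1
  rw [← ofReal_norm, ← ofReal_norm, b.repr.norm_map]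

/-- Bessel-type bound for a continuous linear map, by the Cauchy–Schwarz inequality. -/
theorem HilbertBasis.enorm_apply_sq_le (b : HilbertBasis ι ℝ H) {G : Type*}
    [NormedAddCommGroup G] [NormedSpace ℝ G] (L : H →L[ℝ] G) (v : H) :
    ‖L v‖ₑ ^ 2 ≤ ‖v‖ₑ ^ 2 * ∑' i, ‖L (b i)‖ₑ ^ 2 := by
  have h1 : HasSum (fun i => inner ℝ (b i) v • L (b i)) (L v) := by
    have := (b.hasSum_repr v).mapL L
    simpa [b.repr_apply_apply] using this
  have h2 : Tendsto (fun s : Finset ι => ‖∑ i ∈ s, inner ℝ (b i) v • L (b i)‖ₑ ^ 2) atTop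
      (𝓝 (‖L v‖ₑ ^ 2)) := by
    have := (continuous_enorm.tendsto (L v)).comp h1
    exact ((ENNReal.continuous_pow 2).tendsto _).comp this
  refine le_of_tendsto h2 (Eventually.of_forall fun s => ?_)
  have h3 : ‖∑ i ∈ s, inner ℝ (b i) v • L (b i)‖ ^ 2
      ≤ (∑ i ∈ s, ‖inner ℝ (b i) v‖ ^ 2) * ∑ i ∈ s, ‖L (b i)‖ ^ 2 := by
    refine le_trans ?_ (Finset.sum_mul_sq_le_sq_mul_sq s _ _)
    gcongr
    refine (norm_sum_le _ _).trans (Finset.sum_le_sum fun i _ => ?_)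
    rw [norm_smul]
  rw [← b.tsum_inner_enorm_sq v]
  calc _ ≤ (∑ i ∈ s, ‖inner ℝ (b i) v‖ₑ ^ 2) * ∑ i ∈ s, ‖L (b i)‖ₑ ^ 2 := by
        rw [sum_enorm_sq_eq_ofReal, sum_enorm_sq_eq_ofReal, enorm_pow_eq_ofReal, ← ENNReal.ofReal_mul (by positivity)]
        exact ENNReal.ofReal_le_ofReal h3
    _ ≤ _ := by gcongr <;> exact ENNReal.sum_le_tsum s

end

namespace HS

variable {ι H : Type} [NormedAddCommGroup H] [InnerProductSpace ℝ H]
variable {b : HilbertBasis ι ℝ H} {s : ℕ} {G : Type}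

section NormedSpace

variable [NormedAddCommGroup G] [NormedSpace ℝ G]

theorem ext_toMultilinear {S T : HS b s G} (h : ∀ w, S.toMultilinear w = T.toMultilinear w) :
    S = T :=
  Subtype.ext (ContinuousMultilinearMap.ext h)

/-- The underlying multilinear map depends linearly on the operator. -/
def toMultilinearₗ : HS b s G →ₗ[ℝ] ContinuousMultilinearMap ℝ (fun _ : Fin s => H) G :=
  (hilbertSchmidtSubmodule b s G).subtype

theorem toMultilinearₗ_apply (T : HS b s G) : toMultilinearₗ T = T.toMultilinear := rfl

@[simp] theorem toMultilinear_sub (S T : HS b s G) :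
    (S - T).toMultilinear = S.toMultilinear - T.toMultilinear := rfl

@[simp] theorem toMultilinear_smul (c : ℝ) (T : HS b s G) :
    (c • T).toMultilinear = c • T.toMultilinear := rfl

theorem toMultilinear_sum {α : Type*} (S : Finset α) (f : α → HS b s G) :
    (∑ a ∈ S, f a).toMultilinear = ∑ a ∈ S, (f a).toMultilinear := by
  simp_rw [← toMultilinearₗ_apply]
  exact map_sum _ _ _

theorem enorm_sq (T : HS b s G) :
    ‖T‖ₑ ^ 2 = ∑' j : Fin s → ι, ‖T.toMultilinear (fun i => b (j i))‖ₑ ^ 2 :=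
  lp_enorm_sq (toLp2 T)

/-- Splitting off the first index. -/
theorem tsum_cons_enorm_sq (T : ContinuousMultilinearMap ℝ (fun _ : Fin (s + 1) => H) G) :
    ∑' j : Fin (s + 1) → ι, ‖T (fun i => b (j i))‖ₑ ^ 2 =
      ∑' i, ∑' j : Fin s → ι, ‖T (Fin.cons (b i) fun l => b (j l))‖ₑ ^ 2 := by
  rw [← ENNReal.tsum_prod, ← (Fin.consEquiv fun _ : Fin (s + 1) => ι).tsum_eq]
  refine tsum_congr fun p => ?_
  congr 3
  funext i
  refine Fin.cases ?_ (fun l => ?_) i <;> simp [Fin.consEquiv]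

/-- For fixed remaining indices `j` the map is linear in its first slot, so the Bessel-type bound
applies to each `j` separately and is then summed. -/
theorem tsum_contract_le (T : ContinuousMultilinearMap ℝ (fun _ : Fin (s + 1) => H) G) (v : H) :
    ∑' j : Fin s → ι, ‖T (Fin.cons v fun l => b (j l))‖ₑ ^ 2 ≤
      ‖v‖ₑ ^ 2 * ∑' j : Fin (s + 1) → ι, ‖T (fun i => b (j i))‖ₑ ^ 2 := by
  rw [tsum_cons_enorm_sq, ENNReal.tsum_comm, ← ENNReal.tsum_mul_left]
  refine ENNReal.tsum_le_tsum fun j => ?_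
  have := b.enorm_apply_sq_le
    (T.toContinuousLinearMap (Fin.cons (0 : H) fun l => b (j l)) 0) v
  simpa [ContinuousMultilinearMap.toContinuousLinearMap] using this

/-- The contraction `T(v, ·)` of a Hilbert–Schmidt map. -/
def contract (v : H) : HS b (s + 1) G →ₗ[ℝ] HS b s G where
  toFun T := ⟨T.toMultilinear.curryLeft v, by
    refine memℓp_two_iff_tsum_enorm.2 (ne_top_of_le_ne_top ?_
      (tsum_contract_le (b := b) T.toMultilinear v))
    exact ENNReal.mul_ne_top (by simp) (memℓp_two_iff_tsum_enorm.1 T.2)⟩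
  map_add' _ _ := rfl
  map_smul' _ _ := rfl

@[simp] theorem toMultilinear_contract (v : H) (T : HS b (s + 1) G) (w : Fin s → H) :
    (contract v T).toMultilinear w = T.toMultilinear (Fin.cons v w) := rfl

theorem enorm_contract_le (v : H) (T : HS b (s + 1) G) : ‖contract v T‖ₑ ≤ ‖v‖ₑ * ‖T‖ₑ := by
  rw [← ENNReal.pow_le_pow_left_iff two_ne_zero, mul_pow, enorm_sq, enorm_sq]
  exact tsum_contract_le T.toMultilinear v

theorem norm_contract_le (v : H) (T : HS b (s + 1) G) : ‖contract v T‖ ≤ ‖v‖ * ‖T‖ := by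
  have h := enorm_contract_le v T
  simp_rw [← ofReal_norm] at h
  rw [← ENNReal.ofReal_mul (norm_nonneg _)] at h
  exact (ENNReal.ofReal_le_ofReal_iff (by positivity)).1 h

theorem enorm_sq_eq_tsum_contract (T : HS b (s + 1) G) :
    ‖T‖ₑ ^ 2 = ∑' i, ‖contract (b i) T‖ₑ ^ 2 := by
  rw [enorm_sq, tsum_cons_enorm_sq]
  refine tsum_congr fun i => ?_
  rw [enorm_sq]
  rfl

theorem contract_add_left (u v : H) (T : HS b (s + 1) G) :
    contract (u + v) T = contract u T + contract v T := by
  apply ext_toMultilinear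
  intro w
  change T.toMultilinear.curryLeft (u + v) w = _
  rw [map_add]
  rfl

theorem contract_smul_left (c : ℝ) (v : H) (T : HS b (s + 1) G) :
    contract (c • v) T = c • contract v T := by
  apply ext_toMultilinear
  intro w
  change T.toMultilinear.curryLeft (c • v) w = _
  rw [map_smul]
  rfl

theorem contract_sum_left {α : Type*} (S : Finset α) (f : α → H) (T : HS b (s + 1) G) :
    contract (∑ a ∈ S, f a) T = ∑ a ∈ S, contract (f a) T := by
  let L : H →ₗ[ℝ] HS b s G :=
    { toFun := fun v => contract v T
      map_add' := fun u v => contract_add_left u v T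
      map_smul' := fun c v => contract_smul_left c v T }
  exact map_sum L f S

/-- The contraction as a continuous linear map. -/
def contractL (v : H) : HS b (s + 1) G →L[ℝ] HS b s G :=
  LinearMap.mkContinuous (contract v) ‖v‖ (norm_contract_le v)

theorem continuous_contract (v : H) : Continuous (contract v : HS b (s + 1) G → HS b s G) :=
  (contractL v).continuous

/-- The Hilbert–Schmidt norm dominates the operator norm, by contracting one slot at a time. This is
what makes Hilbert–Schmidt limits continuous multilinear maps. -/
theorem norm_toMultilinear_apply_le (T : HS b s G) (w : Fin s → H) :
    ‖T.toMultilinear w‖ ≤ ‖T‖ * ∏ i, ‖w i‖ := by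
  induction s with
  | zero =>
    have h := enorm_sq T
    rw [tsum_eq_single (fun i => i.elim0) (fun j hj => (hj (Subsingleton.elim _ _)).elim)] at h
    have h1 : ‖T‖ₑ = ‖T.toMultilinear w‖ₑ := by
      have := (ENNReal.pow_right_strictMono two_ne_zero).injective h
      rw [this]
      congr 2
      exact Subsingleton.elim _ _
    simp only [Finset.univ_eq_empty, Finset.prod_empty, mul_one]
    exact (by simpa using congrArg ENNReal.toReal h1 : ‖T‖ = _).ge
  | succ s ih =>
    have h := ih (contract (w 0) T) (Fin.tail w)
    rw [toMultilinear_contract, Fin.cons_self_tail] at h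
    refine h.trans ?_
    rw [Fin.prod_univ_succ]
    calc _ ≤ (‖w 0‖ * ‖T‖) * ∏ i, ‖Fin.tail w i‖ := by
          gcongr
          exact norm_contract_le _ _
      _ = _ := by simp only [Fin.tail]; ring

/-- The Hilbert–Schmidt operators form a complete space. -/
instance [CompleteSpace G] : CompleteSpace (HS b s G) := by
  refine Metric.complete_of_cauchySeq_tendsto fun u hu => ?_
  have h1 : CauchySeq fun n => toLp2 (u n) := by
    rw [Metric.cauchySeq_iff'] at hu ⊢
    intro ε hε
    obtain ⟨N, hN⟩ := hu ε hε
    exact ⟨N, hN⟩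
  -- The matrices converge in `ℓ²` and the maps converge in operator norm; the two limits agree on
  -- the basis, so the limiting map is Hilbert–Schmidt.
  have h2 : CauchySeq fun n => (u n).toMultilinear := by
    rw [Metric.cauchySeq_iff'] at hu ⊢
    intro ε hε
    obtain ⟨N, hN⟩ := hu ε hε
    refine ⟨N, fun n hn => lt_of_le_of_lt ?_ (hN n hn)⟩
    rw [dist_eq_norm, dist_eq_norm, ← toMultilinear_sub]
    exact ContinuousMultilinearMap.opNorm_le_bound (norm_nonneg _)
      (norm_toMultilinear_apply_le (u n - u N))
  obtain ⟨A, hA⟩ := cauchySeq_tendsto_of_complete h1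
  obtain ⟨T, hT⟩ := cauchySeq_tendsto_of_complete h2
  have hAT : ∀ j : Fin s → ι, A j = T (fun i => b (j i)) := by
    intro j
    have t1 : Tendsto (fun n => (toLp2 (u n) : (Fin s → ι) → G) j) atTop (𝓝 (A j)) := by
      rw [tendsto_iff_norm_sub_tendsto_zero] at hA ⊢
      refine squeeze_zero (fun _ => norm_nonneg _) (fun n => ?_) hA
      exact lp.norm_apply_le_norm two_ne_zero (toLp2 (u n) - A) j
    have t2 : Tendsto (fun n => (u n).toMultilinear fun i => b (j i)) atTop
        (𝓝 (T fun i => b (j i))) :=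
      ((ContinuousMultilinearMap.apply ℝ (fun _ : Fin s => H) G
        fun i => b (j i)).continuous.tendsto T).comp hT
    exact tendsto_nhds_unique t1 t2
  have hmem : Memℓp (fun j : Fin s → ι => T (fun i => b (j i))) 2 := by
    have : (fun j : Fin s → ι => T (fun i => b (j i))) = A := funext fun j => (hAT j).symm
    rw [this]
    exact A.2
  obtain ⟨S, hS⟩ : ∃ S : HS b s G, S.toMultilinear = T := ⟨⟨T, hmem⟩, rfl⟩
  refine ⟨S, ?_⟩
  have e : toLp2 S = A := by
    subst hS
    exact Subtype.ext (funext fun j => (hAT j).symm)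
  rw [tendsto_iff_norm_sub_tendsto_zero] at hA ⊢
  rw [← e] at hA
  exact hA

/-- The operator `w ↦ ∏ᵢ ⟪b_{jᵢ}, wᵢ⟫ • g`. -/
def elementary (b : HilbertBasis ι ℝ H) (j : Fin s → ι) (g : G) : HS b s G :=
  ⟨((ContinuousMultilinearMap.mkPiAlgebra ℝ (Fin s) ℝ).compContinuousLinearMap
      fun i => innerSL ℝ (b (j i))).smulRight g, by
    classical
    refine (memℓp_zero ((Set.finite_singleton j).subset fun l hl => ?_)).of_exponent_ge zero_le
    by_contra h
    obtain ⟨i, hi⟩ := Function.ne_iff.1 h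
    apply hl
    have : inner ℝ (b (j i)) (b (l i)) = 0 := b.orthonormal.2 (Ne.symm hi)
    simp only [ContinuousMultilinearMap.smulRight_apply,
      ContinuousMultilinearMap.compContinuousLinearMap_apply,
      ContinuousMultilinearMap.mkPiAlgebra_apply, innerSL_apply_apply]
    rw [Finset.prod_eq_zero (Finset.mem_univ i) this, zero_smul]⟩

theorem elementary_apply (j : Fin s → ι) (g : G) (w : Fin s → H) :
    (elementary b j g).toMultilinear w = (∏ i, inner ℝ (b (j i)) (w i)) • g := by
  simp [elementary, toMultilinear]

end NormedSpace

/-- `HS(⊗^s H, G)` is an inner product space. -/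
instance [NormedAddCommGroup G] [InnerProductSpace ℝ G] : InnerProductSpace ℝ (HS b s G) :=
  InnerProductSpace.induced (toLp2 (b := b) (s := s) (G := G))

end HS

end

/-! ### Integral inequalities and Khinchine's inequality for Gaussian sums. -/

noncomputable section

open ProbabilityTheory

/-- Minkowski's inequality in `L^n` for a finite sum, in terms of powers. -/
theorem lintegral_sum_pow_le {Ω κ : Type*} [MeasurableSpace Ω] {μ : Measure Ω} {n : ℕ}
    (hn : 1 ≤ n) (S : Finset κ) (f : κ → Ω → ℝ≥0∞) (hf : ∀ k ∈ S, Measurable (f k)) (M : ℝ≥0∞)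
    (V : κ → ℝ≥0∞) (h : ∀ k ∈ S, ∫⁻ ω, f k ω ^ n ∂μ ≤ M * V k ^ n) :
    ∫⁻ ω, (∑ k ∈ S, f k ω) ^ n ∂μ ≤ M * (∑ k ∈ S, V k) ^ n := by
  classical
  have hn' : (1 : ℝ) ≤ n := by exact_mod_cast hn
  have hn0 : (n : ℝ) ≠ 0 := by positivity
  have key : ∀ T ⊆ S, (∫⁻ ω, (∑ k ∈ T, f k ω) ^ (n : ℝ) ∂μ) ^ (1 / (n : ℝ)) ≤
      M ^ (1 / (n : ℝ)) * ∑ k ∈ T, V k := by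
    intro T
    induction T using Finset.induction_on with
    | empty =>
      intro _
      simp [ENNReal.zero_rpow_of_pos (by positivity : (0 : ℝ) < n),
        ENNReal.zero_rpow_of_pos (by positivity : (0 : ℝ) < (n : ℝ)⁻¹)]
    | insert a T ha ih =>
      intro hT
      have hTS : T ⊆ S := (Finset.subset_insert a T).trans hT
      have haS : a ∈ S := hT (Finset.mem_insert_self a T)
      simp_rw [Finset.sum_insert ha]
      have hadd := ENNReal.lintegral_Lp_add_le (μ := μ) (p := n) (hf a haS).aemeasurable
        (Finset.measurable_sum T fun k hk => hf k (hTS hk)).aemeasurable hn'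
      simp only [Pi.add_apply] at hadd
      refine hadd.trans ?_
      rw [mul_add]
      refine add_le_add ?_ (ih hTS)
      have := ENNReal.rpow_le_rpow (h a haS) (by positivity : 0 ≤ 1 / (n : ℝ))
      rw [ENNReal.mul_rpow_of_nonneg _ _ (by positivity), ← ENNReal.rpow_natCast (V a),
        ← ENNReal.rpow_mul, mul_one_div_cancel hn0, ENNReal.rpow_one] at this
      simpa only [ENNReal.rpow_natCast] using this
  have := ENNReal.rpow_le_rpow (key S subset_rfl) (by positivity : 0 ≤ (n : ℝ))
  rw [← ENNReal.rpow_mul, one_div_mul_cancel hn0, ENNReal.rpow_one,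
    ENNReal.mul_rpow_of_nonneg _ _ (by positivity), ← ENNReal.rpow_mul, one_div_mul_cancel hn0,
    ENNReal.rpow_one] at this
  simpa only [ENNReal.rpow_natCast] using this

/-- Jensen's inequality for powers of an integral. -/
theorem lintegral_pow_le_lintegral_pow {Ω : Type*} [MeasurableSpace Ω] {μ : Measure Ω}
    [IsProbabilityMeasure μ] {n : ℕ} (hn : 1 ≤ n) {f : Ω → ℝ≥0∞} (hf : AEMeasurable f μ) :
    (∫⁻ ω, f ω ∂μ) ^ n ≤ ∫⁻ ω, f ω ^ n ∂μ := by
  have hn' : (1 : ℝ) ≤ n := by exact_mod_cast hn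
  -- Hölder against the constant `1` needs a finite conjugate exponent, so `n = 1` is treated apart.
  rcases hn'.eq_or_lt with h1 | h1
  · have : n = 1 := by exact_mod_cast h1.symm
    subst this
    simp
  · have hpq := Real.HolderConjugate.conjExponent h1
    have h := ENNReal.lintegral_mul_le_Lp_mul_Lq μ hpq hf (g := fun _ => 1) aemeasurable_const
    simp only [Pi.mul_apply, mul_one, ENNReal.one_rpow, lintegral_const, measure_univ] at h
    have := ENNReal.rpow_le_rpow h (by positivity : 0 ≤ (n : ℝ))
    rw [← ENNReal.rpow_mul, one_div_mul_cancel (by positivity), ENNReal.rpow_one] at this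
    simpa only [ENNReal.rpow_natCast] using this

namespace GaussianChaos

variable {ι : Type*} [Fintype ι]

/-- The standard Gaussian measure on `ℝ^ι`. -/
abbrev gauss (ι : Type*) [Fintype ι] : Measure (EuclideanSpace ℝ ι) :=
  stdGaussian (EuclideanSpace ℝ ι)

/-- The absolute moments of a standard real Gaussian variable. -/
def absMoment (n : ℕ) : ℝ≥0∞ := ∫⁻ t : ℝ, ‖t‖ₑ ^ n ∂(gaussianReal 0 1)

theorem absMoment_lt_top (n : ℕ) : absMoment n < ∞ := by
  rcases Nat.eq_zero_or_pos n with rfl | hn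
  · simp [absMoment]
  · have h := (memLp_id_gaussianReal' (μ := 0) (v := 1) (n : ℝ≥0∞) (by simp)).2
    rw [eLpNorm_lt_top_iff_lintegral_rpow_enorm_lt_top (by simpa using hn.ne') (by simp)] at h
    simpa [absMoment] using h

/-- Moments of a real linear functional of a standard Gaussian vector. -/
theorem lintegral_linear_real (a : ι → ℝ) (n : ℕ) :
    ∫⁻ x, (‖∑ i, x i * a i‖ₑ ^ 2) ^ n ∂(gauss ι) =
      absMoment (2 * n) * (∑ i, ‖a i‖ₑ ^ 2) ^ n := by
  let t : EuclideanSpace ℝ ι := WithLp.toLp 2 a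
  have hL : ∀ x : EuclideanSpace ℝ ι, innerSL ℝ t x = ∑ i, x i * a i := by
    intro x
    simp [t, PiLp.inner_apply]
  -- Both sides are the centred normal law of variance `‖t‖²`.
  have hmap : (gauss ι).map (innerSL ℝ t) = (gaussianReal 0 1).map (fun y => ‖t‖ * y) := by
    rw [IsGaussian.map_eq_gaussianReal, variance_dual_stdGaussian, gaussianReal_map_const_mul]
    have h0 : ∫ x, innerSL ℝ t x ∂(gauss ι) = 0 := integral_strongDual_stdGaussian _
    rw [h0]
    congr 1
    · simp
    · rw [innerSL_apply_norm]
      apply NNReal.eq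
      simp
  have ht : ‖t‖ₑ ^ 2 = ∑ i, ‖a i‖ₑ ^ 2 := by
    rw [enorm_pow_eq_ofReal, EuclideanSpace.real_norm_sq_eq, sum_enorm_sq_eq_ofReal]
    simp [t]
  have e1 : ∫⁻ x, (‖∑ i, x i * a i‖ₑ ^ 2) ^ n ∂(gauss ι) =
      ∫⁻ y, (‖y‖ₑ ^ 2) ^ n ∂((gauss ι).map (innerSL ℝ t)) := by
    rw [lintegral_map (by fun_prop) (by fun_prop)]
    simp_rw [hL]
  rw [e1, hmap, lintegral_map (by fun_prop) (by fun_prop)]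
  simp_rw [enorm_mul, mul_pow, ← pow_mul]
  rw [lintegral_const_mul _ (by fun_prop), ← ht, absMoment, mul_comm, ← pow_mul]
  simp

/-- Khinchine's inequality for Gaussian sums with coefficients in an inner product space. -/
theorem lintegral_linear_le {E : Type*} [NormedAddCommGroup E] [InnerProductSpace ℝ E]
    (g : ι → E) {n : ℕ} (hn : 1 ≤ n) :
    ∫⁻ x, ‖∑ i, x i • g i‖ₑ ^ (2 * n) ∂(gauss ι) ≤
      absMoment (2 * n) * (∑ i, ‖g i‖ₑ ^ 2) ^ n := by
  -- An orthonormal basis of the span writes the squared norm as a sum of squares of scalar Gaussian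
  -- forms. Minkowski in `L^n` adds these up, and the variances sum to `∑ ‖g i‖²`, so the constant
  -- does not depend on the dimension.
  let W := Submodule.span ℝ (Set.range g)
  have : FiniteDimensional ℝ W := FiniteDimensional.span_of_finite ℝ (Set.finite_range g)
  let e := stdOrthonormalBasis ℝ W
  let g' : ι → W := fun i => ⟨g i, Submodule.subset_span ⟨i, rfl⟩⟩
  have hsq : ∀ w : W, ‖w‖ₑ ^ 2 = ∑ k, ‖inner ℝ (e k) w‖ₑ ^ 2 := by
    intro w
    rw [sum_enorm_sq_eq_ofReal, enorm_pow_eq_ofReal, ← e.sum_sq_norm_inner_right w]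
  have hg : ∀ i, ‖g i‖ₑ ^ 2 = ∑ k, ‖inner ℝ (e k) (g' i)‖ₑ ^ 2 := fun i => by
    rw [← hsq]
    rfl
  have hx : ∀ x : EuclideanSpace ℝ ι, ‖∑ i, x i • g i‖ₑ ^ 2 =
      ∑ k, ‖∑ i, x i * inner ℝ (e k) (g' i)‖ₑ ^ 2 := by
    intro x
    have h1 : ‖∑ i, x i • g i‖ₑ = ‖∑ i, x i • g' i‖ₑ := by
      have : ∑ i, x i • g i = ((∑ i, x i • g' i : W) : E) := by
        simp [g']
      rw [this]
      rfl
    rw [h1, hsq]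
    simp_rw [inner_sum, inner_smul_right]
  simp_rw [pow_mul, hx, hg]
  rw [Finset.sum_comm]
  refine lintegral_sum_pow_le hn _ _ (fun k _ => by fun_prop) _ _ fun k _ => ?_
  rw [lintegral_linear_real]

end GaussianChaos

end

/-! ### Decoupling and moments of quadratic and cubic Wick chaoses. -/

noncomputable section

open ProbabilityTheory

namespace GaussianChaos

variable {ι : Type*} [Fintype ι]

/-- First component of the rotation of `(x, u)` by `π/4`. -/
abbrev sumHalf (x u : EuclideanSpace ℝ ι) : EuclideanSpace ℝ ι := (√2)⁻¹ • (x + u)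

/-- Second component of the rotation of `(x, u)` by `π/4`. -/
abbrev diffHalf (x u : EuclideanSpace ℝ ι) : EuclideanSpace ℝ ι := (√2)⁻¹ • (u - x)

theorem map_rotation_gauss :
    ((gauss ι).prod (gauss ι)).map
      (fun q : EuclideanSpace ℝ ι × EuclideanSpace ℝ ι =>
        (sumHalf q.1 q.2, diffHalf q.1 q.2)) = (gauss ι).prod (gauss ι) := by
  have h := IsGaussian.map_rotation_eq_self (μ := gauss ι)
    (by simp) (Real.pi / 4)
  have hs : √2 / 2 = (√2)⁻¹ := by
    rw [inv_eq_one_div, Real.sqrt_div_self', one_div]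
  convert h using 2
  funext q
  rw [sumHalf, diffHalf, ContinuousLinearMap.rotation_apply, Real.cos_pi_div_four, Real.sin_pi_div_four, hs,
    smul_add, smul_sub, neg_smul, neg_add_eq_sub]

/-- Decoupling: moments of a conditional expectation along a rotation by `π/4`. -/
theorem lintegral_le_of_decoupling {E : Type*} [NormedAddCommGroup E] [NormedSpace ℝ E]
    {f : EuclideanSpace ℝ ι → E} {g : EuclideanSpace ℝ ι → EuclideanSpace ℝ ι → E}
    (hg : Continuous fun q : EuclideanSpace ℝ ι × EuclideanSpace ℝ ι => g q.1 q.2) (c : ℝ)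
    (h : ∀ x, f x = c • ∫ u, g (sumHalf x u) (diffHalf x u) ∂(gauss ι))
    {p : ℕ} (hp : 1 ≤ p) :
    ∫⁻ x, ‖f x‖ₑ ^ p ∂(gauss ι) ≤
      ‖c‖ₑ ^ p * ∫⁻ y, ∫⁻ z, ‖g y z‖ₑ ^ p ∂(gauss ι) ∂(gauss ι) := by
  have hm : Measurable fun q : EuclideanSpace ℝ ι × EuclideanSpace ℝ ι => ‖g q.1 q.2‖ₑ ^ p :=
    (hg.enorm.measurable).pow_const p
  have hR : Measurable fun q : EuclideanSpace ℝ ι × EuclideanSpace ℝ ι =>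
      (sumHalf q.1 q.2, diffHalf q.1 q.2) := by fun_prop
  -- Jensen bounds the power of the integral over `u`; rotation invariance of the product measure
  -- then makes the two arguments of `g` independent.
  calc ∫⁻ x, ‖f x‖ₑ ^ p ∂(gauss ι)
      ≤ ∫⁻ x, ‖c‖ₑ ^ p *
        ∫⁻ u, ‖g (sumHalf x u) (diffHalf x u)‖ₑ ^ p ∂(gauss ι) ∂(gauss ι) := by
        refine lintegral_mono fun x => ?_
        rw [h x, enorm_smul, mul_pow]
        gcongr
        refine le_trans ?_ (lintegral_pow_le_lintegral_pow hp ?_)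
        · gcongr
          exact enorm_integral_le_lintegral_enorm _
        · have : Continuous fun u => g (sumHalf x u) (diffHalf x u) :=
            hg.comp (by fun_prop : Continuous fun u : EuclideanSpace ℝ ι =>
              (sumHalf x u, diffHalf x u))
          exact this.enorm.aemeasurable
    _ = ‖c‖ₑ ^ p * ∫⁻ q, ‖g (sumHalf q.1 q.2) (diffHalf q.1 q.2)‖ₑ ^ p
          ∂((gauss ι).prod (gauss ι)) := by
        have hm2 : Measurable fun q : EuclideanSpace ℝ ι × EuclideanSpace ℝ ι =>
            ‖g (sumHalf q.1 q.2) (diffHalf q.1 q.2)‖ₑ ^ p := hm.comp hR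
        rw [lintegral_const_mul, lintegral_prod _ hm2.aemeasurable]
        exact hm2.lintegral_prod_right'
    _ = ‖c‖ₑ ^ p * ∫⁻ q, ‖g q.1 q.2‖ₑ ^ p ∂((gauss ι).prod (gauss ι)) := by
        conv_rhs => rw [← map_rotation_gauss, lintegral_map hm hR]
    _ = _ := by rw [lintegral_prod _ hm.aemeasurable]

theorem memLp_coord (i : ι) (p : ℝ≥0∞) (hp : p ≠ ∞) :
    MemLp (fun u : EuclideanSpace ℝ ι => u i) p (gauss ι) :=
  (EuclideanSpace.proj (𝕜 := ℝ) i).comp_memLp' (IsGaussian.memLp_id (gauss ι) p hp)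

theorem integrable_coord (i : ι) : Integrable (fun u : EuclideanSpace ℝ ι => u i) (gauss ι) :=
  (memLp_coord i 1 (by simp)).integrable le_rfl

theorem integrable_coord_mul (i j : ι) :
    Integrable (fun u : EuclideanSpace ℝ ι => u i * u j) (gauss ι) :=
  (memLp_coord i 2 (by simp)).integrable_mul (memLp_coord j 2 (by simp))

theorem integrable_coord_mul_mul (i j l : ι) :
    Integrable (fun u : EuclideanSpace ℝ ι => u i * u j * u l) (gauss ι) := by
  have h4 : ENNReal.HolderTriple 4 4 2 := ⟨by
    rw [show (4 : ℝ≥0∞) = 2 * 2 by norm_num, ENNReal.mul_inv (by simp) (by simp), ← mul_add,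
      ENNReal.inv_two_add_inv_two, mul_one]⟩
  exact ((memLp_coord j 4 (by simp)).mul (r := 2) (memLp_coord i 4 (by simp))).integrable_mul
    (memLp_coord l 2 (by simp))

theorem integral_coord (i : ι) : ∫ u, u i ∂(gauss ι) = 0 :=
  integral_strongDual_stdGaussian (EuclideanSpace.proj (𝕜 := ℝ) i)

theorem integral_coord_mul [DecidableEq ι] (i j : ι) :
    ∫ u, u i * u j ∂(gauss ι) = if i = j then 1 else 0 := by
  have h := covariance_eval_multivariateGaussian (μ := (0 : EuclideanSpace ℝ ι))
    (S := (1 : Matrix ι ι ℝ)) Matrix.PosSemidef.one i j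
  rw [multivariateGaussian_zero_one, covariance_eq_sub (memLp_coord i 2 (by simp))
    (memLp_coord j 2 (by simp)), integral_coord, zero_mul, sub_zero, Matrix.one_apply] at h
  exact h

/-- Odd monomials integrate to zero because the law is invariant under `x ↦ -x`. -/
theorem integral_coord_mul_mul (i j l : ι) : ∫ u, u i * u j * u l ∂(gauss ι) = 0 := by
  have hmap : (gauss ι).map (fun x => -x) = gauss ι :=
    stdGaussian_map (LinearIsometryEquiv.neg ℝ (E := EuclideanSpace ℝ ι))
  have h : ∫ u, u i * u j * u l ∂(gauss ι) = ∫ u, -(u i * u j * u l) ∂(gauss ι) := by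
    conv_lhs => rw [← hmap]
    rw [integral_map (by fun_prop) (by fun_prop)]
    congr 1
    funext u
    simp
  rw [integral_neg] at h
  linarith

/-- `f` is integrable with integral `v`. -/
def HasExpectation (f : EuclideanSpace ℝ ι → ℝ) (v : ℝ) : Prop :=
  Integrable f (gauss ι) ∧ ∫ u, f u ∂(gauss ι) = v

namespace HasExpectation

variable {f g : EuclideanSpace ℝ ι → ℝ} {v w : ℝ}

theorem add (hf : HasExpectation f v) (hg : HasExpectation g w) :
    HasExpectation (fun u => f u + g u) (v + w) :=
  ⟨hf.1.add hg.1, by rw [integral_add hf.1 hg.1, hf.2, hg.2]⟩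

theorem const_mul (hf : HasExpectation f v) (c : ℝ) : HasExpectation (fun u => c * f u) (c * v) :=
  ⟨hf.1.const_mul c, by rw [integral_const_mul, hf.2]⟩

theorem const (c : ℝ) : HasExpectation (fun _ : EuclideanSpace ℝ ι => c) c :=
  ⟨integrable_const c, by simp⟩

theorem congr (hf : HasExpectation f v) (h : ∀ u, g u = f u) (hw : w = v) :
    HasExpectation g w := by
  obtain rfl : g = f := funext h
  rw [hw]
  exact hf

theorem coord (i : ι) : HasExpectation (fun u : EuclideanSpace ℝ ι => u i) 0 :=
  ⟨integrable_coord i, integral_coord i⟩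

theorem coord_mul [DecidableEq ι] (i j : ι) :
    HasExpectation (fun u : EuclideanSpace ℝ ι => u i * u j) (if i = j then 1 else 0) :=
  ⟨integrable_coord_mul i j, integral_coord_mul i j⟩

theorem coord_mul_mul (i j l : ι) :
    HasExpectation (fun u : EuclideanSpace ℝ ι => u i * u j * u l) 0 :=
  ⟨integrable_coord_mul_mul i j l, integral_coord_mul_mul i j l⟩

end HasExpectation

theorem inv_sqrt_two_sq : (√2)⁻¹ * (√2)⁻¹ = (1 / 2 : ℝ) := by
  rw [← mul_inv, Real.mul_self_sqrt (by norm_num), one_div]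

section Decoupling

variable [DecidableEq ι]

/-- The Kronecker symbol. -/
def kron (i j : ι) : ℝ := if i = j then 1 else 0

/-- Averaging over `u` kills the odd terms and turns `u i * u j` into the Kronecker symbol, which is
precisely the Wick correction. The factor is `-1/2` because `x` enters `diffHalf` with a minus sign.
-/
theorem expectation_rotated_mul (x : EuclideanSpace ℝ ι) (i j : ι) :
    HasExpectation (fun u => diffHalf x u j * sumHalf x u i)
      (-(1 / 2) * (x i * x j - kron i j)) := by
  refine ((((HasExpectation.coord_mul i j).add ((HasExpectation.coord j).const_mul (x i))).add
    ((HasExpectation.coord i).const_mul (-x j))).add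
      (HasExpectation.const (-(x i * x j)))).const_mul (1 / 2) |>.congr (fun u => ?_) ?_
  · simp only [PiLp.smul_apply, PiLp.sub_apply, PiLp.add_apply, smul_eq_mul]
    rw [← inv_sqrt_two_sq]
    ring
  · simp only [kron]
    ring

/-- The same mechanism one degree higher: the quadratic Wick monomial in the first rotated variable,
times a coordinate of the second, averages to the cubic Wick monomial. -/
theorem expectation_rotated_mul_mul (x : EuclideanSpace ℝ ι) (i j l : ι) :
    HasExpectation (fun u => diffHalf x u l *
        (sumHalf x u i * sumHalf x u j - kron i j))
      (-((√2)⁻¹ / 2) *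
        (x i * x j * x l - kron i j * x l - kron i l * x j - kron j l * x i)) := by
  have h1 := (HasExpectation.coord_mul_mul i j l).add
    (((HasExpectation.coord_mul j l).const_mul (x i)).add
      ((HasExpectation.coord_mul i l).const_mul (x j)))
  have h2 := h1.add (((HasExpectation.coord l).const_mul (x i * x j - 2 * kron i j)).add
    ((HasExpectation.coord_mul i j).const_mul (-x l)))
  have h3 := h2.add (((HasExpectation.coord i).const_mul (-(x j * x l))).add
    ((HasExpectation.coord j).const_mul (-(x i * x l))))
  refine ((h3.add (HasExpectation.const (-(x i * x j * x l) + 2 * kron i j * x l))).const_mul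
    ((√2)⁻¹ / 2)).congr (fun u => ?_) ?_
  · simp only [PiLp.smul_apply, PiLp.sub_apply, PiLp.add_apply, smul_eq_mul]
    linear_combination ((√2)⁻¹ * (u l - x l) * ((x i + u i) * (x j + u j))) * inv_sqrt_two_sq
  · simp only [kron]
    ring

variable {E : Type*} [NormedAddCommGroup E] [InnerProductSpace ℝ E] [CompleteSpace E]

/-- The linear chaos with coefficients `g`. -/
def linear (g : ι → E) (x : EuclideanSpace ℝ ι) : E := ∑ i, x i • g i

/-- The Wick-ordered quadratic chaos with coefficients `T`. -/
def quad (T : ι → ι → E) (x : EuclideanSpace ℝ ι) : E :=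
  ∑ j, ∑ i, (x i * x j - kron i j) • T i j

/-- The Wick-ordered cubic chaos with coefficients `T`. -/
def cubic (T : ι → ι → ι → E) (x : EuclideanSpace ℝ ι) : E :=
  ∑ l, ∑ j, ∑ i,
    (x i * x j * x l - kron i j * x l - kron i l * x j - kron j l * x i) • T i j l

theorem quad_eq_integral (T : ι → ι → E) (x : EuclideanSpace ℝ ι) :
    quad T x = (-2 : ℝ) • ∫ u, ∑ j, diffHalf x u j • linear (fun i => T i j) (sumHalf x u)
      ∂(gauss ι) := by
  simp_rw [linear, Finset.smul_sum, smul_smul]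
  rw [integral_finsetSum _ fun j _ => integrable_finsetSum _ fun i _ =>
    (expectation_rotated_mul x i j).1.smul_const _, quad, Finset.smul_sum]
  refine Finset.sum_congr rfl fun j _ => ?_
  rw [integral_finsetSum _ fun i _ => (expectation_rotated_mul x i j).1.smul_const _,
    Finset.smul_sum]
  refine Finset.sum_congr rfl fun i _ => ?_
  rw [integral_smul_const, (expectation_rotated_mul x i j).2, smul_smul]
  congr 1
  ring

theorem continuous_linear (g : ι → E) : Continuous (linear g) := by
  unfold linear
  fun_prop

theorem continuous_quad (T : ι → ι → E) : Continuous (quad T) := by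
  unfold quad
  fun_prop

/-- After decoupling, Khinchine is used twice: in `z` with `y` frozen, which leaves the squared
norms of linear forms in `y`, and then on each of these forms, Minkowski in `L^n` summing them. -/
theorem lintegral_quad_le (T : ι → ι → E) {n : ℕ} (hn : 1 ≤ n) :
    ∫⁻ x, ‖quad T x‖ₑ ^ (2 * n) ∂(gauss ι) ≤
      2 ^ (2 * n) * absMoment (2 * n) ^ 2 * (∑ j, ∑ i, ‖T i j‖ₑ ^ 2) ^ n := by
  have hl := fun j => continuous_linear fun i => T i j
  have h := lintegral_le_of_decoupling
    (g := fun y z => ∑ j, z j • linear (fun i => T i j) y) (by fun_prop) (-2)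
    (quad_eq_integral T) (show 1 ≤ 2 * n by omega)
  refine h.trans ?_
  have h2 : ‖(-2 : ℝ)‖ₑ = 2 := by
    rw [enorm_neg, Real.enorm_eq_ofReal (by norm_num)]
    simp
  rw [h2, mul_assoc]
  gcongr
  refine (lintegral_mono fun y => lintegral_linear_le (fun j => linear (fun i => T i j) y) hn).trans ?_
  rw [lintegral_const_mul _ (Measurable.pow_const (Finset.measurable_sum _ fun j _ =>
    (hl j).enorm.measurable.pow_const 2) n), sq, mul_assoc]
  gcongr
  refine lintegral_sum_pow_le hn _ _ (fun j _ => ?_) _ _ fun j _ => ?_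
  · exact (hl j).enorm.measurable.pow_const 2
  · simp_rw [← pow_mul]
    exact lintegral_linear_le (fun i => T i j) hn

theorem cubic_eq_integral (T : ι → ι → ι → E) (x : EuclideanSpace ℝ ι) :
    cubic T x = (-(2 * √2) : ℝ) • ∫ u, ∑ l, diffHalf x u l •
      quad (fun i j => T i j l) (sumHalf x u) ∂(gauss ι) := by
  have hI := fun i j l => (expectation_rotated_mul_mul x i j l).1.smul_const (T i j l)
  simp_rw [quad, Finset.smul_sum, smul_smul]
  rw [integral_finsetSum _ fun l _ => integrable_finsetSum _ fun j _ =>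
    integrable_finsetSum _ fun i _ => hI i j l, cubic, Finset.smul_sum]
  refine Finset.sum_congr rfl fun l _ => ?_
  rw [integral_finsetSum _ fun j _ => integrable_finsetSum _ fun i _ => hI i j l, Finset.smul_sum]
  refine Finset.sum_congr rfl fun j _ => ?_
  rw [integral_finsetSum _ fun i _ => hI i j l, Finset.smul_sum]
  refine Finset.sum_congr rfl fun i _ => ?_
  rw [integral_smul_const, (expectation_rotated_mul_mul x i j l).2, smul_smul]
  congr 1
  have : √2 * (√2)⁻¹ = 1 := mul_inv_cancel₀ (by positivity)
  linear_combination
    -(x i * x j * x l - kron i j * x l - kron i l * x j - kron j l * x i) * this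

/-- Decoupling splits off one linear factor: Khinchine handles it with `y` frozen, and the quadratic
bound handles the rest. -/
theorem lintegral_cubic_le (T : ι → ι → ι → E) {n : ℕ} (hn : 1 ≤ n) :
    ∫⁻ x, ‖cubic T x‖ₑ ^ (2 * n) ∂(gauss ι) ≤
      ‖(-(2 * √2) : ℝ)‖ₑ ^ (2 * n) * (absMoment (2 * n) * (2 ^ (2 * n) * absMoment (2 * n) ^ 2)) *
        (∑ l, ∑ j, ∑ i, ‖T i j l‖ₑ ^ 2) ^ n := by
  have hq := fun l => continuous_quad fun i j => T i j l
  have h := lintegral_le_of_decoupling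
    (g := fun y z => ∑ l, z l • quad (fun i j => T i j l) y) (by fun_prop) (-(2 * √2))
    (cubic_eq_integral T) (show 1 ≤ 2 * n by omega)
  refine h.trans ?_
  rw [mul_assoc]
  gcongr
  refine (lintegral_mono fun y =>
    lintegral_linear_le (fun l => quad (fun i j => T i j l) y) hn).trans ?_
  rw [lintegral_const_mul _ (Measurable.pow_const (Finset.measurable_sum _ fun l _ =>
    (hq l).enorm.measurable.pow_const 2) n), mul_assoc]
  gcongr
  refine lintegral_sum_pow_le hn _ _ (fun l _ => ?_) _ _ fun l _ => ?_
  · exact (hq l).enorm.measurable.pow_const 2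
  · simp_rw [← pow_mul]
    exact lintegral_quad_le (fun i j => T i j l) hn

end Decoupling

end GaussianChaos

end

/-! ### Wick-ordered cubic polynomials on a Hilbert space and their gradients. -/

noncomputable section

namespace HS

variable {ι H : Type} [NormedAddCommGroup H] [InnerProductSpace ℝ H]
variable {b : HilbertBasis ι ℝ H} {s : ℕ} {G : Type}

section NormedSpace

variable [NormedAddCommGroup G] [NormedSpace ℝ G]

/-- The contraction as a continuous bilinear map. -/
def contractBilin (b : HilbertBasis ι ℝ H) (s : ℕ) (G : Type) [NormedAddCommGroup G]
    [NormedSpace ℝ G] : H →L[ℝ] HS b (s + 1) G →L[ℝ] HS b s G :=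
  LinearMap.mkContinuous₂ (LinearMap.mk₂ ℝ (fun v T => contract v T) contract_add_left
    contract_smul_left (fun v S T => map_add (contract v) S T)
    (fun c v T => map_smul (contract v) c T)) 1 (fun v T => by
      rw [one_mul]
      exact norm_contract_le v T)

theorem _root_.Continuous.contract {Y : Type*} [TopologicalSpace Y] {f : Y → H}
    {g : Y → HS b (s + 1) G} (hf : Continuous f) (hg : Continuous g) :
    Continuous fun y => contract (f y) (g y) :=
  ((contractBilin b s G).continuous.comp hf).clm_apply hg

/-- The operator `T` is invariant under permutations of its three arguments. -/
structure IsSymmetric (T : HS b 3 G) : Prop where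
  comm₂ : ∀ u v, contract u (contract v T) = contract v (contract u T)
  comm₁ : ∀ u v w, contract u (contract v (contract w T)) = contract v (contract u (contract w T))

/-- The iterated gradients of the Wick-ordered cubic polynomial whose leading coefficient is
`T / 6`, where the coordinates with index in `J` are Wick ordered. -/
def wick (J : Finset ι) (T : HS b 3 G) : ∀ s : ℕ, H → HS b s G
  | 0, u => (1 / 6 : ℝ) • contract u (contract u (contract u T)) -
      (1 / 2 : ℝ) • ∑ i ∈ J, contract u (contract (b i) (contract (b i) T))
  | 1, u => (1 / 2 : ℝ) • (contract u (contract u T) -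
      ∑ i ∈ J, contract (b i) (contract (b i) T))
  | 2, u => contract u T
  | 3, _ => T
  | _ + 4, _ => 0

theorem wick_sub (J : Finset ι) (S T : HS b 3 G) (s : ℕ) (u : H) :
    wick J (S - T) s u = wick J S s u - wick J T s u := by
  match s with
  | 0 =>
    simp only [wick, map_sub, Finset.sum_sub_distrib]
    module
  | 1 =>
    simp only [wick, map_sub, Finset.sum_sub_distrib]
    module
  | 2 => simp only [wick, map_sub]
  | 3 => rfl
  | s + 4 => exact (sub_zero _).symm

theorem continuous_wick (J : Finset ι) (T : HS b 3 G) (s : ℕ) : Continuous (wick J T s) := by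
  match s with
  | 0 =>
    refine Continuous.sub ?_ ?_
    · exact (continuous_id.contract (continuous_id.contract
        (continuous_id.contract continuous_const))).const_smul (1 / 6 : ℝ)
    · exact (continuous_finsetSum J fun i _ =>
        continuous_id.contract continuous_const).const_smul (1 / 2 : ℝ)
  | 1 =>
    exact (((continuous_id.contract (continuous_id.contract continuous_const))).sub
      continuous_const).const_smul (1 / 2 : ℝ)
  | 2 => exact continuous_id.contract continuous_const
  | 3 => exact continuous_const
  | s + 4 => exact continuous_const

/-- The Taylor expansion of the iterated gradients. -/
theorem wick_taylor (J : Finset ι) {T : HS b 3 G} (hT : T.IsSymmetric) (s : ℕ) (u p v : H)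
    (hv : contract v T = contract p T) (t : ℝ) :
    wick J T s (u + t • p) = wick J T s u + t • contract v (wick J T (s + 1) u) +
      t ^ 2 • ((1 / 2 : ℝ) • contract v (contract v (wick J T (s + 2) u))) +
      t ^ 3 • ((1 / 6 : ℝ) • contract v (contract v (contract v (wick J T (s + 3) u)))) := by
  -- The hypothesis `hv` concerns the first slot only; symmetry carries it to the other two slots.
  have hv2 : ∀ w, contract v (contract w T) = contract p (contract w T) := fun w => by
    rw [hT.comm₂, hv, hT.comm₂]
  have hv3 : ∀ w z, contract v (contract w (contract z T)) =
      contract p (contract w (contract z T)) := fun w z => by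
    rw [hT.comm₁, hv2, hT.comm₁]
  match s with
  | 0 =>
    simp only [wick, contract_add_left, contract_smul_left, map_add, map_smul, map_sub, map_sum,
      hv3, hv2, hv, Finset.sum_add_distrib, ← Finset.smul_sum]
    rw [hT.comm₁ u p p, hT.comm₂ u p, hT.comm₁ u p u]
    module
  | 1 =>
    simp only [wick, contract_add_left, contract_smul_left, map_add, map_smul,
      hv2, hv, map_zero, smul_zero, add_zero]
    rw [hT.comm₂ u p]
    module
  | 2 =>
    simp only [wick, contract_add_left, contract_smul_left, hv, map_zero, smul_zero, add_zero]
  | 3 => simp only [wick, map_zero, smul_zero, add_zero]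
  | s + 4 => simp only [wick, map_zero, smul_zero, add_zero]

/-- Enlarging `J` beyond the support of `T` does not change anything. -/
theorem wick_congr {J J' : Finset ι} (hJ : J ⊆ J') {T : HS b 3 G} (hT : T.IsSymmetric)
    (hs : ∀ i ∉ J, contract (b i) T = 0) (s : ℕ) {u u' : H} (hu : contract u T = contract u' T) :
    wick J T s u = wick J' T s u' := by
  have hu2 : ∀ w, contract u (contract w T) = contract u' (contract w T) := fun w => by
    rw [hT.comm₂, hu, hT.comm₂]
  have hu3 : ∀ w z, contract u (contract w (contract z T)) =
      contract u' (contract w (contract z T)) := fun w z => by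
    rw [hT.comm₁, hu2, hT.comm₁]
  have hsum : ∑ i ∈ J, contract (b i) (contract (b i) T) =
      ∑ i ∈ J', contract (b i) (contract (b i) T) :=
    Finset.sum_subset hJ fun i _ hi => by rw [hs i hi, map_zero]
  match s with
  | 0 => simp only [wick, ← map_sum, ← hsum, hu, hu2, hu3]
  | 1 => simp only [wick, hu, hu2, hsum]
  | 2 => simp only [wick, hu]
  | 3 => rfl
  | s + 4 => rfl

end NormedSpace

section Moments

open GaussianChaos

variable [NormedAddCommGroup G] [InnerProductSpace ℝ G] [CompleteSpace G]

/-- The vector in `H` with coordinates `y`. -/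
def synth (b : HilbertBasis ι ℝ H) (J : Finset ι) (y : EuclideanSpace ℝ J) : H :=
  ∑ i : J, y i • b i

theorem continuous_synth (J : Finset ι) : Continuous (synth b J) := by
  unfold synth
  fun_prop

theorem sum_contract_enorm_le (J : Finset ι) (T : HS b (s + 1) G) :
    ∑ i : J, ‖contract (b i) T‖ₑ ^ 2 ≤ ‖T‖ₑ ^ 2 := by
  rw [enorm_sq_eq_tsum_contract, Finset.sum_coe_sort J fun i => ‖contract (b i) T‖ₑ ^ 2]
  exact ENNReal.sum_le_tsum J

theorem sum_sum_kron_smul {E κ : Type*} [Fintype κ] [DecidableEq κ] [AddCommGroup E] [Module ℝ E]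
    (c : κ → κ → E) : ∑ j, ∑ i, kron i j • c i j = ∑ i, c i i := by
  simp [kron]

theorem wick_one_eq [DecidableEq ι] (J : Finset ι) {T : HS b 3 G} (hT : T.IsSymmetric)
    (y : EuclideanSpace ℝ J) :
    wick J T 1 (synth b J y) =
      (1 / 2 : ℝ) • quad (fun i j : J => contract (b i) (contract (b j) T)) y := by
  simp only [wick, synth, quad, contract_sum_left, contract_smul_left, map_sum, map_smul,
    sub_smul, Finset.sum_sub_distrib, sum_sum_kron_smul,
    Finset.sum_coe_sort J fun i => contract (b i) (contract (b i) T)]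
  congr 2
  simp only [Finset.smul_sum, smul_smul]
  refine Finset.sum_congr rfl fun j _ => Finset.sum_congr rfl fun i _ => ?_
  rw [mul_comm, hT.comm₂]

/-- For symmetric coefficients the three Wick contractions coincide. After the prefactor `1/6` the
resulting `3` becomes the `1/2` in the definition of `wick`. -/
theorem cubic_eq_of_symm {E κ : Type*} [Fintype κ] [DecidableEq κ] [NormedAddCommGroup E]
    [InnerProductSpace ℝ E] (c : κ → κ → κ → E) (h₁ : ∀ i j l, c i j l = c j i l)
    (h₂ : ∀ i j l, c i j l = c i l j) (y : EuclideanSpace ℝ κ) :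
    cubic c y = ∑ l, ∑ j, ∑ i, (y i * y j * y l) • c i j l -
      (3 : ℝ) • ∑ i, ∑ l, y l • c l i i := by
  have e1 : ∑ l, ∑ j, ∑ i, (kron i j * y l) • c i j l = ∑ i, ∑ l, y l • c l i i := by
    rw [Finset.sum_comm (f := fun i l => y l • c l i i)]
    refine Finset.sum_congr rfl fun l _ => ?_
    simp only [mul_smul, sum_sum_kron_smul]
    exact Finset.sum_congr rfl fun i _ => by rw [h₂, h₁]
  have e2 : ∑ l, ∑ j, ∑ i, (kron i l * y j) • c i j l = ∑ i, ∑ l, y l • c l i i := by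
    rw [Finset.sum_comm, Finset.sum_comm (f := fun i l => y l • c l i i)]
    refine Finset.sum_congr rfl fun l _ => ?_
    simp only [mul_smul, sum_sum_kron_smul]
    exact Finset.sum_congr rfl fun i _ => by rw [h₁]
  have e3 : ∑ l, ∑ j, ∑ i, (kron j l * y i) • c i j l = ∑ i, ∑ l, y l • c l i i := by
    simp_rw [Finset.sum_comm (f := fun j i => (kron j _ * y i) • c i j _)]
    rw [Finset.sum_comm, Finset.sum_comm (f := fun i l => y l • c l i i)]
    refine Finset.sum_congr rfl fun l _ => ?_
    simp only [mul_smul, sum_sum_kron_smul]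
  simp only [cubic, sub_smul, Finset.sum_sub_distrib, e1, e2, e3]
  module

theorem wick_zero_eq [DecidableEq ι] (J : Finset ι) {T : HS b 3 G} (hT : T.IsSymmetric)
    (y : EuclideanSpace ℝ J) :
    wick J T 0 (synth b J y) = (1 / 6 : ℝ) • cubic
      (fun i j l : J => contract (b i) (contract (b j) (contract (b l) T))) y := by
  rw [cubic_eq_of_symm (fun i j l : J => contract (b i) (contract (b j) (contract (b l) T)))
    (fun i j l => hT.comm₁ _ _ _) (fun i j l => by rw [hT.comm₂])]
  simp only [wick, synth, contract_sum_left, contract_smul_left, map_sum, map_smul]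
  rw [← Finset.sum_coe_sort J, smul_sub, smul_smul]
  norm_num only
  congr 2
  simp only [Finset.smul_sum, smul_smul]
  refine Finset.sum_congr rfl fun l _ => Finset.sum_congr rfl fun j _ =>
    Finset.sum_congr rfl fun i _ => ?_
  congr 1
  ring

/-- A constant bounding the moments of order `2n` of all iterated gradients. -/
def momentConst (n : ℕ) : ℝ≥0∞ :=
  1 + absMoment (2 * n) + 2 ^ (2 * n) * absMoment (2 * n) ^ 2 +
    ‖(-(2 * √2) : ℝ)‖ₑ ^ (2 * n) * (absMoment (2 * n) * (2 ^ (2 * n) * absMoment (2 * n) ^ 2))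

theorem momentConst_lt_top (n : ℕ) : momentConst n < ∞ := by
  have := absMoment_lt_top (2 * n)
  unfold momentConst
  finiteness

theorem enorm_le_one {x : ℝ} (h₀ : 0 ≤ x) (h₁ : x ≤ 1) (n : ℕ) : ‖x‖ₑ ^ n ≤ 1 := by
  refine pow_le_one' ?_ n
  rw [Real.enorm_eq_ofReal h₀]
  exact ENNReal.ofReal_le_one.2 h₁

/-- Each nonzero order is a linear, quadratic or cubic chaos, or a constant, with coefficients taken
from `T`. The squared norms of those coefficients sum to at most `‖T‖²`, so the bound does not
depend on `J`. -/
theorem lintegral_wick_le [DecidableEq ι] (J : Finset ι) {T : HS b 3 G} (hT : T.IsSymmetric)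
    (s : ℕ) {n : ℕ} (hn : 1 ≤ n) :
    ∫⁻ y, ‖wick J T s (synth b J y)‖ₑ ^ (2 * n) ∂(gauss J) ≤
      momentConst n * ‖T‖ₑ ^ (2 * n) := by
  have h1 := sum_contract_enorm_le (b := b) J T
  have h2 : ∑ j : J, ∑ i : J, ‖contract (b i) (contract (b j) T)‖ₑ ^ 2 ≤ ‖T‖ₑ ^ 2 :=
    le_trans (Finset.sum_le_sum fun j _ => sum_contract_enorm_le J _) h1
  have h3 : ∑ l : J, ∑ j : J, ∑ i : J,
      ‖contract (b i) (contract (b j) (contract (b l) T))‖ₑ ^ 2 ≤ ‖T‖ₑ ^ 2 :=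
    le_trans (Finset.sum_le_sum fun l _ => Finset.sum_le_sum fun j _ =>
      sum_contract_enorm_le J _) h2
  match s with
  | 0 =>
    simp_rw [wick_zero_eq J hT, enorm_smul, mul_pow]
    rw [lintegral_const_mul' _ _ (by finiteness)]
    refine (mul_le_of_le_one_left zero_le (enorm_le_one (by norm_num) (by norm_num) _)).trans ?_
    refine (lintegral_cubic_le _ hn).trans ?_
    rw [pow_mul ‖T‖ₑ]
    gcongr
    exact le_add_self
  | 1 =>
    simp_rw [wick_one_eq J hT, enorm_smul, mul_pow]
    rw [lintegral_const_mul' _ _ (by finiteness)]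
    refine (mul_le_of_le_one_left zero_le (enorm_le_one (by norm_num) (by norm_num) _)).trans ?_
    refine (lintegral_quad_le _ hn).trans ?_
    rw [pow_mul ‖T‖ₑ]
    gcongr
    exact le_add_self.trans le_self_add
  | 2 =>
    simp_rw [wick, synth, contract_sum_left, contract_smul_left]
    refine (lintegral_linear_le _ hn).trans ?_
    rw [pow_mul ‖T‖ₑ]
    gcongr
    exact (le_add_self.trans le_self_add).trans le_self_add
  | 3 =>
    simp only [wick, lintegral_const, measure_univ, mul_one]
    refine le_mul_of_one_le_left zero_le ?_
    exact ((le_self_add.trans le_self_add).trans le_self_add)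
  | s + 4 =>
    simp [wick, zero_pow (by omega : 2 * n ≠ 0)]

end Moments

end HS

end

/-! ### Chaoses over Gaussian coordinates: convergence in `L^p` and almost everywhere. -/

noncomputable section

namespace HS

open GaussianChaos

variable {ι H X G : Type} [NormedAddCommGroup H] [InnerProductSpace ℝ H]
variable {b : HilbertBasis ι ℝ H} {s : ℕ}
variable [AddCommGroup X] [Module ℝ X] [MeasurableSpace X]

/-- The vector of the coordinates with index in `J`. -/
def coordVec (ξ : ι → X → ℝ) (J : Finset ι) (x : X) : EuclideanSpace ℝ J :=
  WithLp.toLp 2 fun i : J => ξ i x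

/-- The functionals `ξ i` on `X` extend the coordinates `⟪b i, ·⟫` of `H ⊆ X` and are independent
standard Gaussian variables. -/
structure GaussianCoordinates (b : HilbertBasis ι ℝ H) (ι₀ : H →ₗ[ℝ] X) (μ : Measure X)
    (ξ : ι → X → ℝ) : Prop where
  measurable : ∀ i, Measurable (ξ i)
  shift : ∀ i x v (t : ℝ), ξ i (x + t • ι₀ v) = ξ i x + t * inner ℝ (b i) v
  law : ∀ J : Finset ι, μ.map (coordVec ξ J) = gauss J

namespace GaussianCoordinates

variable {ι₀ : H →ₗ[ℝ] X} {μ : Measure X} {ξ : ι → X → ℝ}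

theorem measurable_coordVec (h : GaussianCoordinates b ι₀ μ ξ) (J : Finset ι) :
    Measurable (coordVec ξ J) :=
  (WithLp.measurable_toLp 2 _).comp (measurable_pi_lambda _ fun i => h.measurable i)

theorem synth_coordVec_shift (h : GaussianCoordinates b ι₀ μ ξ) (J : Finset ι) (x : X) (v : H)
    (t : ℝ) : synth b J (coordVec ξ J (x + t • ι₀ v)) =
      synth b J (coordVec ξ J x) + t • ∑ i ∈ J, inner ℝ (b i) v • b i := by
  simp only [synth, coordVec, h.shift, add_smul, Finset.sum_add_distrib, mul_smul,
    ← Finset.smul_sum]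
  rw [Finset.sum_coe_sort J fun i => inner ℝ (b i) v • b i]

variable [NormedAddCommGroup G] [InnerProductSpace ℝ G]

/-- A shift by `v` changes only the coordinates in `J`, hence adds the projection of `v` to their
span. Since `T` vanishes in the other basis directions, it cannot distinguish `v` from that
projection. -/
theorem contract_eq_contract_sum (J : Finset ι) {T : HS b (s + 1) G}
    (hs : ∀ i ∉ J, contract (b i) T = 0) (v : H) :
    contract v T = contract (∑ i ∈ J, inner ℝ (b i) v • b i) T := by
  have h1 : HasSum (fun i => inner ℝ (b i) v • contract (b i) T) (contract v T) := by
    have := (b.hasSum_repr v).mapL ((contractBilin b s G).flip T)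
    simp only [map_smul, b.repr_apply_apply] at this
    exact this
  have h2 := hasSum_sum_of_ne_finset_zero (s := J)
    (L := SummationFilter.unconditional ι)
    (f := fun i => inner ℝ (b i) v • contract (b i) T) fun i hi => by rw [hs i hi, smul_zero]
  rw [h1.unique h2, contract_sum_left]
  simp_rw [contract_smul_left]

variable (ξ) in
/-- The iterated gradients of the Wick-ordered polynomial, as functions on `X`. -/
def chaos (J : Finset ι) (T : HS b 3 G) (s : ℕ) (x : X) : HS b s G :=
  wick J T s (synth b J (coordVec ξ J x))

theorem chaos_taylor (h : GaussianCoordinates b ι₀ μ ξ) {J : Finset ι} {T : HS b 3 G}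
    (hT : T.IsSymmetric) (hs : ∀ i ∉ J, contract (b i) T = 0) (s : ℕ) (x : X) (v : H) (t : ℝ) :
    chaos ξ J T s (x + t • ι₀ v) = chaos ξ J T s x + t • contract v (chaos ξ J T (s + 1) x) +
      t ^ 2 • ((1 / 2 : ℝ) • contract v (contract v (chaos ξ J T (s + 2) x))) +
      t ^ 3 • ((1 / 6 : ℝ) • contract v (contract v (contract v (chaos ξ J T (s + 3) x)))) := by
  rw [chaos, h.synth_coordVec_shift,
    wick_taylor J hT s _ _ v (contract_eq_contract_sum J hs v)]
  rfl

/-- Allows two truncations to be written over one common index set, where their difference is the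
chaos of the difference of the tensors. -/
theorem chaos_congr {J J' : Finset ι} (hJ : J ⊆ J') {T : HS b 3 G} (hT : T.IsSymmetric)
    (hs : ∀ i ∉ J, contract (b i) T = 0) (s : ℕ) (x : X) :
    chaos ξ J T s x = chaos ξ J' T s x := by
  refine wick_congr hJ hT hs s ?_
  simp only [synth, coordVec, contract_sum_left, contract_smul_left]
  rw [Finset.sum_coe_sort J fun i => ξ i x • contract (b i) T,
    Finset.sum_coe_sort J' fun i => ξ i x • contract (b i) T]
  exact Finset.sum_subset hJ fun i _ hi => by rw [hs i hi, smul_zero]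

theorem stronglyMeasurable_chaos (h : GaussianCoordinates b ι₀ μ ξ) (J : Finset ι)
    (T : HS b 3 G) (s : ℕ) : StronglyMeasurable (chaos ξ J T s) :=
  ((continuous_wick J T s).comp (continuous_synth J)).stronglyMeasurable.comp_measurable
    (h.measurable_coordVec J)

theorem eLpNorm_chaos_le [CompleteSpace G] (h : GaussianCoordinates b ι₀ μ ξ) (J : Finset ι)
    {T : HS b 3 G} (hT : T.IsSymmetric) (s : ℕ) {n : ℕ} (hn : 1 ≤ n) :
    eLpNorm (chaos ξ J T s) (2 * n : ℕ) μ ≤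
      momentConst n ^ (1 / (2 * n : ℕ) : ℝ) * ‖T‖ₑ := by
  classical
  have hn0 : (2 * n : ℕ) ≠ 0 := by omega
  rw [eLpNorm_eq_lintegral_rpow_enorm_toReal (by exact_mod_cast hn0)
    (ENNReal.natCast_ne_top _)]
  have hm : Measurable fun y : EuclideanSpace ℝ J => ‖wick J T s (synth b J y)‖ₑ ^ (2 * n) :=
    (((continuous_wick J T s).comp (continuous_synth J)).enorm.measurable).pow_const _
  have h1 : ∫⁻ x, ‖chaos ξ J T s x‖ₑ ^ (2 * n) ∂μ ≤ momentConst n * ‖T‖ₑ ^ (2 * n) := by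
    refine le_trans (le_of_eq ?_) (lintegral_wick_le J hT s hn)
    rw [← h.law J, lintegral_map hm (h.measurable_coordVec J)]
    rfl
  have h2 := ENNReal.rpow_le_rpow h1 (by positivity : (0 : ℝ) ≤ 1 / (2 * n : ℕ))
  rw [ENNReal.mul_rpow_of_nonneg _ _ (by positivity), ← ENNReal.rpow_natCast ‖T‖ₑ,
    ← ENNReal.rpow_mul, mul_one_div_cancel (by exact_mod_cast hn0), ENNReal.rpow_one] at h2
  simpa only [ENNReal.toReal_natCast, ENNReal.rpow_natCast] using h2

theorem memLp_chaos [CompleteSpace G] (h : GaussianCoordinates b ι₀ μ ξ) (J : Finset ι)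
    {T : HS b 3 G} (hT : T.IsSymmetric) (s : ℕ) {n : ℕ} (hn : 1 ≤ n) :
    MemLp (chaos ξ J T s) (2 * n : ℕ) μ := by
  refine ⟨(h.stronglyMeasurable_chaos J T s).aestronglyMeasurable,
    (h.eLpNorm_chaos_le J hT s hn).trans_lt ?_⟩
  exact ENNReal.mul_lt_top (ENNReal.rpow_lt_top_of_nonneg (by positivity)
    (momentConst_lt_top n).ne) (by simp)

theorem IsSymmetric.sub {S T : HS b 3 G} (hS : S.IsSymmetric) (hT : T.IsSymmetric) :
    (S - T).IsSymmetric where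
  comm₂ u v := by simp only [map_sub, hS.comm₂ u v, hT.comm₂ u v]
  comm₁ u v w := by simp only [map_sub, hS.comm₁ u v w, hT.comm₁ u v w]

section Sequence

variable {J : ℕ → Finset ι} {T : ℕ → HS b 3 G}

theorem eLpNorm_chaos_sub_le [CompleteSpace G] (h : GaussianCoordinates b ι₀ μ ξ)
    (hJ : Monotone J) (hT : ∀ N, (T N).IsSymmetric)
    (hs : ∀ N, ∀ i ∉ J N, contract (b i) (T N) = 0) (s : ℕ) {n : ℕ} (hn : 1 ≤ n) (N M : ℕ) :
    eLpNorm (chaos ξ (J N) (T N) s - chaos ξ (J M) (T M) s) (2 * n : ℕ) μ ≤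
      momentConst n ^ (1 / (2 * n : ℕ) : ℝ) * ‖T N - T M‖ₑ := by
  refine le_trans (le_of_eq ?_)
    (h.eLpNorm_chaos_le (J (max N M)) (IsSymmetric.sub (hT N) (hT M)) s hn)
  congr 1
  funext x
  rw [Pi.sub_apply, chaos_congr (hJ (le_max_left N M)) (hT N) (hs N),
    chaos_congr (hJ (le_max_right N M)) (hT M) (hs M)]
  exact (wick_sub _ _ _ _ _).symm

/-- The geometric rate is that of the tensors alone; through the moment bound the same subsequence
serves all orders of gradients simultaneously. -/
theorem exists_fast_subsequence {E : Type*} [SeminormedAddCommGroup E] {u : ℕ → E}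
    (hu : CauchySeq u) : ∃ φ : ℕ → ℕ, StrictMono φ ∧
      ∀ N n m, N ≤ n → N ≤ m → ‖u (φ n) - u (φ m)‖ < (1 / 2) ^ N := by
  have h : ∀ N : ℕ, ∀ᶠ k in atTop, ∀ i, k ≤ i → ∀ j, k ≤ j → ‖u i - u j‖ < (1 / 2) ^ N := by
    intro N
    obtain ⟨k, hk⟩ := Metric.cauchySeq_iff.1 hu ((1 / 2) ^ N) (by positivity)
    filter_upwards [eventually_ge_atTop k] with l hl i hi j hj
    rw [← dist_eq_norm]
    exact hk i (hl.trans hi) j (hl.trans hj)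
  obtain ⟨φ, hφ, hP⟩ := extraction_forall_of_eventually h
  exact ⟨φ, hφ, fun N n m hn hm => hP N _ (hφ.monotone hn) _ (hφ.monotone hm)⟩

theorem ae_exists_tendsto_chaos [CompleteSpace G] (h : GaussianCoordinates b ι₀ μ ξ)
    (hJ : Monotone J) (hT : ∀ N, (T N).IsSymmetric)
    (hs : ∀ N, ∀ i ∉ J N, contract (b i) (T N) = 0) {φ : ℕ → ℕ}
    (hφ : ∀ N n m, N ≤ n → N ≤ m → ‖T (φ n) - T (φ m)‖ < (1 / 2) ^ N) (s : ℕ) :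
    ∀ᵐ x ∂μ, ∃ l, Tendsto (fun k => chaos ξ (J (φ k)) (T (φ k)) s x) atTop (𝓝 l) := by
  -- The added `1` keeps `C` nonzero, so that a strict inequality survives multiplication by it.
  set C : ℝ≥0∞ := momentConst 1 ^ (1 / (2 * 1 : ℕ) : ℝ) + 1 with hC
  have hC0 : C ≠ 0 := by positivity
  have hCt : C ≠ ∞ := ENNReal.add_ne_top.2 ⟨(ENNReal.rpow_lt_top_of_nonneg (by positivity)
    (momentConst_lt_top 1).ne).ne, by simp⟩
  refine Lp.ae_tendsto_of_cauchy_eLpNorm (p := (2 * 1 : ℕ)) (B := fun N => C * (1 / 2) ^ N)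
    (fun k => (h.stronglyMeasurable_chaos _ _ s).aestronglyMeasurable) (by norm_num) ?_ ?_
  · rw [ENNReal.tsum_mul_left]
    refine ENNReal.mul_ne_top hCt ?_
    rw [ENNReal.tsum_geometric, one_div, ENNReal.one_sub_inv_two, inv_inv]
    simp
  · intro N n m hn hm
    refine (h.eLpNorm_chaos_sub_le hJ hT hs s le_rfl _ _).trans_lt ?_
    have h1 : ‖T (φ n) - T (φ m)‖ₑ < (1 / 2) ^ N := by
      rw [← ofReal_norm]
      have := (ENNReal.ofReal_lt_ofReal_iff (by positivity)).2 (hφ N n m hn hm)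
      rwa [ENNReal.ofReal_pow (by positivity), ENNReal.ofReal_div_of_pos (by norm_num),
        ENNReal.ofReal_one, ENNReal.ofReal_ofNat] at this
    calc _ ≤ C * ‖T (φ n) - T (φ m)‖ₑ := by gcongr; exact le_self_add
      _ < _ := ENNReal.mul_lt_mul_right hC0 hCt h1

theorem tendsto_eLpNorm_chaos_sub [CompleteSpace G] [IsProbabilityMeasure μ]
    (h : GaussianCoordinates b ι₀ μ ξ)
    (hJ : Monotone J) (hT : ∀ N, (T N).IsSymmetric)
    (hs : ∀ N, ∀ i ∉ J N, contract (b i) (T N) = 0) (hu : CauchySeq T) {φ : ℕ → ℕ}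
    (hφ : StrictMono φ) {s : ℕ} {D : X → HS b s G}
    (hD : ∀ᵐ x ∂μ, Tendsto (fun k => chaos ξ (J (φ k)) (T (φ k)) s x) atTop (𝓝 (D x)))
    {p : ℕ} (hp : 1 ≤ p) :
    Tendsto (fun N => eLpNorm (chaos ξ (J N) (T N) s - D) p μ) atTop (𝓝 0) := by
  have hDm : AEStronglyMeasurable D μ := aestronglyMeasurable_of_tendsto_ae atTop
    (fun k => (h.stronglyMeasurable_chaos _ _ s).aestronglyMeasurable) hD
  set C : ℝ≥0∞ := momentConst p ^ (1 / (2 * p : ℕ) : ℝ) with hC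
  have hCt : C ≠ ∞ := (ENNReal.rpow_lt_top_of_nonneg (by positivity) (momentConst_lt_top p).ne).ne
  have key : Tendsto (fun N => eLpNorm (chaos ξ (J N) (T N) s - D) (2 * p : ℕ) μ) atTop (𝓝 0) := by
    rw [ENNReal.tendsto_atTop_zero]
    intro ε hε
    obtain ⟨δ, hδ, hδε⟩ : ∃ δ : ℝ, 0 < δ ∧ C * ENNReal.ofReal δ ≤ ε := by
      have : Tendsto (fun δ : ℝ => C * ENNReal.ofReal δ) (𝓝[>] 0) (𝓝 (C * ENNReal.ofReal 0)) := by
        refine (ENNReal.Tendsto.const_mul ?_ (Or.inr hCt)).mono_left nhdsWithin_le_nhds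
        exact ENNReal.continuous_ofReal.tendsto 0
      rw [ENNReal.ofReal_zero, mul_zero] at this
      obtain ⟨δ, h1, h2⟩ := ((this.eventually_le_const hε).and self_mem_nhdsWithin).exists
      exact ⟨δ, h2, h1⟩
    obtain ⟨N₀, hN₀⟩ := Metric.cauchySeq_iff.1 hu δ hδ
    refine ⟨N₀, fun N hN => ?_⟩
    -- Fatou: the distance from the `N`-th chaos to the limit is at most the lower limit of its
    -- distances along the subsequence. This gives convergence of the full sequence.
    refine (Lp.eLpNorm_lim_le_liminf_eLpNorm
      (f := fun k => chaos ξ (J N) (T N) s - chaos ξ (J (φ k)) (T (φ k)) s)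
      (fun k => ((h.stronglyMeasurable_chaos _ _ s).sub
        (h.stronglyMeasurable_chaos _ _ s)).aestronglyMeasurable) _ ?_).trans ?_
    · filter_upwards [hD] with x hx using tendsto_const_nhds.sub hx
    · refine liminf_le_of_frequently_le' (Eventually.frequently ?_)
      filter_upwards [eventually_ge_atTop N₀] with k hk
      refine (h.eLpNorm_chaos_sub_le hJ hT hs s hp _ _).trans (le_trans ?_ hδε)
      gcongr
      rw [← ofReal_norm, ← dist_eq_norm]
      exact ENNReal.ofReal_le_ofReal (hN₀ N hN _ (hk.trans (hφ.id_le k))).le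
  refine tendsto_of_tendsto_of_tendsto_of_le_of_le tendsto_const_nhds key (fun _ => zero_le)
    fun N => ?_
  exact eLpNorm_le_eLpNorm_of_exponent_le (by exact_mod_cast (by omega : p ≤ 2 * p))
    ((h.stronglyMeasurable_chaos _ _ s).aestronglyMeasurable.sub hDm)

end Sequence

end GaussianCoordinates

end HS

end

/-! ### Versions that are polynomial along lines, and the gradients of the limit. -/

noncomputable section

/-- A cubic polynomial curve is absolutely continuous on bounded intervals. -/
theorem absolutelyContinuousOnInterval_cubic {E : Type*} [NormedAddCommGroup E] [NormedSpace ℝ E]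
    (a₀ a₁ a₂ a₃ : E) (t₀ t₁ : ℝ) :
    AbsolutelyContinuousOnInterval
      (fun t : ℝ => a₀ + t • a₁ + t ^ 2 • a₂ + t ^ 3 • a₃) t₀ t₁ := by
  refine ContDiffOn.absolutelyContinuousOnInterval (ContDiff.contDiffOn ?_)
  fun_prop

theorem tendsto_slope_cubic {E : Type*} [NormedAddCommGroup E] [NormedSpace ℝ E]
    (a₀ a₁ a₂ a₃ : E) :
    Tendsto (fun ε : ℝ => ε⁻¹ • ((a₀ + ε • a₁ + ε ^ 2 • a₂ + ε ^ 3 • a₃) - a₀)) (𝓝[≠] 0)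
      (𝓝 a₁) := by
  have h : Tendsto (fun ε : ℝ => a₁ + ε • a₂ + ε ^ 2 • a₃) (𝓝[≠] 0) (𝓝 a₁) := by
    have : Continuous fun ε : ℝ => a₁ + ε • a₂ + ε ^ 2 • a₃ := by fun_prop
    have h2 := this.tendsto 0
    simp only [zero_smul, ne_eq, OfNat.ofNat_ne_zero, not_false_eq_true, zero_pow, add_zero] at h2
    exact h2.mono_left nhdsWithin_le_nhds
  refine h.congr' ?_
  filter_upwards [self_mem_nhdsWithin] with ε hε
  have hε : ε ≠ 0 := hε
  have e : a₀ + ε • a₁ + ε ^ 2 • a₂ + ε ^ 3 • a₃ - a₀ = ε • (a₁ + ε • a₂ + ε ^ 2 • a₃) := by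
    module
  rw [e, inv_smul_smul₀ hε]

/-- A functional which is almost everywhere the limit of functionals that are cubic polynomials
along the lines parallel to `v` has a version that is a cubic polynomial along each of
these lines. -/
theorem exists_version_of_tendsto_cubic {X E : Type*} [AddCommGroup X] [Module ℝ X]
    [MeasurableSpace X] {μ : Measure X} [NormedAddCommGroup E] [NormedSpace ℝ E]
    (f : ℕ → X → E) (F A₁ A₂ A₃ : X → E) (v : X)
    (h : ∀ᵐ x ∂μ, ∀ t : ℝ, Tendsto (fun k => f k (x + t • v)) atTop
      (𝓝 (F x + t • A₁ x + t ^ 2 • A₂ x + t ^ 3 • A₃ x))) :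
    ∃ Fv : X → E, Fv =ᵐ[μ] F ∧
      (∀ (x : X) (t₀ t₁ : ℝ), AbsolutelyContinuousOnInterval (fun t : ℝ => Fv (x + t • v)) t₀ t₁) ∧
      ∀ᵐ x ∂μ, Tendsto (fun ε : ℝ => ε⁻¹ • (Fv (x + ε • v) - Fv x)) (𝓝[≠] 0) (𝓝 (A₁ x)) := by
  classical
  let P : X → E → E → E → E → Prop := fun x a₀ a₁ a₂ a₃ => ∀ t : ℝ,
    Tendsto (fun k => f k (x + t • v)) atTop (𝓝 (a₀ + t • a₁ + t ^ 2 • a₂ + t ^ 3 • a₃))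
  let S : Set X := {x | ∃ a₀ a₁ a₂ a₃, P x a₀ a₁ a₂ a₃}
  -- Re-expanding the cubic about the shifted base point shows that `S` is a union of full lines
  -- parallel to `v`.
  have hshift : ∀ x ∈ S, ∀ r : ℝ, x + r • v ∈ S := by
    rintro x ⟨a₀, a₁, a₂, a₃, hP⟩ r
    refine ⟨a₀ + r • a₁ + r ^ 2 • a₂ + r ^ 3 • a₃, a₁ + (2 * r) • a₂ + (3 * r ^ 2) • a₃,
      a₂ + (3 * r) • a₃, a₃, fun t => ?_⟩
    have h1 := hP (r + t)
    rw [add_smul, ← add_assoc] at h1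
    refine h1.trans (le_of_eq ?_)
    congr 1
    module
  -- On `S` this is the limit at `t = 0`, which does not depend on the coefficients chosen. A line
  -- meets either `S` or its complement but not both, so the value `0` off `S` does not spoil
  -- absolute continuity.
  let Fv : X → E := fun x => if hx : x ∈ S then hx.choose else 0
  have hFv : ∀ x a₀ a₁ a₂ a₃, P x a₀ a₁ a₂ a₃ → Fv x = a₀ := by
    intro x a₀ a₁ a₂ a₃ hP
    have hx : x ∈ S := ⟨a₀, a₁, a₂, a₃, hP⟩
    have e : Fv x = hx.choose := dif_pos hx
    obtain ⟨c₁, c₂, c₃, hc⟩ := hx.choose_spec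
    have := tendsto_nhds_unique (hc 0) (hP 0)
    rw [e]
    simpa using this
  have hline : ∀ x a₀ a₁ a₂ a₃, P x a₀ a₁ a₂ a₃ → ∀ t : ℝ,
      Fv (x + t • v) = a₀ + t • a₁ + t ^ 2 • a₂ + t ^ 3 • a₃ := by
    intro x a₀ a₁ a₂ a₃ hP t
    obtain ⟨c₀, c₁, c₂, c₃, hc⟩ := hshift x ⟨a₀, a₁, a₂, a₃, hP⟩ t
    rw [hFv _ _ _ _ _ hc]
    have h1 := hc 0
    simp only [zero_smul, add_zero, ne_eq, OfNat.ofNat_ne_zero, not_false_eq_true, zero_pow] at h1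
    exact tendsto_nhds_unique h1 (hP t)
  refine ⟨Fv, ?_, fun x t₀ t₁ => ?_, ?_⟩
  · filter_upwards [h] with x hx using hFv x _ _ _ _ hx
  · by_cases hx : x ∈ S
    · obtain ⟨a₀, a₁, a₂, a₃, hP⟩ := hx
      simp_rw [hline x a₀ a₁ a₂ a₃ hP]
      exact absolutelyContinuousOnInterval_cubic a₀ a₁ a₂ a₃ t₀ t₁
    · have : ∀ t : ℝ, Fv (x + t • v) = 0 := by
        intro t
        refine dif_neg fun ht => hx ?_
        have := hshift _ ht (-t)
        rwa [neg_smul, add_neg_cancel_right] at this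
      simp_rw [this]
      simpa using absolutelyContinuousOnInterval_cubic (0 : E) 0 0 0 t₀ t₁
  · filter_upwards [h] with x hx
    have := tendsto_slope_cubic (F x) (A₁ x) (A₂ x) (A₃ x)
    rw [← hFv x _ _ _ _ hx] at this
    simp_rw [hline x _ _ _ _ hx]
    rwa [hFv x _ _ _ _ hx] at this ⊢

namespace HS

open GaussianChaos GaussianCoordinates

variable {ι H X G : Type} [NormedAddCommGroup H] [InnerProductSpace ℝ H]
variable {b : HilbertBasis ι ℝ H}
variable [AddCommGroup X] [Module ℝ X] [MeasurableSpace X]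
variable {ι₀ : H →ₗ[ℝ] X} {μ : Measure X} {ξ : ι → X → ℝ}
variable [NormedAddCommGroup G] [InnerProductSpace ℝ G] [CompleteSpace G]

/-- Cubic Wick polynomials with converging coefficients converge, together with all their
iterated gradients, in `L^p` for every `p`. -/
theorem GaussianCoordinates.exists_limit [IsProbabilityMeasure μ]
    (h : GaussianCoordinates b ι₀ μ ξ)
    {J : ℕ → Finset ι} {T : ℕ → HS b 3 G} (hJ : Monotone J) (hT : ∀ N, (T N).IsSymmetric)
    (hs : ∀ N, ∀ i ∉ J N, contract (b i) (T N) = 0) (hu : CauchySeq T) :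
    ∃ D : ∀ s : ℕ, X → HS b s G,
      (∀ s p : ℕ, 1 ≤ p → MemLp (D s) p μ ∧
        Tendsto (fun N => eLpNorm (chaos ξ (J N) (T N) s - D s) p μ) atTop (𝓝 0)) ∧
      ∀ s, IsMalliavinGradient b ι₀ μ (D s) (D (s + 1)) := by
  classical
  -- A single subsequence must work for every order, because the line argument at order `s` also
  -- uses orders `s + 1`, `s + 2` and `s + 3`.
  obtain ⟨φ, hφ, hfast⟩ := exists_fast_subsequence hu
  have hae := h.ae_exists_tendsto_chaos hJ hT hs hfast
  let D : ∀ s : ℕ, X → HS b s G := fun s x =>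
    if hx : ∃ l, Tendsto (fun k => chaos ξ (J (φ k)) (T (φ k)) s x) atTop (𝓝 l)
    then hx.choose else 0
  have hD : ∀ s, ∀ᵐ x ∂μ,
      Tendsto (fun k => chaos ξ (J (φ k)) (T (φ k)) s x) atTop (𝓝 (D s x)) := by
    intro s
    filter_upwards [hae s] with x hx
    have : D s x = hx.choose := dif_pos hx
    rw [this]
    exact hx.choose_spec
  refine ⟨D, fun s p hp => ?_, fun s v => ?_⟩
  · have ht := h.tendsto_eLpNorm_chaos_sub hJ hT hs hu hφ (hD s) hp
    refine ⟨?_, ht⟩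
    have hDm : AEStronglyMeasurable (D s) μ := aestronglyMeasurable_of_tendsto_ae atTop
      (fun k => (h.stronglyMeasurable_chaos _ _ s).aestronglyMeasurable) (hD s)
    obtain ⟨N, hN⟩ := (ht.eventually_lt_const ENNReal.zero_lt_top).exists
    have h1 : MemLp (chaos ξ (J N) (T N) s) p μ :=
      (h.memLp_chaos (J N) (hT N) s hp).mono_exponent
        (by exact_mod_cast (by omega : p ≤ 2 * p))
    have h2 : MemLp (chaos ξ (J N) (T N) s - D s) p μ := ⟨h1.1.sub hDm, hN⟩
    simpa using h1.sub h2
  · obtain ⟨Fv, h1, h2, h3⟩ := exists_version_of_tendsto_cubic (μ := μ)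
      (fun k => chaos ξ (J (φ k)) (T (φ k)) s) (D s) (fun x => contract v (D (s + 1) x))
      (fun x => (1 / 2 : ℝ) • contract v (contract v (D (s + 2) x)))
      (fun x => (1 / 6 : ℝ) • contract v (contract v (contract v (D (s + 3) x)))) (ι₀ v) (by
        -- By the exact Taylor formula, convergence of four orders at `x` yields convergence at `x +
        -- t v` for all `t`; the exceptional null set does not depend on `t`.
        filter_upwards [hD s, hD (s + 1), hD (s + 2), hD (s + 3)] with x x0 x1 x2 x3 t
        simp_rw [h.chaos_taylor (hT _) (hs _)]
        have c1 := ((continuous_contract v).tendsto _).comp x1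
        have c2 := ((continuous_contract v).tendsto _).comp
          (((continuous_contract v).tendsto _).comp x2)
        have c3 := ((continuous_contract v).tendsto _).comp
          (((continuous_contract v).tendsto _).comp (((continuous_contract v).tendsto _).comp x3))
        exact ((x0.add (c1.const_smul t)).add ((c2.const_smul (1 / 2 : ℝ)).const_smul (t ^ 2))).add
          ((c3.const_smul (1 / 6 : ℝ)).const_smul (t ^ 3)))
    refine ⟨Fv, h1, h2, ?_⟩
    filter_upwards [h3] with x hx using ⟨_, fun w => rfl, hx⟩

end HS

end

/-! ### The measure `μ₂` in the Fourier coordinates of `H^1`. -/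

noncomputable section

open ProbabilityTheory HS GaussianChaos

theorem charFun_modeLaw (k : Mode) (w : ℂ) :
    charFun (modeLaw k) w = Complex.exp (-(‖w‖ ^ 2 / (2 * freqSq k) : ℝ)) := by
  have hk := freqSq_pos k
  have hk' : (freqSq k : ℂ) ≠ 0 := by exact_mod_cast hk.ne'
  have hb : 0 < ((freqSq k / 2 : ℝ) : ℂ).re := by
    rw [Complex.ofReal_re]
    positivity
  have h := GaussianFourier.integral_cexp_neg_mul_sq_norm_add hb Complex.I w
  have hpi : (Real.pi : ℂ) ≠ 0 := by exact_mod_cast Real.pi_ne_zero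
  have hm : Measurable fun z : ℂ =>
      freqSq k / (2 * Real.pi) * Real.exp (-(freqSq k * ‖z‖ ^ 2) / 2) := by fun_prop
  rw [charFun_apply, modeLaw, integral_withDensity_eq_integral_toReal_smul hm.ennreal_ofReal
    (ae_of_all _ fun z => ENNReal.ofReal_lt_top)]
  have e : ∀ z : ℂ, (ENNReal.ofReal
      (freqSq k / (2 * Real.pi) * Real.exp (-(freqSq k * ‖z‖ ^ 2) / 2))).toReal •
      Complex.exp (inner ℝ z w * Complex.I) = (freqSq k / (2 * Real.pi) : ℂ) *
        Complex.exp (-((freqSq k / 2 : ℝ) : ℂ) * ‖z‖ ^ 2 + Complex.I * inner ℝ w z) := by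
    intro z
    rw [ENNReal.toReal_ofReal (by positivity), Complex.exp_add, real_inner_comm w z,
      mul_comm Complex.I, Complex.real_smul, ← mul_assoc]
    push_cast
    congr 3
    ring
  simp_rw [e]
  rw [integral_const_mul, h]
  simp only [Complex.finrank_real_complex]
  norm_num
  rw [← mul_assoc, show (freqSq k / (2 * Real.pi) : ℂ) * (Real.pi / (freqSq k / 2)) = 1 by
    field_simp, one_mul]
  congr 1
  field_simp
  norm_num

/-- Restricting the product measure to `H^β` loses no mass, so pushing forward recovers it and
computations can be made with independent modes. -/
theorem map_coeff_gaussianMeasure {β : ℝ} (hβ : β < 0) :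
    (gaussianMeasure β).map Hs.coeff = coeffLaw := by
  have hP : IsProbabilityMeasure coeffLaw := by
    unfold coeffLaw
    infer_instance
  have he := Hs.measurableEmbedding_coeff β
  have h1 := (isProbabilityMeasure_gaussianMeasure hβ).measure_univ
  rw [gaussianMeasure, he.comap_apply, Set.image_univ] at h1
  rw [gaussianMeasure, he.map_comap]
  exact Measure.restrict_eq_self_of_ae_mem ((mem_ae_iff_prob_eq_one he.measurableSet_range).2 h1)

/-- The real coordinates of a family of Fourier coefficients in the basis `Hs.basis 1`. -/
def realCoord (q : Mode × Fin 2) (c : Mode → ℂ) : ℝ :=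
  inner ℝ (Complex.basisOneI q.2) (freqNorm q.1 ^ (1 : ℝ) • c q.1)

theorem basis_apply (β : ℝ) (q : Mode × Fin 2) : Hs.basis β q = Hs.basisVec β q := by
  simp [Hs.basis]

theorem measurable_realCoord (q : Mode × Fin 2) : Measurable (realCoord q) := by
  unfold realCoord
  fun_prop

theorem integral_exp_coeffLaw (S : Finset Mode) (w : Mode → ℂ) :
    ∫ c, Complex.exp ((∑ k ∈ S, inner ℝ (c k) (w k) : ℝ) * Complex.I) ∂coeffLaw =
      Complex.exp (-(∑ k ∈ S, ‖w k‖ ^ 2 / (2 * freqSq k) : ℝ)) := by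
  have h1 : ∀ c : Mode → ℂ,
      Complex.exp ((∑ k ∈ S, inner ℝ (c k) (w k) : ℝ) * Complex.I) =
        (fun y : (∀ _ : S, ℂ) => ∏ k : S, Complex.exp ((inner ℝ (y k) (w k) : ℝ) * Complex.I))
          (S.restrict c) := by
    intro c
    simp only [Finset.restrict]
    rw [← Complex.exp_sum, ← Finset.sum_mul, Complex.ofReal_sum,
      Finset.sum_coe_sort S fun k => ((inner ℝ (c k) (w k) : ℝ) : ℂ)]
  refine (integral_congr_ae (ae_of_all _ h1)).trans
    ((integral_restrict_infinitePi modeLaw (s := S) (f := fun y : (∀ _ : S, ℂ) =>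
      ∏ k : S, Complex.exp ((inner ℝ (y k) (w k) : ℝ) * Complex.I)) ?_).trans ?_)
  · exact (Continuous.measurable (by fun_prop)).aestronglyMeasurable
  rw [integral_fintype_prod_eq_prod
    (f := fun (k : S) (z : ℂ) => Complex.exp ((inner ℝ z (w k) : ℝ) * Complex.I))]
  simp_rw [← charFun_apply, charFun_modeLaw]
  rw [← Complex.exp_sum, Finset.sum_coe_sort S
    fun k => -((‖w k‖ ^ 2 / (2 * freqSq k) : ℝ) : ℂ), Finset.sum_neg_distrib,
    Complex.ofReal_sum]

/-- Real and imaginary parts of the `k`-th coefficient have variance `|k|⁻²`, and the `H^1`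
normalization multiplies them by `|k|`. The identity of laws is checked on characteristic functions,
which factor over modes. -/
theorem law_realCoord {β : ℝ} (hβ : β < 0) (J : Finset (Mode × Fin 2)) :
    (gaussianMeasure β).map (coordVec (fun q (φ : Hs β) => realCoord q φ.coeff) J) = gauss J := by
  classical
  have := isProbabilityMeasure_gaussianMeasure hβ
  have hm : Measurable fun c : Mode → ℂ => (WithLp.toLp 2 fun q : J => realCoord q c :
      EuclideanSpace ℝ J) :=
    (WithLp.measurable_toLp 2 _).comp (measurable_pi_lambda _ fun q => measurable_realCoord _)
  have hmap : (gaussianMeasure β).map (coordVec (fun q (φ : Hs β) => realCoord q φ.coeff) J) =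
      coeffLaw.map fun c : Mode → ℂ => (WithLp.toLp 2 fun q : J => realCoord q c :
        EuclideanSpace ℝ J) := by
    rw [← map_coeff_gaussianMeasure hβ, Measure.map_map hm (Hs.measurable_coeff β)]
    rfl
  have hP : IsProbabilityMeasure coeffLaw := by
    unfold coeffLaw
    infer_instance
  have := Measure.isProbabilityMeasure_map (μ := coeffLaw) hm.aemeasurable
  rw [hmap]
  refine Measure.ext_of_charFun (funext fun t => ?_)
  rw [charFun_stdGaussian, charFun_apply, integral_map hm.aemeasurable (by fun_prop)]
  -- `J` may contain only one of the two real coordinates of a mode; extending `t` by `0` lets both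
  -- be grouped into one complex dual vector `w k`.
  let t' : Mode × Fin 2 → ℝ := fun q => if h : q ∈ J then t ⟨q, h⟩ else 0
  let S : Finset Mode := J.image Prod.fst
  have hJS : J ⊆ S ×ˢ Finset.univ := fun q hq =>
    Finset.mem_product.2 ⟨Finset.mem_image_of_mem _ hq, Finset.mem_univ _⟩
  let w : Mode → ℂ := fun k => freqNorm k ^ (1 : ℝ) • ∑ r : Fin 2, t' (k, r) • Complex.basisOneI r
  have hsum : ∀ f : Mode × Fin 2 → ℝ → ℝ, (∀ q, f q 0 = 0) →
      ∑ q : J, f q (t q) = ∑ k ∈ S, ∑ r : Fin 2, f (k, r) (t' (k, r)) := by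
    intro f hf
    rw [← Finset.sum_product (f := fun q => f q (t' q)),
      ← Finset.sum_subset hJS (fun q _ hq => by simp [t', hq, hf]), ← Finset.sum_coe_sort J]
    exact Finset.sum_congr rfl fun q _ => by simp [t']
  have e1 : ∀ c : Mode → ℂ, inner ℝ (WithLp.toLp 2 fun q : J => realCoord q c :
      EuclideanSpace ℝ J) t = ∑ k ∈ S, inner ℝ (c k) (w k) := by
    intro c
    rw [PiLp.inner_apply]
    simp only [RCLike.inner_apply, conj_trivial]
    rw [hsum (fun q y => y * realCoord q c) (fun q => zero_mul _)]
    refine Finset.sum_congr rfl fun k _ => ?_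
    simp only [w, realCoord, real_inner_smul_right, inner_sum]
    rw [Finset.mul_sum]
    refine Finset.sum_congr rfl fun r _ => ?_
    rw [real_inner_comm]
    ring
  have e2 : ‖t‖ ^ 2 / 2 = ∑ k ∈ S, ‖w k‖ ^ 2 / (2 * freqSq k) := by
    rw [EuclideanSpace.real_norm_sq_eq, hsum (fun q y => y ^ 2) (fun q => by simp),
      Finset.sum_div]
    refine Finset.sum_congr rfl fun k _ => ?_
    have hk := freqSq_pos k
    have h1 : ‖∑ r : Fin 2, t' (k, r) • Complex.basisOneI r‖ ^ 2 = ∑ r : Fin 2, t' (k, r) ^ 2 := by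
      rw [← Complex.normSq_eq_norm_sq]
      simp [Complex.normSq_apply, Fin.sum_univ_two]
      ring
    simp only [w]
    rw [norm_smul, mul_pow, h1, Real.rpow_one, Real.norm_of_nonneg (freqNorm_pos k).le, freqNorm,
      Real.sq_sqrt hk.le]
    field_simp
  simp_rw [e1]
  rw [integral_exp_coeffLaw, ← e2]
  push_cast
  ring_nf

theorem gaussianCoordinates_Hs {β : ℝ} (hβ : β < 0) :
    GaussianCoordinates (Hs.basis 1) (cameronMartin hβ) (gaussianMeasure β)
      (fun q φ => realCoord q φ.coeff) where
  measurable q := (measurable_realCoord q).comp (Hs.measurable_coeff β)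
  shift q φ v t := by
    rw [basis_apply, Hs.inner_basisVec]
    change inner ℝ _ (freqNorm q.1 ^ (1 : ℝ) • (φ.coeff q.1 + t • v.coeff q.1)) = _
    simp only [realCoord, smul_add, inner_add_right, real_inner_smul_right]
    ring
  law := law_realCoord hβ

end

/-! ### The lattice sum that governs the Hilbert–Schmidt norm. -/

noncomputable section

/-- The weight `|k|^{-2-δ}`, extended by `0` at `k = 0`. -/
def latticeWeight (δ : ℝ) (k : ℤ × ℤ) : ℝ≥0∞ :=
  if k = 0 then 0 else ENNReal.ofReal (freqNorm k ^ (-2 - δ))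

theorem tsum_latticeWeight_ne_top {δ : ℝ} (hδ : 0 < δ) : ∑' k, latticeWeight δ k ≠ ∞ := by
  have h := (summable_freqNorm (β := -δ / 2) (by linarith)).tsum_ofReal_ne_top
  have e : ∑' k, latticeWeight δ k = ∑' k : Mode, latticeWeight δ k := by
    refine (tsum_subtype_eq_of_support_subset (s := {k | k ≠ 0}) fun k hk => ?_).symm
    intro h0
    exact hk (if_pos h0)
  rw [e]
  refine ne_top_of_le_ne_top h (ENNReal.tsum_le_tsum fun k => ?_)
  rw [latticeWeight, if_neg k.2]
  refine ENNReal.ofReal_le_ofReal ?_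
  have hp := freqNorm_pos k
  have hs : freqSq k = freqNorm k ^ (2 : ℝ) := by
    rw [Real.rpow_two, freqNorm, Real.sq_sqrt (freqSq_pos k).le]
  rw [hs, ← Real.rpow_natCast, ← Real.rpow_mul hp.le, mul_div_assoc', mul_comm _ (2 : ℝ),
    mul_div_assoc, ← Real.rpow_sub hp]
  have : (-δ / 2 * (2 : ℕ) - 2 : ℝ) = -2 - δ := by push_cast; ring
  rw [this]
  exact le_mul_of_one_le_left (by positivity) (by norm_num)

/-- `A, B, C, K` stand for the logarithms of `|a|, |b|, |c|, |a+b-c|`. The largest of the four is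
dropped: it dominates the others, so its decay, together with `3δK`, pays for the exponent `-2-δ` on
the remaining three. -/
theorem exp_le_sum_exp {A B C K δ : ℝ}
    (hδ : 0 < δ) (hδ' : δ ≤ 1) :
    Real.exp (-2 * (A + B + C) - 3 * δ * K) ≤
      Real.exp ((-2 - δ) * (A + B + C)) + Real.exp ((-2 - δ) * (K + B + C)) +
        Real.exp ((-2 - δ) * (A + K + C)) + Real.exp ((-2 - δ) * (A + B + K)) := by
  have p1 := Real.exp_pos ((-2 - δ) * (A + B + C))
  have p2 := Real.exp_pos ((-2 - δ) * (K + B + C))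
  have p3 := Real.exp_pos ((-2 - δ) * (A + K + C))
  have p4 := Real.exp_pos ((-2 - δ) * (A + B + K))
  have key : ∀ x y z m : ℝ, x ≤ m → y ≤ m → z ≤ m →
      -2 * (m + y + z) - 3 * δ * x ≤ (-2 - δ) * (x + y + z) := by
    intro x y z m hx hy hz
    nlinarith [mul_nonneg hδ.le (sub_nonneg.2 hy), mul_nonneg hδ.le (sub_nonneg.2 hz),
      mul_nonneg (sub_nonneg.2 hδ') (sub_nonneg.2 hx)]
  -- Two rounds of comparisons find the largest: `A` against `B` and `C` against `K`, then the
  -- winners.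
  rcases le_total A B with hAB | hAB <;> rcases le_total C K with hCK | hCK <;>
    [rcases le_total B K with h | h; rcases le_total B C with h | h;
      rcases le_total A K with h | h; rcases le_total A C with h | h]
  · have := Real.exp_le_exp.2 (show -2 * (A + B + C) - 3 * δ * K ≤ (-2 - δ) * (A + B + C) by
      nlinarith [mul_nonneg hδ.le (sub_nonneg.2 (hAB.trans h)), mul_nonneg hδ.le (sub_nonneg.2 h),
        mul_nonneg hδ.le (sub_nonneg.2 hCK)])
    linarith
  · have := Real.exp_le_exp.2 (show -2 * (A + B + C) - 3 * δ * K ≤ (-2 - δ) * (A + K + C) by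
      linarith [key K A C B h hAB (hCK.trans h)])
    linarith
  · have := Real.exp_le_exp.2 (show -2 * (A + B + C) - 3 * δ * K ≤ (-2 - δ) * (A + B + K) by
      linarith [key K A B C hCK (hAB.trans h) h])
    linarith
  · have := Real.exp_le_exp.2 (show -2 * (A + B + C) - 3 * δ * K ≤ (-2 - δ) * (A + K + C) by
      linarith [key K A C B (hCK.trans h) hAB h])
    linarith
  · have := Real.exp_le_exp.2 (show -2 * (A + B + C) - 3 * δ * K ≤ (-2 - δ) * (A + B + C) by
      nlinarith [mul_nonneg hδ.le (sub_nonneg.2 (hAB.trans h)), mul_nonneg hδ.le (sub_nonneg.2 h),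
        mul_nonneg hδ.le (sub_nonneg.2 hCK)])
    linarith
  · have := Real.exp_le_exp.2 (show -2 * (A + B + C) - 3 * δ * K ≤ (-2 - δ) * (K + B + C) by
      linarith [key K B C A h hAB (hCK.trans h)])
    linarith
  · have := Real.exp_le_exp.2 (show -2 * (A + B + C) - 3 * δ * K ≤ (-2 - δ) * (A + B + K) by
      linarith [key K A B C hCK h (hAB.trans h)])
    linarith
  · have := Real.exp_le_exp.2 (show -2 * (A + B + C) - 3 * δ * K ≤ (-2 - δ) * (K + B + C) by
      linarith [key K B C A (hCK.trans h) hAB h])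
    linarith

/-- The squared norm of the coefficient at `(a, b, c)` of the cubic nonlinearity. -/
def tripleWeight (β : ℝ) (a b c : Mode) : ℝ≥0∞ :=
  if (a + b - c : ℤ × ℤ) = 0 then 0 else
    ENNReal.ofReal ((freqNorm (a + b - c : ℤ × ℤ) ^ β *
      (freqNorm a * freqNorm b * freqNorm c)⁻¹) ^ 2)

theorem tripleWeight_le {β δ : ℝ} (hδ : 0 < δ) (hδ' : δ ≤ 1) (hβ : 3 * δ ≤ -2 * β)
    (a b c : Mode) : tripleWeight β a b c ≤
      latticeWeight δ a * latticeWeight δ b * latticeWeight δ c +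
      latticeWeight δ (a + b - c) * latticeWeight δ b * latticeWeight δ c +
      latticeWeight δ a * latticeWeight δ (a + b - c) * latticeWeight δ c +
      latticeWeight δ a * latticeWeight δ b * latticeWeight δ (a + b - c) := by
  rw [tripleWeight]
  split_ifs with h0
  · exact zero_le
  have ha := freqNorm_pos a
  have hb := freqNorm_pos b
  have hc := freqNorm_pos c
  have hk := freqNorm_pos ⟨_, h0⟩
  have hk1 := Real.log_nonneg (one_le_freqNorm ⟨_, h0⟩)
  simp only at hk hk1
  simp only [latticeWeight, if_neg a.2, if_neg b.2, if_neg c.2, if_neg h0]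
  repeat rw [← ENNReal.ofReal_mul (by positivity)]
  repeat rw [← ENNReal.ofReal_add (by positivity) (by positivity)]
  refine ENNReal.ofReal_le_ofReal ?_
  have e := exp_le_sum_exp (A := Real.log (freqNorm a)) (B := Real.log (freqNorm b))
    (C := Real.log (freqNorm c)) (K := Real.log (freqNorm (a + b - c : ℤ × ℤ))) hδ hδ'
  have el : (freqNorm (a + b - c : ℤ × ℤ) ^ β * (freqNorm a * freqNorm b * freqNorm c)⁻¹) ^ 2 =
      Real.exp (-2 * (Real.log (freqNorm a) + Real.log (freqNorm b) + Real.log (freqNorm c)) +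
        2 * β * Real.log (freqNorm (a + b - c : ℤ × ℤ))) := by
    rw [← Real.log_mul ha.ne' hb.ne', ← Real.log_mul (by positivity) hc.ne', Real.exp_add,
      mul_comm (-2 : ℝ), Real.exp_mul, Real.exp_log (by positivity), mul_comm (2 * β),
      ← Real.rpow_def_of_pos hk, mul_pow, ← Real.rpow_natCast, ← Real.rpow_mul hk.le,
      Real.rpow_neg (by positivity), Real.rpow_two, inv_pow, mul_comm]
    congr 2
    push_cast
    ring
  rw [el]
  simp only [Real.rpow_def_of_pos ha, Real.rpow_def_of_pos hb, Real.rpow_def_of_pos hc,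
    Real.rpow_def_of_pos hk, ← Real.exp_add, ← add_mul]
  simp only [mul_comm (-2 - δ)] at e
  refine (Real.exp_le_exp.2 ?_).trans e
  nlinarith [mul_nonneg (sub_nonneg.2 hβ) hk1]

/-- Any three of `a`, `b`, `c`, `a+b-c` can serve as independent summation variables. Summing first
over a variable that occurs only through `a+b-c`, by translation invariance, makes each of the four
majorants equal to `(∑ |k|^(-2-δ))³`. -/
theorem tsum_tripleWeight_ne_top {β : ℝ} (hβ : β < 0) :
    ∑' (a : Mode) (b : Mode) (c : Mode), tripleWeight β a b c ≠ ∞ := by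
  obtain ⟨δ, hδ, hδ', hδβ⟩ : ∃ δ : ℝ, 0 < δ ∧ δ ≤ 1 ∧ 3 * δ ≤ -2 * β :=
    ⟨min 1 (-2 * β / 3), lt_min one_pos (by linarith), min_le_left _ _,
      by linarith [min_le_right 1 (-2 * β / 3)]⟩
  set h := latticeWeight δ with hh
  set S := ∑' k, h k with hS
  have hSt : S ≠ ∞ := tsum_latticeWeight_ne_top hδ
  have hle : ∀ f : ℤ × ℤ → ℝ≥0∞, ∑' a : Mode, f a ≤ ∑' a, f a := fun f =>
    ENNReal.tsum_comp_le_tsum_of_injective Subtype.val_injective f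
  have s1 : ∀ d : ℤ × ℤ, ∑' a : ℤ × ℤ, h (a + d) = S := fun d => (Equiv.addRight d).tsum_eq h
  have s2 : ∀ d : ℤ × ℤ, ∑' c : ℤ × ℤ, h (d - c) = S := fun d => (Equiv.subLeft d).tsum_eq h
  have s3 : ∀ a c : ℤ × ℤ, ∑' b : ℤ × ℤ, h (a + b - c) = S := fun a c => by
    rw [← s1 (a - c)]
    refine tsum_congr fun b => ?_
    congr 1
    abel
  have t1 : ∑' (a : ℤ × ℤ) (b : ℤ × ℤ) (c : ℤ × ℤ), h a * h b * h c = S * S * S := by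
    simp only [ENNReal.tsum_mul_left, ENNReal.tsum_mul_right, ← hS]
  have t2 : ∑' (a : ℤ × ℤ) (b : ℤ × ℤ) (c : ℤ × ℤ), h (a + b - c) * h b * h c = S * S * S := by
    simp_rw [fun a : ℤ × ℤ => ENNReal.tsum_comm (f := fun b c => h (a + b - c) * h b * h c)]
    rw [ENNReal.tsum_comm]
    simp_rw [fun c : ℤ × ℤ => ENNReal.tsum_comm (f := fun a b => h (a + b - c) * h b * h c),
      ENNReal.tsum_mul_right, add_sub_assoc, s1]
    simp only [ENNReal.tsum_mul_left, ENNReal.tsum_mul_right, ← hS]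
  have t3 : ∑' (a : ℤ × ℤ) (b : ℤ × ℤ) (c : ℤ × ℤ), h a * h (a + b - c) * h c = S * S * S := by
    simp_rw [fun a : ℤ × ℤ => ENNReal.tsum_comm (f := fun b c => h a * h (a + b - c) * h c),
      ENNReal.tsum_mul_right, ENNReal.tsum_mul_left, s3]
    simp only [ENNReal.tsum_mul_left, ENNReal.tsum_mul_right, ← hS]
  have t4 : ∑' (a : ℤ × ℤ) (b : ℤ × ℤ) (c : ℤ × ℤ), h a * h b * h (a + b - c) = S * S * S := by
    simp_rw [ENNReal.tsum_mul_left, s2]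
    simp only [ENNReal.tsum_mul_left, ENNReal.tsum_mul_right, ← hS]
  have tot : ∑' (a : Mode) (b : Mode) (c : Mode), tripleWeight β a b c ≤
      ∑' (a : ℤ × ℤ) (b : ℤ × ℤ) (c : ℤ × ℤ), (h a * h b * h c + h (a + b - c) * h b * h c +
        h a * h (a + b - c) * h c + h a * h b * h (a + b - c)) := by
    refine le_trans (ENNReal.tsum_le_tsum fun a => ?_) (hle _)
    refine le_trans (ENNReal.tsum_le_tsum fun b => ?_) (hle _)
    exact le_trans (ENNReal.tsum_le_tsum fun c => tripleWeight_le hδ hδ' hδβ a b c) (hle _)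
  refine ne_top_of_le_ne_top ?_ tot
  simp_rw [ENNReal.tsum_add]
  rw [t1, t2, t3, t4]
  finiteness

end

/-! ### Trilinear Hilbert–Schmidt maps with given coefficients, and their symmetrization. -/

noncomputable section

namespace HS

variable {ι H G : Type} [NormedAddCommGroup H] [InnerProductSpace ℝ H]
variable {b : HilbertBasis ι ℝ H} [NormedAddCommGroup G] [NormedSpace ℝ G]

/-- The trilinear map with the coefficients `c p q r`, `p, q, r ∈ J`. -/
def ofTensor (b : HilbertBasis ι ℝ H) (J : Finset ι) (c : ι → ι → ι → G) : HS b 3 G :=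
  ∑ p ∈ J, ∑ q ∈ J, ∑ r ∈ J, elementary b ![p, q, r] (c p q r)

theorem ofTensor_apply (J : Finset ι) (c : ι → ι → ι → G) (w : Fin 3 → H) :
    (ofTensor b J c).toMultilinear w = ∑ p ∈ J, ∑ q ∈ J, ∑ r ∈ J,
      (inner ℝ (b p) (w 0) * inner ℝ (b q) (w 1) * inner ℝ (b r) (w 2)) • c p q r := by
  simp only [ofTensor, toMultilinear_sum, _root_.sum_apply, elementary_apply,
    Fin.prod_univ_three]
  rfl

theorem ofTensor_swap_left (J : Finset ι) {c : ι → ι → ι → G} (h : ∀ p q r, c p q r = c q p r)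
    (u v w : H) : (ofTensor b J c).toMultilinear ![u, v, w] =
      (ofTensor b J c).toMultilinear ![v, u, w] := by
  rw [ofTensor_apply, ofTensor_apply, Finset.sum_comm]
  refine Finset.sum_congr rfl fun p _ => Finset.sum_congr rfl fun q _ =>
    Finset.sum_congr rfl fun r _ => ?_
  rw [h p q r]
  congr 1
  simp only [Matrix.cons_val]
  ring

theorem ofTensor_swap_right (J : Finset ι) {c : ι → ι → ι → G} (h : ∀ p q r, c p q r = c p r q)
    (u v w : H) : (ofTensor b J c).toMultilinear ![u, v, w] =
      (ofTensor b J c).toMultilinear ![u, w, v] := by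
  rw [ofTensor_apply, ofTensor_apply]
  refine Finset.sum_congr rfl fun p _ => ?_
  rw [Finset.sum_comm]
  refine Finset.sum_congr rfl fun q _ => Finset.sum_congr rfl fun r _ => ?_
  rw [h p q r]
  congr 1
  simp only [Matrix.cons_val]
  ring

theorem toMultilinear_contract₃ (T : HS b 3 G) (u v w : H) (z : Fin 0 → H) :
    (contract u (contract v (contract w T))).toMultilinear z = T.toMultilinear ![w, v, u] := by
  rw [toMultilinear_contract, toMultilinear_contract, toMultilinear_contract]
  congr 1
  funext i
  fin_cases i <;> rfl

theorem toMultilinear_contract₂ (T : HS b 3 G) (u v : H) (z : Fin 1 → H) :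
    (contract u (contract v T)).toMultilinear z = T.toMultilinear ![v, u, z 0] := by
  rw [toMultilinear_contract, toMultilinear_contract]
  congr 1
  funext i
  fin_cases i <;> rfl

theorem isSymmetric_ofTensor (J : Finset ι) {c : ι → ι → ι → G}
    (h₁ : ∀ p q r, c p q r = c q p r) (h₂ : ∀ p q r, c p q r = c p r q) :
    (ofTensor b J c).IsSymmetric where
  comm₂ u v := ext_toMultilinear fun z => by
    rw [toMultilinear_contract₂, toMultilinear_contract₂, ofTensor_swap_left J h₁]
  comm₁ u v w := ext_toMultilinear fun z => by
    rw [toMultilinear_contract₃, toMultilinear_contract₃, ofTensor_swap_right J h₂]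

theorem contract_ofTensor_eq_zero {J : Finset ι} (c : ι → ι → ι → G) {i : ι} (hi : i ∉ J) :
    contract (b i) (ofTensor b J c) = 0 := by
  refine ext_toMultilinear fun z => ?_
  rw [toMultilinear_contract, ofTensor_apply]
  refine Finset.sum_eq_zero fun p hp => Finset.sum_eq_zero fun q _ =>
    Finset.sum_eq_zero fun r _ => ?_
  have : inner ℝ (b p) (b i) = 0 := b.orthonormal.2 fun h => hi (h ▸ hp)
  rw [Fin.cons_zero, this, zero_mul, zero_mul, zero_smul]

theorem ofTensor_apply_basis {J : Finset ι} {c : ι → ι → ι → G}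
    (hc : ∀ p q r, ¬(p ∈ J ∧ q ∈ J ∧ r ∈ J) → c p q r = 0) (p q r : ι) :
    (ofTensor b J c).toMultilinear ![b p, b q, b r] = c p q r := by
  classical
  have hb : ∀ i j, inner ℝ (b i) (b j) = if i = j then (1 : ℝ) else 0 :=
    orthonormal_iff_ite.1 b.orthonormal
  rw [ofTensor_apply]
  simp only [Matrix.cons_val, hb]
  by_cases h : p ∈ J ∧ q ∈ J ∧ r ∈ J
  · obtain ⟨hp, hq, hr⟩ := h
    rw [Finset.sum_eq_single_of_mem p hp fun p' _ h' => by simp [h'],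
      Finset.sum_eq_single_of_mem q hq fun q' _ h' => by simp [h'],
      Finset.sum_eq_single_of_mem r hr fun r' _ h' => by simp [h']]
    simp
  · rw [hc p q r h]
    refine Finset.sum_eq_zero fun p' hp => Finset.sum_eq_zero fun q' hq =>
      Finset.sum_eq_zero fun r' hr => ?_
    by_cases h1 : p' = p
    · by_cases h2 : q' = q
      · by_cases h3 : r' = r
        · subst h1 h2 h3
          exact (h ⟨hp, hq, hr⟩).elim
        · simp [h3]
      · simp [h2]
    · simp [h1]

theorem enorm_sq_three (T : HS b 3 G) :
    ‖T‖ₑ ^ 2 = ∑' (p : ι) (q : ι) (r : ι), ‖T.toMultilinear ![b p, b q, b r]‖ₑ ^ 2 := by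
  rw [enorm_sq_eq_tsum_contract]
  refine tsum_congr fun p => ?_
  rw [enorm_sq_eq_tsum_contract]
  refine tsum_congr fun q => ?_
  rw [enorm_sq_eq_tsum_contract]
  refine tsum_congr fun r => ?_
  rw [enorm_sq, tsum_eq_single Fin.elim0 fun j hj => (hj (Subsingleton.elim _ _)).elim,
    toMultilinear_contract₃]

/-- The symmetrization (multiplied by `6`) of a tensor that is symmetric in its first two
indices. -/
def symmTensor (A : ι → ι → ι → G) (p q r : ι) : G :=
  (2 : ℝ) • (A p q r + A p r q + A q r p)

theorem symmTensor_swap_left {A : ι → ι → ι → G} (hA : ∀ p q r, A p q r = A q p r) (p q r : ι) :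
    symmTensor A p q r = symmTensor A q p r := by
  rw [symmTensor, symmTensor, hA p q r]
  congr 1
  abel

theorem symmTensor_swap_right {A : ι → ι → ι → G} (hA : ∀ p q r, A p q r = A q p r) (p q r : ι) :
    symmTensor A p q r = symmTensor A p r q := by
  rw [symmTensor, symmTensor, hA q r p]
  congr 1
  abel

/-- `12 = 2² · 3`: the prefactor squared, times Cauchy–Schwarz for three terms. -/
theorem enorm_symmTensor_sq_le (A : ι → ι → ι → G) (p q r : ι) :
    ‖symmTensor A p q r‖ₑ ^ 2 ≤ 12 * (‖A p q r‖ₑ ^ 2 + ‖A p r q‖ₑ ^ 2 + ‖A q r p‖ₑ ^ 2) := by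
  simp only [enorm_pow_eq_ofReal]
  rw [← ENNReal.ofReal_add (by positivity) (by positivity),
    ← ENNReal.ofReal_add (by positivity) (by positivity),
    show (12 : ℝ≥0∞) = ENNReal.ofReal 12 by simp, ← ENNReal.ofReal_mul (by norm_num)]
  refine ENNReal.ofReal_le_ofReal ?_
  rw [symmTensor, norm_smul, Real.norm_ofNat]
  have h : ‖A p q r + A p r q + A q r p‖ ≤ ‖A p q r‖ + ‖A p r q‖ + ‖A q r p‖ := norm_add₃_le
  have h2 := pow_le_pow_left₀ (norm_nonneg _) h 2
  nlinarith [sq_nonneg (‖A p q r‖ - ‖A p r q‖), sq_nonneg (‖A p r q‖ - ‖A q r p‖),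
    sq_nonneg (‖A p q r‖ - ‖A q r p‖)]

/-- Relabelling the indices makes the three sums equal, whence `36 = 12 · 3`. -/
theorem enorm_sq_le_of_symmTensor {T : HS b 3 G} {A : ι → ι → ι → G}
    (h : ∀ p q r, T.toMultilinear ![b p, b q, b r] = symmTensor A p q r) :
    ‖T‖ₑ ^ 2 ≤ 36 * ∑' (p : ι) (q : ι) (r : ι), ‖A p q r‖ₑ ^ 2 := by
  rw [enorm_sq_three]
  simp_rw [h]
  have e1 : ∑' (p : ι) (q : ι) (r : ι), ‖A p r q‖ₑ ^ 2 =
      ∑' (p : ι) (q : ι) (r : ι), ‖A p q r‖ₑ ^ 2 :=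
    tsum_congr fun p => ENNReal.tsum_comm
  have e2 : ∑' (p : ι) (q : ι) (r : ι), ‖A q r p‖ₑ ^ 2 =
      ∑' (p : ι) (q : ι) (r : ι), ‖A p q r‖ₑ ^ 2 := by
    rw [ENNReal.tsum_comm]
    exact tsum_congr fun q => ENNReal.tsum_comm
  calc _ ≤ ∑' (p : ι) (q : ι) (r : ι),
        12 * (‖A p q r‖ₑ ^ 2 + ‖A p r q‖ₑ ^ 2 + ‖A q r p‖ₑ ^ 2) :=
        ENNReal.tsum_le_tsum fun p => ENNReal.tsum_le_tsum fun q => ENNReal.tsum_le_tsum fun r =>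
          enorm_symmTensor_sq_le A p q r
    _ = _ := by
        simp_rw [ENNReal.tsum_mul_left, ENNReal.tsum_add]
        rw [e1, e2]
        ring

/-- The Wick polynomial of a symmetrized tensor. -/
theorem wick_symmTensor (J : Finset ι) (A : ι → ι → ι → G) (x : ι → ℝ) (z : Fin 0 → H) :
    (wick J (ofTensor b J (symmTensor A)) 0 (∑ p ∈ J, x p • b p)).toMultilinear z =
      ∑ p ∈ J, ∑ q ∈ J, ∑ r ∈ J, (x p * x q * x r) • A p q r -
        ∑ p ∈ J, ∑ r ∈ J, x r • (A p p r + (2 : ℝ) • A p r p) := by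
  classical
  have hb : ∀ i j, inner ℝ (b i) (b j) = if i = j then (1 : ℝ) else 0 :=
    orthonormal_iff_ite.1 b.orthonormal
  have hu : ∀ p ∈ J, inner ℝ (b p) (∑ q ∈ J, x q • b q) = x p := by
    intro p hp
    simp [inner_sum, real_inner_smul_right, hb, hp]
  simp only [wick, toMultilinear_sub, toMultilinear_smul, toMultilinear_sum,
    _root_.sub_apply, _root_.smul_apply,
    _root_.sum_apply, toMultilinear_contract₃]
  have e1 : (ofTensor b J (symmTensor A)).toMultilinear
      ![∑ p ∈ J, x p • b p, ∑ p ∈ J, x p • b p, ∑ p ∈ J, x p • b p] =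
      (6 : ℝ) • ∑ p ∈ J, ∑ q ∈ J, ∑ r ∈ J, (x p * x q * x r) • A p q r := by
    rw [ofTensor_apply]
    simp only [Matrix.cons_val]
    have s1 : ∑ p ∈ J, ∑ q ∈ J, ∑ r ∈ J, (x p * x q * x r) • A p r q =
        ∑ p ∈ J, ∑ q ∈ J, ∑ r ∈ J, (x p * x q * x r) • A p q r := by
      refine Finset.sum_congr rfl fun p _ => ?_
      rw [Finset.sum_comm]
      refine Finset.sum_congr rfl fun q _ => Finset.sum_congr rfl fun r _ => ?_
      congr 1
      ring
    have s2 : ∑ p ∈ J, ∑ q ∈ J, ∑ r ∈ J, (x p * x q * x r) • A q r p =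
        ∑ p ∈ J, ∑ q ∈ J, ∑ r ∈ J, (x p * x q * x r) • A p q r := by
      rw [Finset.sum_comm]
      refine Finset.sum_congr rfl fun q _ => ?_
      rw [Finset.sum_comm]
      refine Finset.sum_congr rfl fun r _ => Finset.sum_congr rfl fun p _ => ?_
      congr 1
      ring
    have s3 : ∑ p ∈ J, ∑ q ∈ J, ∑ r ∈ J, (inner ℝ (b p) (∑ p ∈ J, x p • b p) *
        inner ℝ (b q) (∑ p ∈ J, x p • b p) * inner ℝ (b r) (∑ p ∈ J, x p • b p)) •
          symmTensor A p q r = ∑ p ∈ J, ∑ q ∈ J, ∑ r ∈ J, ((2 : ℝ) • ((x p * x q * x r) • A p q r) +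
            (2 : ℝ) • ((x p * x q * x r) • A p r q) + (2 : ℝ) • ((x p * x q * x r) • A q r p)) := by
      refine Finset.sum_congr rfl fun p hp => Finset.sum_congr rfl fun q hq =>
        Finset.sum_congr rfl fun r hr => ?_
      rw [hu p hp, hu q hq, hu r hr, symmTensor]
      module
    rw [s3]
    simp only [Finset.sum_add_distrib, ← Finset.smul_sum, s1, s2]
    module
  have e2 : ∀ i ∈ J, (ofTensor b J (symmTensor A)).toMultilinear
      ![b i, b i, ∑ p ∈ J, x p • b p] =
      (2 : ℝ) • ∑ r ∈ J, x r • (A i i r + (2 : ℝ) • A i r i) := by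
    intro i hi
    rw [ofTensor_apply]
    simp only [Matrix.cons_val, hb]
    rw [Finset.sum_eq_single_of_mem i hi fun p' _ h' => by simp [h'],
      Finset.sum_eq_single_of_mem i hi fun q' _ h' => by simp [h'], Finset.smul_sum]
    refine Finset.sum_congr rfl fun r hr => ?_
    rw [hu r hr, symmTensor]
    simp only [if_true]
    module
  rw [e1, Finset.sum_congr rfl e2, ← Finset.smul_sum]
  module

end HS

end

/-! ### The tensor of the cubic nonlinearity and its convergence. -/

noncomputable section

open HS GaussianChaos GaussianCoordinates

/-- The element of `H^β` whose only nonzero coefficient is `z`, at the frequency `k`; it is `0`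
for `k = 0`. -/
def modeVec (β : ℝ) (k : ℤ × ℤ) (z : ℂ) : Hs β :=
  Hs.ofFinite β (fun m => if k = m then z else 0) (by
    refine Set.Finite.subset (Set.Finite.preimage Subtype.val_injective.injOn
      (Set.finite_singleton k)) fun m hm => ?_
    by_contra h
    exact hm (if_neg fun h' => h h'.symm))

theorem coeff_modeVec (β : ℝ) (k : ℤ × ℤ) (z : ℂ) (m : Mode) :
    (modeVec β k z).coeff m = if k = m then z else 0 := rfl

theorem Hs.enorm_sq {β : ℝ} (φ : Hs β) : ‖φ‖ₑ ^ 2 =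
    ∑' k : Mode, ‖freqNorm k ^ β • φ.coeff k‖ₑ ^ 2 :=
  lp_enorm_sq (Hs.toLp2 β φ)

theorem enorm_modeVec_sq (β : ℝ) (k : ℤ × ℤ) (z : ℂ) :
    ‖modeVec β k z‖ₑ ^ 2 =
      if k = 0 then 0 else ENNReal.ofReal ((freqNorm k ^ β * ‖z‖) ^ 2) := by
  rw [Hs.enorm_sq]
  split_ifs with h
  · refine ENNReal.tsum_eq_zero.2 fun m => ?_
    rw [coeff_modeVec, if_neg fun h' : k = m => m.2 (h'.symm.trans h)]
    simp
  · rw [tsum_eq_single ⟨k, h⟩ fun m hm => by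
      rw [coeff_modeVec, if_neg fun h' : k = m => hm (Subtype.ext h'.symm)]
      simp]
    rw [coeff_modeVec, if_pos rfl, enorm_pow_eq_ofReal, norm_smul,
      Real.norm_of_nonneg (Real.rpow_nonneg (freqNorm_pos ⟨k, h⟩).le _)]

/-- The nonzero Fourier coefficient of `Hs.basis 1`. -/
def basisCoeff (q : Mode × Fin 2) : ℂ := ((freqNorm q.1)⁻¹ : ℝ) • Complex.basisOneI q.2

theorem norm_basisCoeff (q : Mode × Fin 2) : ‖basisCoeff q‖ = (freqNorm q.1)⁻¹ := by
  obtain ⟨k, r⟩ := q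
  rw [basisCoeff, norm_smul, Real.norm_of_nonneg (by have := freqNorm_pos k; positivity)]
  fin_cases r <;> simp

/-- The cubic nonlinearity evaluated at three basis vectors. -/
def cubicTensor (β : ℝ) (p q r : Mode × Fin 2) : Hs β :=
  modeVec β (p.1 + q.1 - r.1) (basisCoeff p * basisCoeff q * (starRingEnd ℂ) (basisCoeff r))

/-- The frequencies that take part in the truncated nonlinearity. -/
def TruncRange (N : ℕ) (p q r : Mode × Fin 2) : Prop :=
  freqNorm p.1 ≤ N ∧ freqNorm q.1 ≤ N ∧ freqNorm r.1 ≤ N ∧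
    freqNorm (p.1 + q.1 - r.1 : ℤ × ℤ) ≤ N

open Classical in
/-- The truncation of `cubicTensor`. -/
def truncTensor (β : ℝ) (N : ℕ) (p q r : Mode × Fin 2) : Hs β :=
  if TruncRange N p q r then cubicTensor β p q r else 0

theorem truncTensor_swap (β : ℝ) (N : ℕ) (p q r : Mode × Fin 2) :
    truncTensor β N p q r = truncTensor β N q p r := by
  have h1 : TruncRange N p q r ↔ TruncRange N q p r := by
    rw [TruncRange, TruncRange, add_comm (p.1 : ℤ × ℤ)]
    tauto
  have h2 : cubicTensor β p q r = cubicTensor β q p r := by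
    rw [cubicTensor, cubicTensor, add_comm (p.1 : ℤ × ℤ), mul_comm (basisCoeff p)]
  unfold truncTensor
  by_cases h : TruncRange N p q r
  · rw [if_pos h, if_pos (h1.1 h), h2]
  · rw [if_neg h, if_neg fun h' => h (h1.2 h')]

theorem enorm_cubicTensor_sq (β : ℝ) (p q r : Mode × Fin 2) :
    ‖cubicTensor β p q r‖ₑ ^ 2 = tripleWeight β p.1 q.1 r.1 := by
  rw [cubicTensor, enorm_modeVec_sq, tripleWeight]
  simp only [norm_mul, RCLike.norm_conj, norm_basisCoeff, mul_inv]

theorem tsum_prod_fin_two (f : Mode → ℝ≥0∞) : ∑' p : Mode × Fin 2, f p.1 = 2 * ∑' k, f k := by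
  rw [ENNReal.tsum_prod (f := fun k (_ : Fin 2) => f k), ← ENNReal.tsum_mul_left]
  simp

theorem tsum_cubicTensor_ne_top {β : ℝ} (hβ : β < 0) :
    ∑' (p : Mode × Fin 2) (q : Mode × Fin 2) (r : Mode × Fin 2), ‖cubicTensor β p q r‖ₑ ^ 2 ≠
      ∞ := by
  have h1 : ∀ a b : Mode, ∑' r : Mode × Fin 2, tripleWeight β a b r.1 =
      2 * ∑' c : Mode, tripleWeight β a b c := fun a b => tsum_prod_fin_two _
  have h2 : ∀ a : Mode, ∑' q : Mode × Fin 2, 2 * ∑' c : Mode, tripleWeight β a q.1 c =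
      2 * ∑' b : Mode, 2 * ∑' c : Mode, tripleWeight β a b c := fun a =>
    tsum_prod_fin_two fun b => 2 * ∑' c : Mode, tripleWeight β a b c
  simp_rw [enorm_cubicTensor_sq, h1, h2]
  rw [tsum_prod_fin_two fun a => 2 * ∑' b : Mode, 2 * ∑' c : Mode, tripleWeight β a b c]
  simp_rw [ENNReal.tsum_mul_left]
  have := tsum_tripleWeight_ne_top hβ
  finiteness

/-- The modes with `1 ≤ |k| ≤ N`. -/
def ballModes (N : ℕ) : Finset Mode := (freqBall N).subtype fun k => k ≠ 0

theorem mem_ballModes {N : ℕ} {k : Mode} : k ∈ ballModes N ↔ freqNorm k ≤ N := by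
  rw [ballModes, Finset.mem_subtype, mem_freqBall]
  exact and_iff_right k.2

/-- The basis indices of the modes with `1 ≤ |k| ≤ N`. -/
def ballIndices (N : ℕ) : Finset (Mode × Fin 2) := ballModes N ×ˢ Finset.univ

theorem mem_ballIndices {N : ℕ} {q : Mode × Fin 2} : q ∈ ballIndices N ↔ freqNorm q.1 ≤ N := by
  rw [ballIndices, Finset.mem_product, mem_ballModes]
  exact and_iff_left (Finset.mem_univ _)

theorem monotone_ballIndices : Monotone ballIndices := fun N M h q hq =>
  mem_ballIndices.2 ((mem_ballIndices.1 hq).trans (by exact_mod_cast h))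

/-- The third gradient of the truncated nonlinearity. -/
def gradTensor (β : ℝ) (N : ℕ) : HS (Hs.basis 1) 3 (Hs β) :=
  ofTensor (Hs.basis 1) (ballIndices N) (symmTensor (truncTensor β N))

theorem isSymmetric_gradTensor (β : ℝ) (N : ℕ) : (gradTensor β N).IsSymmetric :=
  isSymmetric_ofTensor _ (symmTensor_swap_left (truncTensor_swap β N))
    (symmTensor_swap_right (truncTensor_swap β N))

theorem truncTensor_eq_zero {β : ℝ} {N : ℕ} {p q r : Mode × Fin 2}
    (h : ¬(p ∈ ballIndices N ∧ q ∈ ballIndices N ∧ r ∈ ballIndices N)) :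
    truncTensor β N p q r = 0 := by
  refine if_neg fun h' => h ?_
  simp only [mem_ballIndices]
  exact ⟨h'.1, h'.2.1, h'.2.2.1⟩

theorem gradTensor_apply_basis (β : ℝ) (N : ℕ) (p q r : Mode × Fin 2) :
    (gradTensor β N).toMultilinear ![Hs.basis 1 p, Hs.basis 1 q, Hs.basis 1 r] =
      symmTensor (truncTensor β N) p q r := by
  refine ofTensor_apply_basis (fun p q r h => ?_) p q r
  rw [symmTensor, truncTensor_eq_zero h, truncTensor_eq_zero (by tauto),
    truncTensor_eq_zero (by tauto)]
  simp

open Classical in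
-- Truncation only selects entries of one fixed square-summable tensor, so differences of
-- truncations are controlled by the tail of a convergent series.
theorem cauchySeq_gradTensor {β : ℝ} (hβ : β < 0) : CauchySeq (gradTensor β) := by
  let I := Mode × Fin 2
  let V : I × I × I → ℝ≥0∞ := fun t => ‖cubicTensor β t.1 t.2.1 t.2.2‖ₑ ^ 2
  have hV : ∑' t, V t ≠ ∞ := by
    rw [ENNReal.tsum_prod (f := fun p (t : I × I) => V (p, t))]
    simp_rw [fun p => ENNReal.tsum_prod (f := fun q r => V (p, q, r))]
    exact tsum_cubicTensor_ne_top hβ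
  let K : ℕ → Finset (I × I × I) := fun N =>
    (ballIndices N ×ˢ ballIndices N ×ˢ ballIndices N).filter fun t => TruncRange N t.1 t.2.1 t.2.2
  have hK : ∀ N t, t ∈ K N ↔ TruncRange N t.1 t.2.1 t.2.2 := by
    intro N t
    simp only [K, Finset.mem_filter, Finset.mem_product, mem_ballIndices]
    exact ⟨fun h => h.2, fun h => ⟨⟨h.1, h.2.1, h.2.2.1⟩, h⟩⟩
  have hKmono : Monotone K := by
    intro N M h t ht
    rw [hK] at ht ⊢
    have h' : (N : ℝ) ≤ M := by exact_mod_cast h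
    exact ⟨ht.1.trans h', ht.2.1.trans h', ht.2.2.1.trans h', ht.2.2.2.trans h'⟩
  have hKtop : Tendsto K atTop atTop := by
    refine tendsto_atTop_finset_of_monotone hKmono fun t => ?_
    obtain ⟨N, hN⟩ := exists_nat_ge (max (max (freqNorm t.1.1) (freqNorm t.2.1.1))
      (max (freqNorm t.2.2.1) (freqNorm (t.1.1 + t.2.1.1 - t.2.2.1 : ℤ × ℤ))))
    refine ⟨N, (hK N t).2 ?_⟩
    simp only [max_le_iff] at hN
    exact ⟨hN.1.1, hN.1.2, hN.2.1, hN.2.2⟩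
  have htail := (ENNReal.tendsto_tsum_compl_atTop_zero hV).comp hKtop
  have hle : ∀ N₀ N M, N₀ ≤ N → N₀ ≤ M →
      ‖gradTensor β N - gradTensor β M‖ₑ ^ 2 ≤ 36 * ∑' t : {t // t ∉ K N₀}, V t := by
    intro N₀ N M hN hM
    refine (enorm_sq_le_of_symmTensor (A := fun p q r => truncTensor β N p q r -
      truncTensor β M p q r) fun p q r => ?_).trans ?_
    · rw [toMultilinear_sub, _root_.sub_apply, gradTensor_apply_basis, gradTensor_apply_basis]
      simp only [symmTensor]
      module
    · gcongr
      simp_rw [← fun p => ENNReal.tsum_prod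
        (f := fun q r => ‖truncTensor β N p q r - truncTensor β M p q r‖ₑ ^ 2)]
      rw [← ENNReal.tsum_prod (f := fun p (t : I × I) =>
        ‖truncTensor β N p t.1 t.2 - truncTensor β M p t.1 t.2‖ₑ ^ 2)]
      refine le_of_le_of_eq ?_ (tsum_subtype {t | t ∉ K N₀} V).symm
      refine ENNReal.tsum_le_tsum fun t => ?_
      by_cases ht : t ∈ K N₀
      · rw [truncTensor, truncTensor, if_pos ((hK N t).1 (hKmono hN ht)),
          if_pos ((hK M t).1 (hKmono hM ht))]
        simp
      -- Off `K N₀` the difference of the two truncations is `0` or `± cubicTensor`.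
      · rw [Set.indicator_of_mem (show t ∈ {t | t ∉ K N₀} from ht)]
        rw [truncTensor, truncTensor]
        split_ifs <;> simp [V]
  rw [Metric.cauchySeq_iff]
  intro ε hε
  have hε2 : (0 : ℝ≥0∞) < ENNReal.ofReal ε ^ 2 / 36 :=
    ENNReal.div_pos (pow_ne_zero _ (ENNReal.ofReal_pos.2 hε).ne') (by simp)
  obtain ⟨N₀, hN₀⟩ := (htail.eventually_lt_const hε2).exists
  refine ⟨N₀, fun N hN M hM => ?_⟩
  have h1 := (hle N₀ N M hN hM).trans_lt
    (ENNReal.mul_lt_of_lt_div' hN₀)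
  have h2 := (ENNReal.pow_lt_pow_left_iff two_ne_zero).1 h1
  rw [← ofReal_norm, ← dist_eq_norm] at h2
  exact (ENNReal.ofReal_lt_ofReal_iff hε).1 h2

end

/-! ### The truncated nonlinearity as a Wick polynomial. -/

noncomputable section

open HS GaussianChaos GaussianCoordinates

open scoped ComplexConjugate

variable {β : ℝ} {N : ℕ}

/-- The `m`-th Fourier coefficient, as a linear form. -/
def coeffₗ (β : ℝ) (m : Mode) : Hs β →ₗ[ℝ] ℂ where
  toFun φ := φ.coeff m
  map_add' _ _ := rfl
  map_smul' _ _ := rfl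

theorem coeffₗ_apply (φ : Hs β) (m : Mode) : coeffₗ β m φ = φ.coeff m := rfl

theorem sum_realCoord_smul_basisCoeff (c : Mode → ℂ) (a : Mode) :
    ∑ i : Fin 2, (realCoord (a, i) c : ℂ) * basisCoeff (a, i) = c a := by
  have h : (freqNorm a : ℂ) ≠ 0 := by exact_mod_cast (freqNorm_pos a).ne'
  rw [Fin.sum_univ_two]
  simp only [realCoord, basisCoeff, Real.rpow_one, Complex.inner]
  apply Complex.ext <;> simp <;> field_simp [(freqNorm_pos a).ne']

/-- Since `1 + i² = 0`, pairing the two unconjugated factors contributes nothing to the counterterm.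
-/
theorem sum_basisCoeff_sq (a : Mode) : ∑ i : Fin 2, basisCoeff (a, i) * basisCoeff (a, i) = 0 := by
  rw [Fin.sum_univ_two]
  simp only [basisCoeff]
  apply Complex.ext <;> simp

/-- This is the variance of the mode, the expectation of `|φ_a|²`, and the source of the
counterterm. -/
theorem sum_basisCoeff_mul_conj (a : Mode) :
    ∑ i : Fin 2, basisCoeff (a, i) * conj (basisCoeff (a, i)) = ((2 * (1 / freqSq a) : ℝ) : ℂ) := by
  have h : ∀ i, basisCoeff (a, i) * conj (basisCoeff (a, i)) = ((1 / freqSq a : ℝ) : ℂ) := by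
    intro i
    rw [Complex.mul_conj, Complex.normSq_eq_norm_sq, norm_basisCoeff, inv_pow, freqNorm,
      Real.sq_sqrt (freqSq_pos a).le, one_div]
  simp only [h]
  simp

theorem coeff_truncTensor_of_lt {m : Mode} (hm : (m : ℤ × ℤ) ∉ freqBall N) (p q r : Mode × Fin 2) :
    (truncTensor β N p q r).coeff m = 0 := by
  rw [truncTensor]
  split_ifs with h
  · rw [cubicTensor, coeff_modeVec, if_neg]
    intro h'
    exact hm (mem_freqBall.2 ⟨m.2, h' ▸ h.2.2.2⟩)
  · rfl

theorem coeff_truncTensor {m : Mode} (hm : (m : ℤ × ℤ) ∈ freqBall N) {p q r : Mode × Fin 2}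
    (hp : p ∈ ballIndices N) (hq : q ∈ ballIndices N) (hr : r ∈ ballIndices N) :
    (truncTensor β N p q r).coeff m = (if (p.1 + q.1 - r.1 : ℤ × ℤ) = m then 1 else 0) *
      (basisCoeff p * basisCoeff q * conj (basisCoeff r)) := by
  rw [mem_ballIndices] at hp hq hr
  rw [truncTensor, ite_mul, one_mul, zero_mul]
  by_cases h : TruncRange N p q r
  · rw [if_pos h, cubicTensor, coeff_modeVec]
  · rw [if_neg h, if_neg]
    · rfl
    · intro h'
      exact h ⟨hp, hq, hr, h' ▸ (mem_freqBall.1 hm).2⟩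

theorem sum_ballIndices {M : Type} [AddCommMonoid M] (f : Mode × Fin 2 → M) :
    ∑ p ∈ ballIndices N, f p = ∑ a ∈ ballModes N, ∑ i, f (a, i) :=
  Finset.sum_product _ _ _

theorem sum_ballIndices_mul (g : Mode → ℂ) (y : Mode × Fin 2 → ℂ) :
    ∑ p ∈ ballIndices N, g p.1 * y p = ∑ a ∈ ballModes N, g a * ∑ i, y (a, i) := by
  simp only [sum_ballIndices, Finset.mul_sum]

theorem sum_ballModes (f : ℤ × ℤ → ℂ) : ∑ a ∈ ballModes N, f a = ∑ k ∈ freqBall N, f k := by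
  rw [ballModes, Finset.sum_subtype_eq_sum_filter]
  refine Finset.sum_congr (Finset.filter_true_of_mem fun k hk => ?_) fun _ _ => rfl
  exact (mem_freqBall.1 hk).1

theorem truncCoeff_coe (φ : Hs β) {a : Mode} (ha : a ∈ ballModes N) :
    truncCoeff N φ a = φ.coeff a :=
  dif_pos (mem_freqBall.2 ⟨a.2, mem_ballModes.1 ha⟩)

theorem truncCoeff_eq_zero (φ : Hs β) {k : ℤ × ℤ} (hk : k ∉ freqBall N) :
    truncCoeff N φ k = 0 := dif_neg hk

/-- The substitution `(b, c) = (l + n, l)`. -/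
def shearEquiv : (ℤ × ℤ) × (ℤ × ℤ) ≃ (ℤ × ℤ) × (ℤ × ℤ) where
  toFun t := (t.2, t.1 - t.2)
  invFun q := (q.1 + q.2, q.1)
  left_inv t := by simp
  right_inv q := by simp

/-- With `a = m - n`, `b = l + n`, `c = l` the convolution becomes a sum over `a + b - c = m`, the
form in which the tensor is indexed. -/
theorem cubicCoeff_truncCoeff (φ : Hs β) (m : ℤ × ℤ) :
    cubicCoeff (truncCoeff N φ) m = ∑ a ∈ freqBall N, ∑ b ∈ freqBall N, ∑ c ∈ freqBall N,
      (if a + b - c = m then 1 else 0) *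
        (truncCoeff N φ a * truncCoeff N φ b * conj (truncCoeff N φ c)) := by
  set ψ := truncCoeff N φ with hψ
  rw [cubicCoeff, ← shearEquiv.tsum_eq]
  rw [tsum_eq_sum (s := freqBall N ×ˢ freqBall N)]
  · rw [Finset.sum_product, Finset.sum_comm' (t' := freqBall N) (s' := fun _ => freqBall N)
      (by simp)]
    rw [Finset.sum_comm' (s := freqBall N) (t' := freqBall N) (s' := fun _ => freqBall N)
      (by simp)]
    conv_rhs => rw [Finset.sum_comm]
    refine Finset.sum_congr rfl fun b _ => ?_
    rw [Finset.sum_comm]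
    refine Finset.sum_congr rfl fun c _ => ?_
    have h : ∀ a, (a + b - c = m) ↔ a = m - (b - c) := fun a => by
      rw [eq_sub_iff_add_eq, add_sub_assoc]
    simp only [h, ite_mul, one_mul, zero_mul, shearEquiv, Equiv.coe_fn_mk,
      Finset.sum_ite_eq', add_sub_cancel]
    split_ifs with h'
    · rfl
    · rw [hψ, truncCoeff_eq_zero φ h', zero_mul, zero_mul]
  · intro t ht
    rw [Finset.mem_product, not_and_or] at ht
    simp only [shearEquiv, Equiv.coe_fn_mk, add_sub_cancel]
    rcases ht with h | h
    · rw [hψ, truncCoeff_eq_zero φ h, mul_zero, zero_mul]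
    · rw [hψ, truncCoeff_eq_zero φ h, map_zero, mul_zero]

theorem coeff_sum_truncTensor (φ : Hs β) {m : Mode} (hm : (m : ℤ × ℤ) ∈ freqBall N) :
    (∑ p ∈ ballIndices N, ∑ q ∈ ballIndices N, ∑ r ∈ ballIndices N,
      (realCoord p φ.coeff * realCoord q φ.coeff * realCoord r φ.coeff) •
        truncTensor β N p q r).coeff m = cubicCoeff (truncCoeff N φ) m := by
  set y : Mode × Fin 2 → ℂ := fun p => realCoord p φ.coeff * basisCoeff p with hy
  have hsum : ∀ a ∈ ballModes N, ∑ i, y (a, i) = truncCoeff N φ a := fun a ha => by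
    rw [truncCoeff_coe φ ha]
    exact sum_realCoord_smul_basisCoeff φ.coeff a
  have hsum' : ∀ a ∈ ballModes N, ∑ i, conj (y (a, i)) = conj (truncCoeff N φ a) := fun a ha => by
    rw [← hsum a ha, map_sum]
  rw [← coeffₗ_apply]
  simp only [map_sum, map_smul]
  -- The resonance condition depends on the frequencies only, so nesting the sums lets the two real
  -- coordinates of each mode recombine into its complex coefficient, one factor at a time.
  let e : ℤ × ℤ → ℤ × ℤ → ℤ × ℤ → ℂ := fun a b c => if a + b - c = m then 1 else 0
  calc
    _ = ∑ p ∈ ballIndices N, (∑ q ∈ ballIndices N, (∑ r ∈ ballIndices N,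
          e p.1 q.1 r.1 * conj (y r)) * y q) * y p := by
      simp only [Finset.sum_mul]
      refine Finset.sum_congr rfl fun p hp => Finset.sum_congr rfl fun q hq =>
        Finset.sum_congr rfl fun r hr => ?_
      rw [coeffₗ_apply, coeff_truncTensor hm hp hq hr, Complex.real_smul]
      simp only [hy, e, map_mul, Complex.conj_ofReal]
      push_cast
      ring
    _ = ∑ a ∈ ballModes N, (∑ b ∈ ballModes N, (∑ c ∈ ballModes N,
          e a b c * conj (truncCoeff N φ c)) * truncCoeff N φ b) * truncCoeff N φ a := by
      rw [sum_ballIndices_mul fun a => ∑ q ∈ ballIndices N, (∑ r ∈ ballIndices N,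
          e a q.1 r.1 * conj (y r)) * y q]
      refine Finset.sum_congr rfl fun a ha => ?_
      rw [hsum a ha]
      congr 1
      rw [sum_ballIndices_mul fun b => ∑ r ∈ ballIndices N, e a b r.1 * conj (y r)]
      refine Finset.sum_congr rfl fun b hb => ?_
      rw [hsum b hb]
      congr 1
      rw [sum_ballIndices_mul (fun c => e a b c) fun r => conj (y r)]
      exact Finset.sum_congr rfl fun c hc => by rw [hsum' c hc]
    _ = _ := by
      rw [cubicCoeff_truncCoeff]
      rw [sum_ballModes fun a => (∑ b ∈ ballModes N, (∑ c ∈ ballModes N,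
          e a b c * conj (truncCoeff N φ c)) * truncCoeff N φ b) * truncCoeff N φ a]
      refine Finset.sum_congr rfl fun a _ => ?_
      rw [sum_ballModes fun b => (∑ c ∈ ballModes N,
          e a b c * conj (truncCoeff N φ c)) * truncCoeff N φ b, Finset.sum_mul]
      refine Finset.sum_congr rfl fun b _ => ?_
      rw [sum_ballModes fun c => e a b c * conj (truncCoeff N φ c), Finset.sum_mul,
        Finset.sum_mul]
      refine Finset.sum_congr rfl fun c _ => ?_
      simp only [e]
      ring

/-- Only the pairings with the conjugated factor survive. They leave the frequency `p + r - p = r`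
and contribute `2 · ∑ 2/|a|²`, which is `wickConst N`. -/
theorem coeff_sum_trace_truncTensor (φ : Hs β) {m : Mode} (hm : (m : ℤ × ℤ) ∈ freqBall N) :
    (∑ p ∈ ballIndices N, ∑ r ∈ ballIndices N, realCoord r φ.coeff •
      (truncTensor β N p p r + (2 : ℝ) • truncTensor β N p r p)).coeff m =
      wickConst N * φ.coeff m := by
  rw [← coeffₗ_apply]
  simp only [map_sum, map_smul, map_add, smul_add, Finset.sum_add_distrib]
  have h1 : ∑ p ∈ ballIndices N, ∑ r ∈ ballIndices N,
      realCoord r φ.coeff • coeffₗ β m (truncTensor β N p p r) = 0 := by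
    rw [Finset.sum_comm]
    refine Finset.sum_eq_zero fun r hr => ?_
    rw [Finset.sum_congr rfl fun p hp => by
      rw [coeffₗ_apply, coeff_truncTensor hm hp hp hr, Complex.real_smul]]
    rw [Finset.sum_congr rfl fun p hp => show _ =
      ((if (p.1 + p.1 - r.1 : ℤ × ℤ) = m then 1 else 0) * (realCoord r φ.coeff *
        conj (basisCoeff r))) * (basisCoeff p * basisCoeff p) by ring]
    rw [sum_ballIndices_mul (fun a => (if (a + a - r.1 : ℤ × ℤ) = m then 1 else 0) *
      (realCoord r φ.coeff * conj (basisCoeff r))) fun p => basisCoeff p * basisCoeff p]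
    simp only [sum_basisCoeff_sq, mul_zero, Finset.sum_const_zero]
  have h2 : ∑ p ∈ ballIndices N, ∑ r ∈ ballIndices N,
      realCoord r φ.coeff • (2 : ℝ) • coeffₗ β m (truncTensor β N p r p) =
      wickConst N * φ.coeff m := by
    have hmb : m ∈ ballModes N := mem_ballModes.2 (mem_freqBall.1 hm).2
    calc
      _ = (∑ p ∈ ballIndices N, 2 * (basisCoeff p * conj (basisCoeff p))) *
          ∑ r ∈ ballIndices N, (if r.1 = m then 1 else 0) *
            (realCoord r φ.coeff * basisCoeff r) := by
        rw [Finset.sum_mul_sum]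
        refine Finset.sum_congr rfl fun p hp => Finset.sum_congr rfl fun r hr => ?_
        rw [coeffₗ_apply, coeff_truncTensor hm hp hr hp, Complex.real_smul, Complex.real_smul]
        simp only [add_sub_cancel_left, Subtype.coe_inj]
        push_cast
        ring
      _ = _ := by
        rw [sum_ballIndices_mul (fun _ => 2) fun p => basisCoeff p * conj (basisCoeff p),
          sum_ballIndices_mul (fun a => if a = m then 1 else 0) fun r =>
            realCoord r φ.coeff * basisCoeff r]
        simp only [sum_basisCoeff_mul_conj, sum_realCoord_smul_basisCoeff, ite_mul, one_mul,
          zero_mul, Finset.sum_ite_eq', if_pos hmb]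
        congr 1
        rw [sum_ballModes fun a => 2 * ((2 * (1 / freqSq a) : ℝ) : ℂ), wickConst, Finset.mul_sum]
        push_cast
        exact Finset.sum_congr rfl fun a _ => by ring
  rw [h1, h2, zero_add]

/-- The truncated nonlinearity is the Wick-ordered polynomial with the third gradient
`gradTensor β N`. -/
theorem chaos_gradTensor (φ : Hs β) (z : Fin 0 → Hs 1) :
    (chaos (fun q (φ : Hs β) => realCoord q φ.coeff) (ballIndices N) (gradTensor β N) 0
      φ).toMultilinear z = wickCubicTrunc β N φ := by
  have hu : synth (Hs.basis 1) (ballIndices N) (coordVec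
      (fun q (φ : Hs β) => realCoord q φ.coeff) (ballIndices N) φ) =
      ∑ p ∈ ballIndices N, realCoord p φ.coeff • Hs.basis 1 p := by
    simp only [synth, coordVec]
    rw [Finset.sum_coe_sort (ballIndices N) fun p => realCoord p φ.coeff • Hs.basis 1 p]
  rw [chaos, hu, gradTensor, wick_symmTensor]
  apply Hs.ext_coeff
  funext m
  have hw : (wickCubicTrunc β N φ).coeff m = wickCubicCoeff N φ m := rfl
  rw [hw, ← coeffₗ_apply, map_sub, coeffₗ_apply, coeffₗ_apply, wickCubicCoeff]
  split_ifs with hm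
  · rw [coeff_sum_truncTensor φ hm, coeff_sum_trace_truncTensor φ hm]
  · simp only [← coeffₗ_apply, map_sum, map_smul, map_add]
    simp only [coeffₗ_apply, coeff_truncTensor_of_lt hm, smul_zero, add_zero,
      Finset.sum_const_zero, sub_zero]

end

/-! ### Identification of the limit and conclusion. -/

noncomputable section

namespace HS

variable {ι H G : Type} [NormedAddCommGroup H] [InnerProductSpace ℝ H]
variable {b : HilbertBasis ι ℝ H} [NormedAddCommGroup G] [NormedSpace ℝ G]

theorem enorm_toMultilinear_of_isEmpty (T : HS b 0 G) (z : Fin 0 → H) :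
    ‖T.toMultilinear z‖ₑ = ‖T‖ₑ := by
  refine (ENNReal.pow_right_strictMono two_ne_zero).injective ?_
  rw [enorm_sq, tsum_eq_single (default : Fin 0 → ι) fun j hj =>
    absurd (Subsingleton.elim _ _) hj]
  congr 3
  exact Subsingleton.elim _ _

/-- `HS(⊗^0 H, G) = G`. -/
def evalZero (b : HilbertBasis ι ℝ H) (G : Type) [NormedAddCommGroup G] [NormedSpace ℝ G] :
    HS b 0 G →ₗᵢ[ℝ] G where
  toFun T := T.toMultilinear default
  map_add' _ _ := rfl
  map_smul' _ _ := rfl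
  norm_map' T := by
    have := enorm_toMultilinear_of_isEmpty T default
    rw [← toReal_enorm, ← toReal_enorm]
    exact congrArg ENNReal.toReal this

theorem toMultilinear_eq_evalZero (T : HS b 0 G) (z : Fin 0 → H) :
    T.toMultilinear z = evalZero b G T :=
  congrArg T.toMultilinear (Subsingleton.elim z default)

end HS

theorem MeasureTheory.ae_eq_of_tendsto_eLpNorm_sub {X E : Type} [MeasurableSpace X]
    [NormedAddCommGroup E] {μ : Measure X} {f : ℕ → X → E} {g h : X → E}
    (hf : ∀ n, AEStronglyMeasurable (f n) μ) (hg : AEStronglyMeasurable g μ)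
    (hh : AEStronglyMeasurable h μ)
    (h₁ : Tendsto (fun n => eLpNorm (fun x => f n x - g x) 1 μ) atTop (𝓝 0))
    (h₂ : Tendsto (fun n => eLpNorm (fun x => f n x - h x) 1 μ) atTop (𝓝 0)) : g =ᵐ[μ] h :=
  tendstoInMeasure_ae_unique (tendstoInMeasure_of_tendsto_eLpNorm one_ne_zero hf hg h₁)
    (tendstoInMeasure_of_tendsto_eLpNorm one_ne_zero hf hh h₂)

open HS GaussianCoordinates

theorem proposition3p4 (β : ℝ) (hβ : β < 0) :
    (∃ B : Hs β → Hs β, IsWickCubic β B) ∧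
    ∀ B : Hs β → Hs β, IsWickCubic β B →
      (∃ D : ∀ s : ℕ, Hs β → HS (Hs.basis 1) s (Hs β),
        (∀ r : ℕ, IsIteratedGradient (Hs.basis 1) (cameronMartin hβ) (gaussianMeasure β) B r D) ∧
        ∀ s p : ℕ, 1 ≤ p → MemLp (D s) p (gaussianMeasure β)) ∧
      MemWInfty (Hs.basis 1) (cameronMartin hβ) (gaussianMeasure β) B := by
  have := isProbabilityMeasure_gaussianMeasure hβ
  have hξ := gaussianCoordinates_Hs hβ
  obtain ⟨D, hD, hgrad⟩ := hξ.exists_limit monotone_ballIndices (isSymmetric_gradTensor β)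
    (fun N i hi => contract_ofTensor_eq_zero _ hi) (cauchySeq_gradTensor hβ)
  let ev := evalZero (Hs.basis 1) (Hs β)
  let B₀ : Hs β → Hs β := fun φ => ev (D 0 φ)
  have hev : ∀ N φ, wickCubicTrunc β N φ = ev (chaos (fun q (φ : Hs β) => realCoord q φ.coeff)
      (ballIndices N) (gradTensor β N) 0 φ) := fun N φ => (chaos_gradTensor φ default).symm
  have hmeas : ∀ N, AEStronglyMeasurable (wickCubicTrunc β N) (gaussianMeasure β) := by
    intro N
    have := ev.continuous.comp_aestronglyMeasurable
      (hξ.stronglyMeasurable_chaos (ballIndices N) (gradTensor β N) 0).aestronglyMeasurable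
      (μ := gaussianMeasure β)
    exact this.congr (ae_of_all _ fun φ => (hev N φ).symm)
  have hB₀m : AEStronglyMeasurable B₀ (gaussianMeasure β) :=
    ev.continuous.comp_aestronglyMeasurable (hD 0 1 le_rfl).1.1
  have hB₀ : IsWickCubic β B₀ := by
    refine ⟨hB₀m, fun p hp => (hD 0 p hp).2.congr fun N => ?_⟩
    refine eLpNorm_congr_norm_ae (ae_of_all _ fun φ => ?_)
    rw [hev, ← map_sub, LinearIsometry.norm_map]
    rfl
  refine ⟨⟨B₀, hB₀⟩, fun B hB => ?_⟩
  -- Uniqueness of `L¹` limits transfers the gradients built for `B₀` to any other version `B`.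
  have hae : B₀ =ᵐ[gaussianMeasure β] B := ae_eq_of_tendsto_eLpNorm_sub hmeas hB₀m hB.1
    (by simpa using hB₀.2 1 le_rfl) (by simpa using hB.2 1 le_rfl)
  have hiter : ∀ r, IsIteratedGradient (Hs.basis 1) (cameronMartin hβ) (gaussianMeasure β) B r D :=
    fun r => ⟨hae.mono fun φ h w => (toMultilinear_eq_evalZero (D 0 φ) w).trans h,
      fun s _ => hgrad s⟩
  have hmem : ∀ (s : ℕ) (p : ℝ≥0∞), p ≠ ∞ → MemLp (D s) p (gaussianMeasure β) := by
    intro s p hp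
    obtain ⟨n, hn⟩ := ENNReal.exists_nat_gt hp
    refine (hD s (n + 1) (by omega)).1.mono_exponent (hn.le.trans ?_)
    exact_mod_cast n.le_succ
  refine ⟨⟨D, hiter, fun s p _ => hmem s p (ENNReal.natCast_ne_top p)⟩, fun r p _ hp =>
    ⟨?_, D, hiter r, fun s _ _ => hmem s p hp⟩⟩
  exact ((hmem 0 p hp).norm.of_le hB.1 (hae.mono fun φ h => by
    rw [← h, norm_norm]; exact (ev.norm_map _).le))

end
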